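/- Let \(m>0\). On the complex Hilbert space \(L^2(\mathbb R)\) let \(K_0=-\partial_x^2+4m^2\) and let \(K=-\partial_x^2+4m^2-6m^2\,\mathrm{sech}^2(mx)\) be the linearization about the kink, both with domain \(H^2(\mathbb R)\). Let \(\psi_0(x)=\sqrt{3m/4}\,\mathrm{sech}^2(mx)\), let \(\mathbb P_0\) be the orthogonal projection of \(L^2(\mathbb R)\) onto the span of \(\psi_0\), and for \(\theta>0\) let \(K^\theta=\theta\,\mathbb P_0+K\). (1) For every \(\theta>0\) the operators \(K_0\), \(K^\theta\) have bounded, everywhere defined, non-negative inverses \(C_0=K_0^{-1}\), \(C^\theta=(K^\theta)^{-1}\), the operator \(K_0^{1/2}+\theta^{1/2}\mathbb P_0\) has a bounded everywhere defined inverse, and each of the operators \[ K_0^{1/4}\bigl((C^\theta)^{1/2}-C_0^{1/2}\bigr)K_0^{1/4},\qquad K_0^{1/4}\bigl((K_0^{1/2}+\theta^{1/2}\mathbb P_0)^{-1}-C_0^{1/2}\bigr)K_0^{1/4},\qquad K_0^{1/4}\bigl((C^\theta)^{1/2}-(K_0^{1/2}+\theta^{1/2}\mathbb P_0)^{-1}\bigr)K_0^{1/4}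 \] is trace class on \(L^2(\mathbb R)\): on its natural domain it is densely defined, and it extends to a trace-class operator on \(L^2(\mathbb R)\). (2) For \(j\in\{0,1,2,3\}\) put \[ I_j(z)=\int_{\mathbb R}\frac{k^j e^{ikz}}{(k^2+m^2)(k^2+4m^2)^{3/2}}\,dk . \] For all Schwartz functions \(f,g\) on \(\mathbb R\) and \(j\in\{0,1,2\}\), the tempered distribution \[ \Gamma_{1,j}(x,y)=(4m^2-\partial_x^2)^{1/4}(4m^2-\partial_y^2)^{1/4}\bigl(f(x)I_j(x-y)g(y)\bigr) \] is a continuous function on \(\mathbb R^2\), \(\Gamma_{1,j}(x,x)\) decays faster than any power of \(|x|\) as \(|x|\to\infty\), and \(\int_{\mathbb R}|\Gamma_{1,j}(x,x)|\,dx<\infty\). (3) For every Schwartz function \(f\) on \(\mathbb R\), the tempered distribution \[ \Gamma_2(x,y)=(4m^2-\partial_x^2)^{1/4}(4m^2-\partial_y^2)^{1/4}\Bigl[\bigl(f(x)-f(y)\bigr)I_3(x-y)\Bigr] \] is a continuous function on \(\mathbb R^2\) and \(\int_{\mathbb R}|\Gamma_2(x,x)|\,dx<\infty\). -/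

import Mathlib

open MeasureTheory
open scoped SchwartzMap Laplacian LineDeriv

noncomputable section

namespace Kink

universe u

/-- The complex Hilbert space `L²(ℝ)` (Lebesgue measure). -/
abbrev L2R : Type := Lp ℂ 2 (volume : Measure ℝ)

/-! ### General operator theory: trace class, unbounded operators -/

section Abstract

variable {H : Type u} [NormedAddCommGroup H] [InnerProductSpace ℂ H] [CompleteSpace H]

/-- A bounded operator `T` on a Hilbert space is trace class if `∑ i, ⟨e i, |T| e i⟩ < ∞` for an
orthonormal basis `e`, where `|T| = (T* T)^{1/2}`. (The sum of these nonnegative terms does not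
depend on the orthonormal basis.) -/
def IsTraceClass (T : H →L[ℂ] H) : Prop :=
  ∃ (ι : Type u) (e : HilbertBasis ι ℂ H),
    Summable fun i => (inner ℂ (e i) (CFC.abs T (e i))).re

/-- The product `A B` of two unbounded operators with its natural domain
`{f ∈ Dom B | B f ∈ Dom A}`. -/
def mulNat (A B : H →ₗ.[ℂ] H) : H →ₗ.[ℂ] H where
  domain :=
    { carrier := {f | ∃ hf : f ∈ B.domain, B ⟨f, hf⟩ ∈ A.domain}
      add_mem' := by
        rintro a b ⟨ha, ha'⟩ ⟨hb, hb'⟩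
        refine ⟨B.domain.add_mem ha hb, ?_⟩
        have h : B ⟨a + b, B.domain.add_mem ha hb⟩ = B ⟨a, ha⟩ + B ⟨b, hb⟩ :=
          B.map_add ⟨a, ha⟩ ⟨b, hb⟩
        rw [h]
        exact A.domain.add_mem ha' hb'
      zero_mem' := by
        refine ⟨B.domain.zero_mem, ?_⟩
        have h : B ⟨0, B.domain.zero_mem⟩ = 0 := B.map_zero
        rw [h]
        exact A.domain.zero_mem
      smul_mem' := by
        rintro c a ⟨ha, ha'⟩
        refine ⟨B.domain.smul_mem c ha, ?_⟩
        have h : B ⟨c • a, B.domain.smul_mem c ha⟩ = c • B ⟨a, ha⟩ := B.map_smul c ⟨a, ha⟩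
        rw [h]
        exact A.domain.smul_mem c ha' }
  toFun :=
    { toFun := fun f => A ⟨B ⟨f.1, f.2.choose⟩, f.2.choose_spec⟩
      map_add' := by
        rintro ⟨a, ha, ha'⟩ ⟨b, hb, hb'⟩
        rw [← A.map_add]
        congr 1
        exact Subtype.ext (B.map_add ⟨a, ha⟩ ⟨b, hb⟩)
      map_smul' := by
        rintro c ⟨a, ha, ha'⟩
        rw [← A.map_smul]
        congr 1
        exact Subtype.ext (B.map_smul c ⟨a, ha⟩) }

/-- A bounded operator regarded as an everywhere defined unbounded operator. -/
def ofBounded (T : H →L[ℂ] H) : H →ₗ.[ℂ] H := (T : H →ₗ[ℂ] H).toPMap ⊤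

/-- A densely defined operator is said to be trace class if it extends to a (then unique) bounded
operator on the whole space which is trace class. -/
def IsTraceClassOp (A : H →ₗ.[ℂ] H) : Prop :=
  Dense (A.domain : Set H) ∧
    ∃ B : H →L[ℂ] H, IsTraceClass B ∧ ∀ f : A.domain, A f = B f

/-- `C` is the bounded, everywhere defined inverse of the unbounded operator `A`. -/
def IsBoundedInverse (A : H →ₗ.[ℂ] H) (C : H →L[ℂ] H) : Prop :=
  (∀ f : A.domain, C (A f) = f) ∧ ∀ g : H, ∃ hg : C g ∈ A.domain, A ⟨C g, hg⟩ = g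

/-- The power `C ^ s`, `s > 0`, of a bounded nonnegative operator (functional calculus). -/
def bpow (C : H →L[ℂ] H) (s : ℝ) : H →L[ℂ] H := C ^ s

/-- The power `A ^ s`, `s > 0`, of a strictly positive self-adjoint operator `A`, expressed through
its bounded nonnegative inverse `C = A⁻¹`: it is the unbounded operator `(C ^ s)⁻¹`, with
domain `Ran (C ^ s)`. -/
def powOfInverse (C : H →L[ℂ] H) (s : ℝ) : H →ₗ.[ℂ] H := (ofBounded (bpow C s)).inverse

/-- For `C₀ = K₀⁻¹`, the operator `K₀^{1/4} T K₀^{1/4}` with its natural domain. -/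
def sandwich (C₀ T : H →L[ℂ] H) : H →ₗ.[ℂ] H :=
  mulNat (powOfInverse C₀ (1 / 4)) (mulNat (ofBounded T) (powOfInverse C₀ (1 / 4)))

end Abstract

/-! ### The Schrödinger operators `K₀`, `K`, `K^θ` -/

/-- The Sobolev space `H²(ℝ)` as a subspace of `L²(ℝ)`. -/
def H2 : Submodule ℂ L2R where
  carrier := {f | TemperedDistribution.MemSobolev 2 2 (f : 𝓢'(ℝ, ℂ))}
  add_mem' := by
    intro a b ha hb
    have h := TemperedDistribution.MemSobolev.add ha hb
    simpa only [Set.mem_ofPred_eq, ← Lp.toTemperedDistributionCLM_apply, map_add] using h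
  zero_mem' := by
    have h := TemperedDistribution.memSobolev_fun_zero ℝ ℂ 2 2
    simpa only [Set.mem_ofPred_eq, ← Lp.toTemperedDistributionCLM_apply, map_zero] using h
  smul_mem' := by
    intro c a ha
    have h := TemperedDistribution.MemSobolev.smul c ha
    simpa only [Set.mem_ofPred_eq, ← Lp.toTemperedDistributionCLM_apply, map_smul] using h

theorem toTempered_injective :
    Function.Injective (Lp.toTemperedDistributionCLM ℂ (volume : Measure ℝ) 2) := by
  have h := Lp.ker_toTemperedDistributionCLM_eq_bot (E := ℝ) (F := ℂ) (μ := volume) (p := 2)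
  exact LinearMap.ker_eq_bot.mp h

theorem exists_second_deriv (f : H2) :
    ∃ g : L2R, Lp.toTemperedDistributionCLM ℂ (volume : Measure ℝ) 2 g
      = Δ (((f : L2R) : 𝓢'(ℝ, ℂ))) := by
  have h := TemperedDistribution.MemSobolev.laplacian f.2
  have h0 : (2 - 2 : ℝ) = 0 := by norm_num
  rw [h0] at h
  obtain ⟨g, hg⟩ := TemperedDistribution.memSobolev_zero_iff.mp h
  exact ⟨g, hg.symm⟩

/-- The second derivative `∂²f ∈ L²(ℝ)` of `f ∈ H²(ℝ)`: the element of `L²(ℝ)` that represents the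
distributional second derivative (the one-dimensional Laplacian) of `f`. -/
def secondDeriv : H2 →ₗ[ℂ] L2R where
  toFun f := (exists_second_deriv f).choose
  map_add' a b := by
    apply toTempered_injective
    rw [map_add, (exists_second_deriv (a + b)).choose_spec, (exists_second_deriv a).choose_spec,
      (exists_second_deriv b).choose_spec]
    simp only [← TemperedDistribution.laplacianCLM_apply, ← Lp.toTemperedDistributionCLM_apply,
      Submodule.coe_add, map_add]
  map_smul' c a := by
    apply toTempered_injective
    rw [RingHom.id_apply, map_smul, (exists_second_deriv (c • a)).choose_spec,
      (exists_second_deriv a).choose_spec]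
    simp only [← TemperedDistribution.laplacianCLM_apply, ← Lp.toTemperedDistributionCLM_apply,
      Submodule.coe_smul, map_smul]

/-- `K₀ = -∂² + 4m²` with domain `H²(ℝ)`. -/
def K₀ (m : ℝ) : L2R →ₗ.[ℂ] L2R where
  domain := H2
  toFun := -secondDeriv + ((4 * m ^ 2 : ℝ) : ℂ) • H2.subtype

theorem sech_sq_le_one (x : ℝ) : (1 / Real.cosh x) ^ 2 ≤ 1 := by
  have h := Real.one_le_cosh x
  rw [one_div, inv_pow]
  exact inv_le_one_of_one_le₀ (one_le_pow₀ h)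

theorem sech_sq_le (x : ℝ) : (1 / Real.cosh x) ^ 2 ≤ (1 + x ^ 2)⁻¹ := by
  rw [one_div, inv_pow]
  apply inv_anti₀ (by positivity)
  have h1 : x ^ 2 ≤ Real.sinh x ^ 2 := by
    apply sq_le_sq.mpr
    rw [Real.abs_sinh]
    exact Real.self_le_sinh_iff.mpr (abs_nonneg x)
  rw [Real.cosh_sq]
  linarith

theorem continuous_sech_sq (m : ℝ) : Continuous fun x : ℝ => (1 / Real.cosh (m * x)) ^ 2 := by
  have h : ∀ x : ℝ, Real.cosh (m * x) ≠ 0 := fun x => (Real.cosh_pos _).ne'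
  fun_prop (disch := exact h _)

theorem memLp_potential (m : ℝ) :
    MemLp (fun x : ℝ => ((6 * m ^ 2 * (1 / Real.cosh (m * x)) ^ 2 : ℝ) : ℂ)) ⊤
      (volume : Measure ℝ) := by
  refine memLp_top_of_bound ?_ (6 * m ^ 2) ?_
  · have h := continuous_sech_sq m
    exact (Complex.continuous_ofReal.comp (h.const_mul _)).aestronglyMeasurable
  · refine Filter.Eventually.of_forall fun x => ?_
    rw [Complex.norm_real, Real.norm_of_nonneg (by positivity)]
    exact mul_le_of_le_one_right (by positivity) (sech_sq_le_one _)

/-- The bounded operator of multiplication by `6 m² sech²(m x)`. -/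
def potential (m : ℝ) : L2R →L[ℂ] L2R :=
  (ContinuousLinearMap.mul ℂ ℂ).holderL volume ⊤ 2 2 (memLp_potential m).toLp

/-- The linearization about the kink, `K = K₀ - 6 m² sech²(m x) = -∂² + 4m² - 6 m² sech²(m x)`,
with domain `H²(ℝ)`. -/
def K (m : ℝ) : L2R →ₗ.[ℂ] L2R := ((-potential m : L2R →L[ℂ] L2R) : L2R →ₗ[ℂ] L2R) +ᵥ K₀ m

/-- The zero mode `ψ₀(x) = √(3m/4) sech²(m x)`. -/
def zeroModeFun (m : ℝ) (x : ℝ) : ℂ := ((√(3 * m / 4) * (1 / Real.cosh (m * x)) ^ 2 : ℝ) : ℂ)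

theorem memLp_zeroModeFun (m : ℝ) : MemLp (zeroModeFun m) 2 (volume : Measure ℝ) := by
  unfold zeroModeFun
  rcases le_or_gt m 0 with hm | hm
  · have h : √(3 * m / 4) = 0 := Real.sqrt_eq_zero_of_nonpos (by linarith)
    simp [h]
  · have hc := continuous_sech_sq m
    apply MemLp.ofReal
    apply MemLp.const_mul
    rw [memLp_two_iff_integrable_sq hc.aestronglyMeasurable]
    have hi : Integrable fun x : ℝ => (1 + (m * x) ^ 2)⁻¹ :=
      integrable_inv_one_add_sq.comp_mul_left' hm.ne'
    refine hi.mono' (hc.pow 2).aestronglyMeasurable (Filter.Eventually.of_forall fun x => ?_)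
    rw [Real.norm_of_nonneg (by positivity)]
    calc ((1 / Real.cosh (m * x)) ^ 2) ^ 2
        ≤ (1 / Real.cosh (m * x)) ^ 2 :=
          pow_le_of_le_one (by positivity) (sech_sq_le_one _) two_ne_zero
      _ ≤ (1 + (m * x) ^ 2)⁻¹ := sech_sq_le _

/-- The zero mode as an element of `L²(ℝ)`. -/
def zeroMode (m : ℝ) : L2R := (memLp_zeroModeFun m).toLp

/-- The orthogonal projection onto the line spanned by the zero mode. -/
def P₀ (m : ℝ) : L2R →L[ℂ] L2R := (Submodule.span ℂ {zeroMode m}).starProjection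

/-- `K^θ = θ P₀ + K`, with domain `H²(ℝ)`. -/
def Kθ (m θ : ℝ) : L2R →ₗ.[ℂ] L2R :=
  (((θ : ℂ) • P₀ m : L2R →L[ℂ] L2R) : L2R →ₗ[ℂ] L2R) +ᵥ K m

/-- For `C₀ = K₀⁻¹`, the operator `K₀^{1/2} + θ^{1/2} P₀` with the domain of `K₀^{1/2}`. -/
def comparison (m θ : ℝ) (C₀ : L2R →L[ℂ] L2R) : L2R →ₗ.[ℂ] L2R :=
  (((√θ : ℂ) • P₀ m : L2R →L[ℂ] L2R) : L2R →ₗ[ℂ] L2R) +ᵥ powOfInverse C₀ (1 / 2)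

/-! ### Kernels on `ℝ²` -/

/-- The plane, with its Lebesgue measure. -/
abbrev Plane : Type := EuclideanSpace ℝ (Fin 2)

/-- `I_j(z) = ∫ k^j e^{ikz} / ((k² + m²) (k² + 4m²)^{3/2}) dk`. -/
def oscInt (m : ℝ) (j : ℕ) (z : ℝ) : ℂ :=
  ∫ k : ℝ, ((k ^ j / ((k ^ 2 + m ^ 2) * (k ^ 2 + 4 * m ^ 2) ^ (3 / 2 : ℝ)) : ℝ) : ℂ)
    * Complex.exp (Complex.I * k * z)

/-- The symbol of `(4m² - ∂_x²)^{1/4} (4m² - ∂_y²)^{1/4}`. Mathlib's Fourier transform uses the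
characters `e^{2πi⟨x,ξ⟩}`, so the wave numbers are `2πξ`. -/
def symbol (m : ℝ) (ξ : Plane) : ℂ :=
  (((4 * m ^ 2 + (2 * Real.pi * ξ 0) ^ 2) ^ (1 / 4 : ℝ)
    * (4 * m ^ 2 + (2 * Real.pi * ξ 1) ^ 2) ^ (1 / 4 : ℝ) : ℝ) : ℂ)

/-- The pseudodifferential operator `(4m² - ∂_x²)^{1/4} (4m² - ∂_y²)^{1/4}` on `𝓢(ℝ²)`. -/
def pseudoDiff (m : ℝ) : 𝓢(Plane, ℂ) →L[ℂ] 𝓢(Plane, ℂ) :=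
  SchwartzMap.fourierMultiplierCLM ℂ (symbol m)

/-- The function `Γ` represents the tempered distribution
`(4m² - ∂_x²)^{1/4} (4m² - ∂_y²)^{1/4} A(x, y)`, where the pseudodifferential operator (whose
symbol is even, so that it is its own transpose) acts by duality with Schwartz functions. -/
def IsPseudoDiffOf (m : ℝ) (Γ A : ℝ → ℝ → ℂ) : Prop :=
  ∀ φ : 𝓢(Plane, ℂ),
    Integrable (fun p : Plane => Γ (p 0) (p 1) * φ p) ∧
    Integrable (fun p : Plane => A (p 0) (p 1) * pseudoDiff m φ p) ∧
    ∫ p : Plane, Γ (p 0) (p 1) * φ p = ∫ p : Plane, A (p 0) (p 1) * pseudoDiff m φ p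

end Kink

end

noncomputable section

namespace Kink

/-! ### Trace class criterion, bounded inverses and sandwiched operators -/

section Abstract

universe v

variable {H : Type v} [NormedAddCommGroup H] [InnerProductSpace ℂ H] [CompleteSpace H]

/-! Operators. Put h = K₀^{-1/4}, V = 6m² sech²(mx) and W = V - θP₀, so that K^θ = K₀ - W. On Ran h
the outer factors K₀^{1/4} cancel the h's in h T h, so each difference only has to be written as h T
h with T trace class (`isTraceClassOp_sandwich`). A self-adjoint T is trace class as soon as its
absolute diagonal sums are bounded uniformly over all orthonormal bases
(`isTraceClass_of_sum_norm_inner_le`), and such bounds are stable under subtraction.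

The inverse of K^θ is h² S h² with S = (1 - h² W h²)⁻¹. It exists and is nonnegative by coercivity
(`exists_coercive`), which rests on the factorization K = A*A with A = ∂ + 2m tanh(mx), Aψ₀ = 0, and
on a Hardy-type inequality giving the gap ‖(1 - P₀)f‖ ≤ (4/m)‖Af‖ (`norm_sub_P₀_sq_le`). The square
roots are compared through C^{1/2} = const ∫ t^{-1/2} C(t + C)⁻¹ dt and the resolvent identity
iterated so that the free factor stands on both sides (`mul_resolv_sub_mul_resolv`). This yields T =
const ∫ t^{-1/2} B_t M_t B_t dt with B_t = h³(t + h⁴)⁻¹ and M_t a form of size O(t) relative to ‖√V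
x‖². Since Σ ‖√V B_t e_i‖² ≤ ∫V · ∫|b_t|² for the symbol b_t of B_t (`sum_inner_mulOp_fmul_le`),
everything reduces to the elementary bounds on t^{1/2} b_t² in `sqrt_mul_smootherSymbol_sq_le`. The
operator (K₀^{1/2} + θ^{1/2}P₀)⁻¹ is h Z h, where Z - 1 is controlled by the rank-one operator hP₀h
(`exists_inverse_comparison`).

Kernels. A product f(x) I_j(x - y) g(y) is a superposition of plane waves of frequencies (κ + ζ, -κ
+ η) with density σ_j(κ) f̂(ζ) ĝ(η), and the pseudodifferential operator multiplies this density by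
its symbol (`isPseudoDiffOf_superpose`). Peetre's inequality bounds the result by ⟨κ⟩^{j-4} times
rapidly decaying factors, hence it is integrable for j ≤ 2. For j = 3 the factor f(x) - f(y)
replaces σ(κ) by σ(κ) - σ(κ + ζ), which gains one power of ⟨κ⟩ (`IsSymbol.exists_abs_sub_le`). On
the diagonal κ drops out of the phase, and integration by parts in ζ gives decay in x
(`IsFamily.exists_fourierInv_le`). -/

theorem inner_map_comm {T : H →L[ℂ] H} (hT : IsSelfAdjoint T) (x y : H) :
    inner ℂ (T x) y = inner ℂ x (T y) := by
  conv_lhs => rw [← hT.adjoint_eq]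
  exact ContinuousLinearMap.adjoint_inner_left T y x

/-- A Hilbert space has an orthonormal basis adapted to a complemented subspace. -/
theorem exists_hilbertBasis_adapted (M : Submodule ℂ H) [CompleteSpace M] :
    ∃ (w : Set H) (b : HilbertBasis w ℂ H), ∀ i, b i ∈ M ∨ b i ∈ Mᗮ := by
  obtain ⟨u, bu, hbu⟩ := exists_hilbertBasis ℂ M
  have hu : Orthonormal ℂ (fun x : u => ((x : M) : H)) := by
    have := bu.orthonormal.comp_linearIsometry M.subtypeₗᵢ
    rw [hbu] at this
    exact this
  have hu' : Orthonormal ℂ (Subtype.val : (Subtype.val '' u : Set H) → H) := by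
    have := hu.toSubtypeRange
    have hr : Set.range (fun x : u => ((x : M) : H)) = Subtype.val '' u := by
      ext x; simp
    rwa [hr] at this
  obtain ⟨w, b, hsw, hb⟩ := hu'.exists_hilbertBasis_extension
  refine ⟨w, b, fun i => ?_⟩
  by_cases hi : (i : H) ∈ Subtype.val '' u
  · left
    obtain ⟨x, -, hx⟩ := hi
    rw [hb, ← hx]
    exact x.2
  · right
    rw [Submodule.mem_orthogonal]
    intro y hy
    -- The remaining vectors are orthogonal to a basis of M. Density of its span and continuity of
    -- the inner product extend this to all of M.
    have hall : ∀ z : M, inner ℂ (z : H) (b i) = 0 := by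
      intro z
      have hz : z ∈ (Submodule.span ℂ (Set.range bu)).topologicalClosure := by
        rw [bu.dense_span]; trivial
      have hcl : IsClosed {z : M | inner ℂ (z : H) (b i) = 0} :=
        isClosed_eq (by fun_prop) continuous_const
      refine closure_minimal ?_ hcl hz
      intro z hz
      induction hz using Submodule.span_induction with
      | mem x hx =>
        obtain ⟨j, rfl⟩ := hx
        have hj : ((bu j : M) : H) ∈ w := hsw ⟨bu j, by rw [hbu]; exact j.2, rfl⟩
        have hne : (⟨_, hj⟩ : w) ≠ i := by
          intro h
          apply hi
          rw [← h]
          exact ⟨bu j, by rw [hbu]; exact j.2, rfl⟩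
        have := b.orthonormal.2 hne
        rw [hb] at this
        simpa [hb] using this
      | zero => simp
      | add x y _ _ hx hy =>
        simp only [Set.mem_ofPred_eq, Submodule.coe_add, inner_add_left] at hx hy ⊢
        rw [hx, hy, add_zero]
      | smul c x _ hx =>
        simp only [Set.mem_ofPred_eq, Submodule.coe_smul, inner_smul_left] at hx ⊢
        rw [hx, mul_zero]
    exact hall ⟨y, hy⟩

/-- A self-adjoint operator whose diagonal is uniformly summable in all orthonormal bases is trace
class. -/
theorem isTraceClass_of_sum_norm_inner_le {T : H →L[ℂ] H} (hT : IsSelfAdjoint T) (C : ℝ)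
    (hC : ∀ (ι : Type v) (e : HilbertBasis ι ℂ H) (s : Finset ι),
      ∑ i ∈ s, ‖inner ℂ (e i) (T (e i))‖ ≤ C) : IsTraceClass T := by
  have hneg : IsSelfAdjoint (T⁻) := (CFC.negPart_nonneg T).isSelfAdjoint
  have hpos : IsSelfAdjoint (T⁺) := (CFC.posPart_nonneg T).isSelfAdjoint
  have : CompleteSpace (LinearMap.ker (T⁻ : H →L[ℂ] H).toLinearMap) :=
    (ContinuousLinearMap.isClosed_ker (T⁻ : H →L[ℂ] H)).completeSpace_coe
  -- Since T⁻T⁺ = 0, the range of T⁺ lies in ker T⁻, so T⁺ kills the orthogonal complement of ker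
  -- T⁻. Each vector of an adapted basis is therefore killed by T⁻ or by T⁺, and |T| acts on it as T
  -- or as -T.
  obtain ⟨w, b, hb⟩ := exists_hilbertBasis_adapted (LinearMap.ker (T⁻ : H →L[ℂ] H).toLinearMap)
  refine ⟨w, b, ?_⟩
  have habs : CFC.abs T = T⁺ + T⁻ := (CFC.posPart_add_negPart T hT).symm
  have hsub : T = T⁺ - T⁻ := (CFC.posPart_sub_negPart T hT).symm
  have hle : ∀ i, ‖(inner ℂ (b i) (CFC.abs T (b i))).re‖ ≤ ‖inner ℂ (b i) (T (b i))‖ := by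
    intro i
    rcases hb i with h | h
    · have h0 : (T⁻ : H →L[ℂ] H) (b i) = 0 := h
      have h1 : CFC.abs T (b i) = T (b i) := by
        rw [habs]
        conv_rhs => rw [hsub]
        simp [h0]
      rw [h1]
      exact Complex.abs_re_le_norm _
    · have h0 : (T⁺ : H →L[ℂ] H) (b i) = 0 := by
        rw [← inner_self_eq_zero (𝕜 := ℂ), inner_map_comm hpos, ← inner_conj_symm]
        have hk : (T⁺ : H →L[ℂ] H) ((T⁺ : H →L[ℂ] H) (b i)) ∈
            LinearMap.ker (T⁻ : H →L[ℂ] H).toLinearMap := by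
          have := congrArg (fun S : H →L[ℂ] H => S ((T⁺ : H →L[ℂ] H) (b i)))
            (CFC.negPart_mul_posPart T)
          exact this
        rw [(Submodule.mem_orthogonal _ _).1 h _ hk, map_zero]
      have h1 : CFC.abs T (b i) = - T (b i) := by
        rw [habs]
        conv_rhs => rw [hsub]
        simp [h0]
      rw [h1, inner_neg_right, Complex.neg_re, norm_neg]
      exact Complex.abs_re_le_norm _
  refine Summable.of_norm_bounded ?_ hle
  exact summable_of_sum_le (fun i => norm_nonneg _) (hC w b)

omit [CompleteSpace H] in
/-- Inverse of a bounded perturbation. -/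
theorem IsBoundedInverse.vadd {A : H →ₗ.[ℂ] H} {G E S : H →L[ℂ] H}
    (hA : IsBoundedInverse A (G * G)) (hS : S * (1 + G * E * G) = 1)
    (hS' : (1 + G * E * G) * S = 1) :
    IsBoundedInverse ((E : H →ₗ[ℂ] H) +ᵥ A) (G * S * G) := by
  -- The resolvent identity (A + E)⁻¹ = A⁻¹ - A⁻¹E(A + E)⁻¹. It exhibits the values of GSG as values
  -- of A⁻¹ = GG, which puts them in the domain of A.
  have key : G * S * G = G * G - G * G * E * (G * S * G) := by
    have : G * (S + G * E * G * S) * G = G * G := by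
      have h : S + G * E * G * S = 1 := by rw [← hS']; noncomm_ring
      rw [h, mul_one]
    calc G * S * G = G * (S + G * E * G * S) * G - G * G * E * (G * S * G) := by noncomm_ring
      _ = _ := by rw [this]
  constructor
  · intro f
    have hf : (f : H) = G (G (A f)) := (hA.1 f).symm
    have h1 : ((E : H →ₗ[ℂ] H) +ᵥ A : H →ₗ.[ℂ] H) f = E f + A f := rfl
    have h2 : (S * (1 + G * E * G)) (G (A f)) = G (A f) := by rw [hS]; rfl
    calc (G * S * G) (((E : H →ₗ[ℂ] H) +ᵥ A : H →ₗ.[ℂ] H) f)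
        = G (S (G (E (G (G (A f))) + A f))) := by rw [h1, ← hf]; rfl
      _ = G ((S * (1 + G * E * G)) (G (A f))) := by
        congr 1
        simp only [mul_apply_eq_comp, add_apply,
          one_apply_eq_self, map_add]
        abel
      _ = f := by rw [h2, ← hf]
  · intro g
    have hg : (G * S * G) g = (G * G) (g - E ((G * S * G) g)) := by
      conv_lhs => rw [key]
      simp
    obtain ⟨hd, he⟩ := hA.2 (g - E ((G * S * G) g))
    have hd' : (G * S * G) g ∈ A.domain := by rw [hg]; exact hd
    refine ⟨hd', ?_⟩
    have h1 : ((E : H →ₗ[ℂ] H) +ᵥ A : H →ₗ.[ℂ] H) ⟨(G * S * G) g, hd'⟩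
        = E ((G * S * G) g) + A ⟨(G * S * G) g, hd'⟩ := rfl
    have h2 : A ⟨(G * S * G) g, hd'⟩ = g - E ((G * S * G) g) := by
      rw [← he]
      congr 1
      exact Subtype.ext hg
    rw [h1, h2]
    abel

omit [CompleteSpace H] in
theorem isBoundedInverse_inverse {T : H →L[ℂ] H} (hT : ∀ x, T x = 0 → x = 0) :
    IsBoundedInverse (ofBounded T).inverse T := by
  have hker : LinearMap.ker (ofBounded T).toFun = ⊥ := by
    rw [LinearMap.ker_eq_bot']
    intro x hx
    exact Subtype.ext (hT x hx)
  have hval : ∀ x : H, ∃ hx : T x ∈ (ofBounded T).inverse.domain,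
      (ofBounded T).inverse ⟨T x, hx⟩ = x := by
    intro x
    have hx : T x ∈ (ofBounded T).inverse.domain := by
      rw [LinearPMap.inverse_domain]
      exact ⟨⟨x, trivial⟩, rfl⟩
    exact ⟨hx, LinearPMap.inverse_apply_eq hker (x := ⟨x, trivial⟩) rfl⟩
  refine ⟨?_, hval⟩
  rintro ⟨f, hf⟩
  have hf' := hf
  rw [LinearPMap.inverse_domain] at hf'
  obtain ⟨⟨x, _⟩, rfl⟩ := hf'
  obtain ⟨hx, h⟩ := hval x
  exact congrArg T h

theorem mem_powOfInverse_domain {C : H →L[ℂ] H} {s : ℝ} {f : H} :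
    f ∈ (powOfInverse C s).domain ↔ ∃ x, bpow C s x = f := by
  unfold powOfInverse
  rw [LinearPMap.inverse_domain]
  constructor
  · rintro ⟨⟨x, _⟩, hx⟩; exact ⟨x, hx⟩
  · rintro ⟨x, hx⟩; exact ⟨⟨x, trivial⟩, hx⟩

/-- The outer factors are h⁻¹ with domain Ran h. As X maps into Ran h, the natural domain of the
product is exactly Ran h, on which h⁻¹(hTh)h⁻¹ = T. This range is dense because h is self-adjoint
and injective. -/
theorem isTraceClassOp_sandwich {C₀ h X T : H →L[ℂ] H} (hC : bpow C₀ (1 / 4) = h)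
    (hh : IsSelfAdjoint h) (hinj : ∀ x, h x = 0 → x = 0) (hX : X = h * T * h)
    (hT : IsTraceClass T) : IsTraceClassOp (sandwich C₀ X) := by
  have hinv : IsBoundedInverse (powOfInverse C₀ (1 / 4)) h := by
    unfold powOfInverse
    rw [hC]
    exact isBoundedInverse_inverse hinj
  have hdom : ∀ f, f ∈ (sandwich C₀ X).domain ↔ ∃ x, h x = f := by
    intro f
    constructor
    · rintro ⟨⟨hf, _⟩, _⟩
      rw [mem_powOfInverse_domain, hC] at hf
      exact hf
    · rintro ⟨x, rfl⟩
      obtain ⟨hx, hx'⟩ := hinv.2 x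
      refine ⟨⟨hx, trivial⟩, ?_⟩
      change X (powOfInverse C₀ (1 / 4) ⟨h x, hx⟩) ∈ _
      rw [hx', mem_powOfInverse_domain, hC, hX]
      exact ⟨T (h x), rfl⟩
  refine ⟨?_, T, hT, ?_⟩
  · have hr : ((sandwich C₀ X).domain : Set H) = (LinearMap.range (h : H →ₗ[ℂ] H) : Set H) := by
      ext f
      exact hdom f
    rw [hr, Submodule.dense_iff_topologicalClosure_eq_top,
      Submodule.topologicalClosure_eq_top_iff, Submodule.eq_bot_iff]
    intro y hy
    apply hinj
    rw [← inner_self_eq_zero (𝕜 := ℂ), inner_map_comm hh]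
    exact (Submodule.mem_orthogonal' _ _).1 hy _ ⟨h y, rfl⟩
  · rintro ⟨f, hf⟩
    obtain ⟨x, rfl⟩ := (hdom _).1 hf
    obtain ⟨hx, hx'⟩ := hinv.2 x
    obtain ⟨hy, hy'⟩ := hinv.2 (T (h x))
    have hXx : X (powOfInverse C₀ (1 / 4) ⟨h x, hx⟩) = h (T (h x)) := by
      rw [hx', hX]; rfl
    change powOfInverse C₀ (1 / 4) ⟨X (powOfInverse C₀ (1 / 4) ⟨h x, hx⟩), _⟩ = T (h x)
    rw [← hy']
    congr 1
    exact Subtype.ext hXx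

end Abstract

/-! ### Resolvents of nonnegative operators and the integral for the square root -/

section Resolvent

universe v

variable {H : Type v} [NormedAddCommGroup H] [InnerProductSpace ℂ H] [CompleteSpace H]

/-- The resolvent `(t + C)⁻¹`. -/
def resolv (C : H →L[ℂ] H) (t : ℝ) : H →L[ℂ] H := Ring.inverse ((t : ℂ) • 1 + C)

theorem isUnit_smul_one_add {C : H →L[ℂ] H} (hC : 0 ≤ C) {t : ℝ} (ht : 0 < t) :
    IsUnit ((t : ℂ) • 1 + C) := by
  have h : (-t) ∉ spectrum ℝ C := fun hs => by
    have := spectrum_nonneg_of_nonneg hC hs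
    linarith
  rw [spectrum.notMem_iff] at h
  have h2 := h.neg
  have : -((algebraMap ℝ (H →L[ℂ] H)) (-t) - C) = (t : ℂ) • 1 + C := by
    ext x
    simp [Algebra.algebraMap_eq_smul_one, add_comm]
  rwa [this] at h2

theorem mul_resolv {C : H →L[ℂ] H} (hC : 0 ≤ C) {t : ℝ} (ht : 0 < t) :
    ((t : ℂ) • 1 + C) * resolv C t = 1 :=
  Ring.mul_inverse_cancel _ (isUnit_smul_one_add hC ht)

theorem resolv_mul {C : H →L[ℂ] H} (hC : 0 ≤ C) {t : ℝ} (ht : 0 < t) :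
    resolv C t * ((t : ℂ) • 1 + C) = 1 :=
  Ring.inverse_mul_cancel _ (isUnit_smul_one_add hC ht)

theorem isSelfAdjoint_resolv {C : H →L[ℂ] H} (hC : 0 ≤ C) (t : ℝ) :
    IsSelfAdjoint (resolv C t) := by
  have hs : star C = C := hC.isSelfAdjoint.star_eq
  rw [IsSelfAdjoint, resolv, ← Ring.inverse_star]
  simp [hs]

/-- Pairing tx + Cx = y with x and dropping ⟨x, Cx⟩ ≥ 0 leaves t‖x‖² ≤ ‖x‖‖y‖. -/
theorem norm_resolv_le {C : H →L[ℂ] H} (hC : 0 ≤ C) {t : ℝ} (ht : 0 < t) :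
    ‖resolv C t‖ ≤ t⁻¹ := by
  refine ContinuousLinearMap.opNorm_le_bound _ (by positivity) fun y => ?_
  set x := resolv C t y with hx
  have hy : (t : ℂ) • x + C x = y := by
    have := congrArg (fun S : H →L[ℂ] H => S y) (mul_resolv hC ht)
    simpa using this
  have hpos : 0 ≤ (inner ℂ x (C x)).re :=
    ((ContinuousLinearMap.nonneg_iff_isPositive C).1 hC).re_inner_nonneg_right x
  have h1 : t * ‖x‖ ^ 2 ≤ (inner ℂ x y).re := by
    rw [← hy, inner_add_right, inner_smul_right, inner_self_eq_norm_sq_to_K]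
    simp only [Complex.add_re, Complex.mul_re, Complex.ofReal_re, Complex.ofReal_im]
    norm_cast
    have e : ∀ r : ℝ, (RCLike.ofReal r : ℂ).re = r := fun r => Complex.ofReal_re r
    rw [e]
    linarith
  have h2 : (inner ℂ x y).re ≤ ‖x‖ * ‖y‖ :=
    (Complex.re_le_norm _).trans (norm_inner_le_norm x y)
  rcases eq_or_lt_of_le (norm_nonneg x) with h0 | h0
  · rw [← h0]; positivity
  · have h3 : t * ‖x‖ ≤ ‖y‖ := by
      by_contra hcon
      push Not at hcon
      have := mul_lt_mul_of_pos_left hcon h0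
      nlinarith
    rw [inv_mul_eq_div, le_div_iff₀ ht]
    linarith

theorem continuousOn_resolv {C : H →L[ℂ] H} (hC : 0 ≤ C) :
    ContinuousOn (resolv C) (Set.Ioi 0) := by
  intro t ht
  obtain ⟨u, hu⟩ := isUnit_smul_one_add hC ht
  have h1 := NormedRing.inverse_continuousAt u
  rw [hu] at h1
  have h2 : ContinuousAt (fun t : ℝ => (t : ℂ) • (1 : H →L[ℂ] H) + C) t := by fun_prop
  exact (ContinuousAt.comp (f := fun t : ℝ => (t : ℂ) • (1 : H →L[ℂ] H) + C)
    h1 h2).continuousWithinAt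

theorem mul_resolv_eq {C : H →L[ℂ] H} (hC : 0 ≤ C) {t : ℝ} (ht : 0 < t) :
    C * resolv C t = 1 - (t : ℂ) • resolv C t := by
  rw [eq_sub_iff_add_eq, add_comm]
  simpa [add_mul] using mul_resolv hC ht

/-- The sharp constant is 1; the triangle inequality in C(t + C)⁻¹ = 1 - t(t + C)⁻¹ gives 2, which
is enough. -/
theorem norm_mul_resolv_le {C : H →L[ℂ] H} (hC : 0 ≤ C) {t : ℝ} (ht : 0 < t) :
    ‖C * resolv C t‖ ≤ 2 := by
  rw [mul_resolv_eq hC ht]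
  refine (norm_sub_le _ _).trans ?_
  have h1 : ‖(1 : H →L[ℂ] H)‖ ≤ 1 := ContinuousLinearMap.norm_id_le
  have h2 : ‖(t : ℂ) • resolv C t‖ ≤ 1 := by
    rw [norm_smul, Complex.norm_real, Real.norm_of_nonneg ht.le]
    calc t * ‖resolv C t‖ ≤ t * t⁻¹ := by gcongr; exact norm_resolv_le hC ht
      _ = 1 := mul_inv_cancel₀ ht.ne'
  linarith

theorem commute_resolv {C X : H →L[ℂ] H} (hC : 0 ≤ C) {t : ℝ} (ht : 0 < t) (h : Commute X C) :
    Commute X (resolv C t) := by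
  have hX : X * ((t : ℂ) • 1 + C) = ((t : ℂ) • 1 + C) * X := by
    rw [mul_add, add_mul, h.eq]; simp
  calc X * resolv C t
      = resolv C t * (((t : ℂ) • 1 + C) * X) * resolv C t := by
        rw [← mul_assoc, resolv_mul hC ht, one_mul]
    _ = resolv C t * X * (((t : ℂ) • 1 + C) * resolv C t) := by rw [← hX]; noncomm_ring
    _ = resolv C t * X := by rw [mul_resolv hC ht, mul_one]

/-- The constant in the integral representation of the square root. -/
def sqrtConst : ℝ := (∫ t in Set.Ioi 0, Real.rpowIntegrand₀₁ (1 / 2) t 1)⁻¹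

/-- For x ≥ 0 the scalar integrand is t^{-1/2} x/(t + x). The denominator is cleared inside the
functional calculus and put back as the resolvent. -/
theorem cfc_rpowIntegrand {C : H →L[ℂ] H} (hC : 0 ≤ C) {t : ℝ} (ht : 0 < t) :
    cfc (Real.rpowIntegrand₀₁ (1 / 2) t) C = (t ^ (-1 / 2 : ℝ) : ℝ) • (C * resolv C t) := by
  have hspec : ∀ x ∈ spectrum ℝ C, 0 ≤ x := fun x hx => spectrum_nonneg_of_nonneg hC hx
  have hcont : ContinuousOn (Real.rpowIntegrand₀₁ (1 / 2) t) (spectrum ℝ C) :=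
    (Real.continuousOn_rpowIntegrand₀₁_Ici (by norm_num) ht).mono hspec
  have h1 : cfc (fun x => Real.rpowIntegrand₀₁ (1 / 2) t x * (t + x)) C
      = cfc (fun x => (t ^ (-1 / 2 : ℝ)) * x) C := by
    refine cfc_congr fun x hx => ?_
    have hx0 := hspec x hx
    have : t + x ≠ 0 := by positivity
    rw [Real.rpowIntegrand₀₁_eq_pow_div (by norm_num) ht.le hx0]
    norm_num
    field_simp
  rw [cfc_mul _ _ C hcont (by fun_prop), cfc_const_mul_id _ _ hC.isSelfAdjoint,
    cfc_const_add t _ C (by fun_prop), cfc_id' ℝ C hC.isSelfAdjoint] at h1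
  have h2 : (algebraMap ℝ (H →L[ℂ] H)) t + C = (t : ℂ) • 1 + C := by
    ext x
    simp [Algebra.algebraMap_eq_smul_one]
  rw [h2] at h1
  calc cfc (Real.rpowIntegrand₀₁ (1 / 2) t) C
      = cfc (Real.rpowIntegrand₀₁ (1 / 2) t) C * ((t : ℂ) • 1 + C) * resolv C t := by
        rw [mul_assoc, mul_resolv hC ht, mul_one]
    _ = _ := by rw [h1, smul_mul_assoc]

/-- The scalar formula √x = const ∫ t^{-1/2} x/(t + x) dt passes through the functional calculus:
the integrand increases with x, so its value at an upper bound M of the spectrum dominates it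
uniformly. -/
theorem rpow_half_eq_integral {C : H →L[ℂ] H} (hC : 0 ≤ C) :
    IntegrableOn (fun t : ℝ => (t ^ (-1 / 2 : ℝ) : ℝ) • (C * resolv C t)) (Set.Ioi 0) ∧
    bpow C (1 / 2)
      = sqrtConst • ∫ t in Set.Ioi (0 : ℝ), (t ^ (-1 / 2 : ℝ) : ℝ) • (C * resolv C t) := by
  have hp : (1 / 2 : ℝ) ∈ Set.Ioo (0 : ℝ) 1 := by norm_num
  have hspec : ∀ x ∈ spectrum ℝ C, 0 ≤ x := fun x hx => spectrum_nonneg_of_nonneg hC hx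
  have hspec' : ∀ x ∈ spectrum ℝ C, x ≤ ‖C‖ * ‖(1 : H →L[ℂ] H)‖ := fun x hx =>
    (le_abs_self x).trans (spectrum.norm_le_norm_mul_of_mem hx)
  set M := ‖C‖ * ‖(1 : H →L[ℂ] H)‖
  have hM : 0 ≤ M := by positivity
  have hf : ContinuousOn (Function.uncurry (Real.rpowIntegrand₀₁ (1 / 2)))
      (Set.Ioi (0 : ℝ) ×ˢ spectrum ℝ C) :=
    Real.continuousOn_rpowIntegrand₀₁_uncurry hp _ hspec
  have hbound : ∀ᵐ t ∂(volume.restrict (Set.Ioi (0 : ℝ))), ∀ z ∈ spectrum ℝ C,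
      ‖Real.rpowIntegrand₀₁ (1 / 2) t z‖ ≤ ‖Real.rpowIntegrand₀₁ (1 / 2) t M‖ := by
    filter_upwards [ae_restrict_mem measurableSet_Ioi] with t ht z hz
    have ht' : 0 ≤ t := le_of_lt ht
    rw [Real.norm_of_nonneg (Real.rpowIntegrand₀₁_nonneg hp.1 ht' (hspec z hz)),
      Real.norm_of_nonneg (Real.rpowIntegrand₀₁_nonneg hp.1 ht' hM)]
    exact Real.rpowIntegrand₀₁_monotoneOn hp ht' (hspec z hz) hM (hspec' z hz)
  have hfin : HasFiniteIntegral (fun t => ‖Real.rpowIntegrand₀₁ (1 / 2) t M‖)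
      (volume.restrict (Set.Ioi (0 : ℝ))) := by
    rw [hasFiniteIntegral_norm_iff]
    exact (Real.integrableOn_rpowIntegrand₀₁_Ioi hp hM).2
  have hcongr : Set.EqOn (fun t : ℝ => cfc (Real.rpowIntegrand₀₁ (1 / 2) t) C)
      (fun t : ℝ => (t ^ (-1 / 2 : ℝ) : ℝ) • (C * resolv C t)) (Set.Ioi 0) :=
    fun t ht => cfc_rpowIntegrand hC ht
  have hint := integrableOn_cfc measurableSet_Ioi _ _ C hf hbound hfin hC.isSelfAdjoint
  refine ⟨(integrableOn_congr_fun hcongr measurableSet_Ioi).1 hint, ?_⟩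
  rw [← setIntegral_congr_fun measurableSet_Ioi hcongr,
    ← cfc_setIntegral measurableSet_Ioi _ _ C hf hbound hfin hC.isSelfAdjoint]
  have hcI : ContinuousOn (fun r => ∫ t in Set.Ioi 0, Real.rpowIntegrand₀₁ (1 / 2) t r)
      (spectrum ℝ C) := by
    refine ContinuousOn.congr (f := fun r : ℝ =>
      r ^ (1 / 2 : ℝ) * ∫ t in Set.Ioi 0, Real.rpowIntegrand₀₁ (1 / 2) t 1) ?_ ?_
    · exact ((Real.continuous_rpow_const (by norm_num)).mul continuous_const).continuousOn
    · intro r hr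
      exact Real.integral_rpowIntegrand₀₁_eq_rpow_mul_const hp (hspec r hr)
  rw [← cfc_smul (R := ℝ) sqrtConst _ C hcI, bpow, CFC.rpow_eq_cfc_real hC]
  refine cfc_congr fun r hr => ?_
  rw [Real.rpow_eq_const_mul_integral hp (hspec r hr), smul_eq_mul, sqrtConst]

end Resolvent

/-! ### Uniform diagonal bounds, coercivity and the iterated resolvent identity -/

section Perturbation

universe v

variable {H : Type v} [NormedAddCommGroup H] [InnerProductSpace ℂ H] [CompleteSpace H]

/-- Uniform boundedness of the absolute diagonal sums over all orthonormal bases. -/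
def DiagonalBounded (T : H →L[ℂ] H) : Prop :=
  ∃ c : ℝ, ∀ (ι : Type v) (e : HilbertBasis ι ℂ H) (s : Finset ι),
    ∑ i ∈ s, ‖inner ℂ (e i) (T (e i))‖ ≤ c

omit [CompleteSpace H] in
-- Additivity is immediate here because the bound does not involve |T|. This makes the third trace
-- class statement a consequence of the first two.
theorem DiagonalBounded.sub {S T : H →L[ℂ] H} (hS : DiagonalBounded S) (hT : DiagonalBounded T) :
    DiagonalBounded (S - T) := by
  obtain ⟨a, ha⟩ := hS
  obtain ⟨b, hb⟩ := hT
  refine ⟨a + b, fun ι e s => ?_⟩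
  refine le_trans ?_ (add_le_add (ha ι e s) (hb ι e s))
  rw [← Finset.sum_add_distrib]
  refine Finset.sum_le_sum fun i _ => ?_
  rw [sub_apply, inner_sub_right]
  exact norm_sub_le _ _

theorem DiagonalBounded.isTraceClass {T : H →L[ℂ] H} (h : DiagonalBounded T)
    (hT : IsSelfAdjoint T) : IsTraceClass T :=
  isTraceClass_of_sum_norm_inner_le hT h.choose h.choose_spec

omit [CompleteSpace H] in
-- The form of T is dominated by a multiple of |⟨u, ψ⟩|², and Bessel's inequality sums this to a
-- multiple of ‖ψ‖² in every basis.
theorem diagonalBounded_of_rankOne_bound {T Q : H →L[ℂ] H} (κ : ℝ) (ψ : H) (k : ℝ)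
    (hκ : 0 ≤ κ) (hT : ∀ u, ‖inner ℂ u (T u)‖ ≤ κ * ‖Q u‖ ^ 2)
    (hQ : ∀ u, ‖Q u‖ ≤ k * ‖inner ℂ u ψ‖) : DiagonalBounded T := by
  refine ⟨κ * (k ^ 2 * ‖ψ‖ ^ 2), fun ι e s => ?_⟩
  calc ∑ i ∈ s, ‖inner ℂ (e i) (T (e i))‖
      ≤ ∑ i ∈ s, κ * (k ^ 2 * ‖inner ℂ (e i) ψ‖ ^ 2) := by
        refine Finset.sum_le_sum fun i _ => (hT _).trans ?_
        gcongr
        rw [← mul_pow]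
        exact pow_le_pow_left₀ (norm_nonneg _) (hQ _) 2
    _ = κ * (k ^ 2 * ∑ i ∈ s, ‖inner ℂ (e i) ψ‖ ^ 2) := by
        rw [Finset.mul_sum, Finset.mul_sum]
    _ ≤ _ := by
        gcongr
        exact e.orthonormal.sum_inner_products_le ψ

theorem isUnit_of_coercive {S : H →L[ℂ] H} {c : ℝ} (hc : 0 < c)
    (h : ∀ u, c * ‖u‖ ^ 2 ≤ (inner ℂ u (S u)).re) : IsUnit S := by
  refine ContinuousLinearMap.isUnit_of_forall_le_norm_inner_map S (c := ⟨c, hc.le⟩) hc fun u => ?_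
  rw [← inner_conj_symm, RCLike.norm_conj]
  have := (h u).trans (Complex.re_le_norm _)
  change ‖u‖ ^ 2 * c ≤ _
  linarith

theorem inverse_nonneg_of_coercive {S : H →L[ℂ] H} (hS : IsSelfAdjoint S) {c : ℝ} (hc : 0 < c)
    (h : ∀ u, c * ‖u‖ ^ 2 ≤ (inner ℂ u (S u)).re) : 0 ≤ Ring.inverse S := by
  have hu := isUnit_of_coercive hc h
  have hsa : IsSelfAdjoint (Ring.inverse S) := by
    rw [IsSelfAdjoint, ← Ring.inverse_star, hS.star_eq]
  rw [ContinuousLinearMap.nonneg_iff_isPositive, ContinuousLinearMap.isPositive_def']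
  refine ⟨hsa, fun x => ?_⟩
  have hx : S (Ring.inverse S x) = x := by
    have := congrArg (fun T : H →L[ℂ] H => T x) (Ring.mul_inverse_cancel _ hu)
    simpa using this
  have h1 := h (Ring.inverse S x)
  rw [hx] at h1
  rw [ContinuousLinearMap.reApplyInnerSelf_apply]
  exact le_trans (by positivity) h1

theorem mul_mul_nonneg {X Y : H →L[ℂ] H} (hX : IsSelfAdjoint X) (hY : 0 ≤ Y) : 0 ≤ X * Y * X := by
  have := star_left_conjugate_nonneg hY X
  rwa [hX.star_eq] at this

theorem bpow_pow_mul {h : H →L[ℂ] H} (hh : 0 ≤ h) {n : ℕ} {s : ℝ} (hs : 0 ≤ s) :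
    bpow (h ^ n) s = h ^ (n * s : ℝ) := by
  rw [bpow, ← CFC.rpow_natCast h n hh,
    CFC.rpow_rpow_of_exponent_nonneg h n s (by positivity) hs hh]

theorem bpow_four_quarter {h : H →L[ℂ] H} (hh : 0 ≤ h) : bpow (h ^ 4) (1 / 4) = h := by
  rw [bpow_pow_mul hh (by norm_num)]
  norm_num
  exact CFC.rpow_one h hh

theorem bpow_four_half {h : H →L[ℂ] H} (hh : 0 ≤ h) : bpow (h ^ 4) (1 / 2) = h ^ 2 := by
  rw [bpow_pow_mul hh (by norm_num)]
  norm_num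
  exact_mod_cast CFC.rpow_natCast h 2 hh

/-- Second resolvent identity, iterated once. -/
theorem mul_resolv_sub_mul_resolv {C C' W : H →L[ℂ] H} (hC : 0 ≤ C) (hC' : 0 ≤ C')
    (hW : IsSelfAdjoint W) (h : C' - C = C * W * C') {t : ℝ} (ht : 0 < t) :
    C' * resolv C' t - C * resolv C t
      = (C * resolv C t) * ((t : ℂ) • W + (t : ℂ) ^ 2 • (W * (C' * resolv C' t) * W))
        * (C * resolv C t) := by
  have h' : C' - C = C' * W * C := by
    have := congrArg star h
    simpa [hC.isSelfAdjoint.star_eq, hC'.isSelfAdjoint.star_eq, hW.star_eq, mul_assoc] using this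
  have hcC : resolv C t * C = C * resolv C t :=
    (commute_resolv hC ht (Commute.refl C)).symm.eq
  have hcC' : resolv C' t * C' = C' * resolv C' t :=
    (commute_resolv hC' ht (Commute.refl C')).symm.eq
  have hd : ((t : ℂ) • 1 + C') - ((t : ℂ) • 1 + C) = C' - C := by abel
  set J := resolv C t
  set J' := resolv C' t
  have e0 : C' * J' - C * J = (t : ℂ) • (J - J') := by
    rw [mul_resolv_eq hC ht, mul_resolv_eq hC' ht, smul_sub]; abel
  have e1 : J - J' = J * (C' - C) * J' := by
    rw [← hd, mul_sub, sub_mul, resolv_mul hC ht, mul_assoc, mul_resolv hC' ht]; simp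
  have e2 : J - J' = J' * (C' - C) * J := by
    rw [← hd, mul_sub, sub_mul, resolv_mul hC' ht, mul_assoc, mul_resolv hC ht]; simp
  -- Two first-order expansions, with C'J' on the right in `f1` and on the left in `f2`. Inserting
  -- `f2` into `f1` leaves CJ as the outer factor on both sides and confines C'J' to the middle.
  have f1 : C' * J' = C * J + (t : ℂ) • ((C * J) * W * (C' * J')) := by
    rw [← hcC, ← sub_eq_iff_eq_add', hcC, e0, e1, h, ← hcC]
    congr 1
  have f2 : C' * J' = C * J + (t : ℂ) • ((C' * J') * W * (C * J)) := by
    rw [← sub_eq_iff_eq_add', e0, e2, h', ← hcC']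
    congr 1
  conv_lhs => rw [f1]
  conv_lhs => rw [f2]
  rw [mul_add, mul_add, add_mul, smul_add]
  simp only [smul_mul_assoc, mul_smul_comm, smul_smul, pow_two, add_sub_cancel_left,
    mul_assoc]

end Perturbation

/-! ### Integral formula for the difference of square roots -/

section Perturbation

universe v

variable {H : Type v} [NormedAddCommGroup H] [InnerProductSpace ℂ H] [CompleteSpace H]

/-- The operator `h³ (t + h⁴)⁻¹`. -/
def smoother (h : H →L[ℂ] H) (t : ℝ) : H →L[ℂ] H := h ^ 3 * resolv (h ^ 4) t

omit [CompleteSpace H] in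
theorem mul_smoother {h : H →L[ℂ] H} (t : ℝ) :
    h * smoother h t = h ^ 4 * resolv (h ^ 4) t := by
  rw [smoother, ← mul_assoc, ← pow_succ']

theorem commute_smoother {h : H →L[ℂ] H} (hh : 0 ≤ h) {t : ℝ} (ht : 0 < t) :
    Commute h (smoother h t) :=
  (Commute.pow_right rfl 3).mul_right
    (commute_resolv (CStarAlgebra.pow_nonneg hh 4) ht (Commute.pow_right rfl 4))

theorem isSelfAdjoint_smoother {h : H →L[ℂ] H} (hh : 0 ≤ h) {t : ℝ} (ht : 0 < t) :
    IsSelfAdjoint (smoother h t) := by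
  have h4 : 0 ≤ h ^ 4 := CStarAlgebra.pow_nonneg hh 4
  rw [IsSelfAdjoint, smoother, star_mul, (isSelfAdjoint_resolv h4 t).star_eq, star_pow,
    hh.isSelfAdjoint.star_eq]
  exact (commute_resolv h4 ht ((Commute.refl h).pow_pow 3 4)).symm.eq

/-- Write R = (t + h⁴)⁻¹. The bound t⁻¹, useful for small t, comes from (h³R)² = (h⁴R)(h²R) with h⁴R
bounded. The bound t⁻², useful for large t, comes from ‖R‖ ≤ t⁻¹ alone. -/
theorem norm_smoother_sq_le {h : H →L[ℂ] H} (hh : 0 ≤ h) :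
    ∃ c : ℝ, 0 ≤ c ∧ ∀ t : ℝ, 0 < t → ‖smoother h t‖ ^ 2 ≤ c * t⁻¹ ∧
      ‖smoother h t‖ ^ 2 ≤ c * (t⁻¹ * t⁻¹) := by
  have h4 : 0 ≤ h ^ 4 := CStarAlgebra.pow_nonneg hh 4
  refine ⟨2 * ‖h‖ ^ 2 + (‖h‖ ^ 3) ^ 2, by positivity, fun t ht => ?_⟩
  have hJ := norm_resolv_le h4 ht
  have hJ' := norm_mul_resolv_le h4 ht
  have hpow : ∀ n : ℕ, 0 < n → ‖h ^ n‖ ≤ ‖h‖ ^ n := fun n hn => norm_pow_le' h hn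
  have hti : 0 < t⁻¹ := inv_pos.2 ht
  constructor
  · have h1 : ‖smoother h t‖ ^ 2 = ‖smoother h t * smoother h t‖ := by
      have := CStarRing.norm_star_mul_self (x := smoother h t)
      rw [(isSelfAdjoint_smoother hh ht).star_eq] at this
      rw [this, sq]
    have h2 : smoother h t * smoother h t
        = (h ^ 4 * resolv (h ^ 4) t) * (h ^ 2 * resolv (h ^ 4) t) := by
      have hc : Commute (h ^ 3) (resolv (h ^ 4) t) :=
        commute_resolv h4 ht ((Commute.refl h).pow_pow 3 4)
      have hc' : Commute (h ^ 2) (resolv (h ^ 4) t) :=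
        commute_resolv h4 ht ((Commute.refl h).pow_pow 2 4)
      calc smoother h t * smoother h t
          = h ^ 3 * (resolv (h ^ 4) t * h ^ 3) * resolv (h ^ 4) t := by
            simp only [smoother, mul_assoc]
        _ = h ^ 4 * (h ^ 2 * resolv (h ^ 4) t) * resolv (h ^ 4) t := by
            rw [← hc.eq]; simp only [← mul_assoc, ← pow_add]
        _ = _ := by rw [hc'.eq]; simp only [mul_assoc]; rw [hc'.eq]
    rw [h1, h2]
    calc _ ≤ ‖h ^ 4 * resolv (h ^ 4) t‖ * (‖h ^ 2‖ * ‖resolv (h ^ 4) t‖) :=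
          (norm_mul_le _ _).trans (by gcongr; exact norm_mul_le _ _)
      _ ≤ 2 * (‖h‖ ^ 2 * t⁻¹) := by gcongr; exact hpow 2 (by norm_num)
      _ ≤ _ := by
        rw [add_mul, mul_assoc]
        exact le_add_of_nonneg_right (by positivity)
  · have h1 : ‖smoother h t‖ ≤ ‖h‖ ^ 3 * t⁻¹ :=
      (norm_mul_le _ _).trans (by gcongr; exact hpow 3 (by norm_num))
    calc ‖smoother h t‖ ^ 2 ≤ (‖h‖ ^ 3 * t⁻¹) ^ 2 := by gcongr
      _ = (‖h‖ ^ 3) ^ 2 * (t⁻¹ * t⁻¹) := by ring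
      _ ≤ _ := by
        rw [add_mul (2 * ‖h‖ ^ 2)]
        exact le_add_of_nonneg_left (by positivity)

theorem continuousOn_smoother {h : H →L[ℂ] H} (hh : 0 ≤ h) :
    ContinuousOn (smoother h) (Set.Ioi 0) :=
  continuousOn_const.mul (continuousOn_resolv (CStarAlgebra.pow_nonneg hh 4))

/-- The middle factor in the second order resolvent expansion. -/
def bulk (W C' : H →L[ℂ] H) (t : ℝ) : H →L[ℂ] H :=
  (t : ℂ) • W + (t : ℂ) ^ 2 • (W * (C' * resolv C' t) * W)

/-- The resolvent absorbs one of the two powers of t, so that the second-order term of `bulk` is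
O(t), like the first-order one. -/
theorem norm_sq_smul_mul_resolv_le {C' : H →L[ℂ] H} (hC' : 0 ≤ C') {t : ℝ} (ht : 0 < t) :
    t ^ 2 * ‖C' * resolv C' t‖ ≤ t * ‖C'‖ := by
  calc t ^ 2 * ‖C' * resolv C' t‖ ≤ t ^ 2 * (‖C'‖ * t⁻¹) := by
        gcongr
        exact (norm_mul_le _ _).trans (by gcongr; exact norm_resolv_le hC' ht)
    _ = t * ‖C'‖ := by field_simp

theorem norm_bulk_le {W C' : H →L[ℂ] H} (hC' : 0 ≤ C') {t : ℝ} (ht : 0 < t) :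
    ‖bulk W C' t‖ ≤ t * (‖W‖ + ‖W‖ * ‖C'‖ * ‖W‖) := by
  have hR := norm_sq_smul_mul_resolv_le hC' ht
  have h1 : ‖(t : ℂ) • W‖ = t * ‖W‖ := by
    rw [norm_smul, Complex.norm_real, Real.norm_of_nonneg ht.le]
  have h2 : ‖(t : ℂ) ^ 2 • (W * (C' * resolv C' t) * W)‖ ≤ ‖W‖ * (t * ‖C'‖) * ‖W‖ := by
    rw [norm_smul, norm_pow, Complex.norm_real, Real.norm_of_nonneg ht.le]
    calc t ^ 2 * ‖W * (C' * resolv C' t) * W‖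
        ≤ t ^ 2 * (‖W‖ * ‖C' * resolv C' t‖ * ‖W‖) := by
          gcongr
          exact (norm_mul_le _ _).trans (by gcongr; exact norm_mul_le _ _)
      _ = ‖W‖ * (t ^ 2 * ‖C' * resolv C' t‖) * ‖W‖ := by ring
      _ ≤ _ := by gcongr
  calc ‖bulk W C' t‖ ≤ t * ‖W‖ + ‖W‖ * (t * ‖C'‖) * ‖W‖ :=
        (norm_add_le _ _).trans (add_le_add h1.le h2)
    _ = _ := by ring

/-- A bound by a form p, not only by ‖x‖², is needed because p is what sums over a basis after
smoothing; in the application p x = ‖√V x‖². The second-order term is a form in W x, hence the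
hypothesis on ‖W x‖². -/
theorem norm_inner_bulk_le {W C' : H →L[ℂ] H} (hW : IsSelfAdjoint W) (hC' : 0 ≤ C') {p : H → ℝ}
    {κ : ℝ} (h1 : ∀ x, ‖inner ℂ x (W x)‖ ≤ κ * p x) (h2 : ∀ x, ‖W x‖ ^ 2 ≤ κ * p x)
    {t : ℝ} (ht : 0 < t) (x : H) :
    ‖inner ℂ x (bulk W C' t x)‖ ≤ t * (κ * (1 + ‖C'‖) * p x) := by
  have hR := norm_sq_smul_mul_resolv_le hC' ht
  have e : inner ℂ x (bulk W C' t x)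
      = t * inner ℂ x (W x) + (t : ℂ) ^ 2 * inner ℂ (W x) ((C' * resolv C' t) (W x)) := by
    rw [inner_map_comm hW]
    simp only [bulk, add_apply, smul_apply, inner_add_right, inner_smul_right]
    rfl
  have e1 : ‖(t : ℂ) * inner ℂ x (W x)‖ ≤ t * (κ * p x) := by
    rw [norm_mul, Complex.norm_real, Real.norm_of_nonneg ht.le]
    gcongr
    exact h1 x
  have e2 : ‖(t : ℂ) ^ 2 * inner ℂ (W x) ((C' * resolv C' t) (W x))‖
      ≤ t * ‖C'‖ * (κ * p x) := by
    rw [norm_mul, norm_pow, Complex.norm_real, Real.norm_of_nonneg ht.le]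
    calc t ^ 2 * ‖inner ℂ (W x) ((C' * resolv C' t) (W x))‖
        ≤ t ^ 2 * (‖W x‖ * (‖C' * resolv C' t‖ * ‖W x‖)) := by
          gcongr
          exact (norm_inner_le_norm _ _).trans
            (by gcongr; exact ContinuousLinearMap.le_opNorm _ _)
      _ = (t ^ 2 * ‖C' * resolv C' t‖) * ‖W x‖ ^ 2 := by ring
      _ ≤ t * ‖C'‖ * (κ * p x) := by gcongr; exact h2 x
  rw [e]
  calc _ ≤ t * (κ * p x) + t * ‖C'‖ * (κ * p x) := (norm_add_le _ _).trans (add_le_add e1 e2)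
    _ = _ := by ring

theorem isSelfAdjoint_bulk {W C' : H →L[ℂ] H} (hW : IsSelfAdjoint W) (hC' : 0 ≤ C') {t : ℝ}
    (ht : 0 < t) : IsSelfAdjoint (bulk W C' t) := by
  have hc : resolv C' t * C' = C' * resolv C' t :=
    (commute_resolv hC' ht (Commute.refl C')).symm.eq
  rw [IsSelfAdjoint, bulk]
  simp [hW.star_eq, hC'.isSelfAdjoint.star_eq, (isSelfAdjoint_resolv hC' t).star_eq, hc, mul_assoc]

theorem continuousOn_bulk {W C' : H →L[ℂ] H} (hC' : 0 ≤ C') :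
    ContinuousOn (bulk W C') (Set.Ioi 0) := by
  have h1 := continuousOn_resolv hC'
  unfold bulk
  have h2 : ContinuousOn (fun t : ℝ => (t : ℂ)) (Set.Ioi 0) := Complex.continuous_ofReal.continuousOn
  exact (h2.smul continuousOn_const).add ((h2.pow 2).smul
    ((continuousOn_const.mul (continuousOn_const.mul h1)).mul continuousOn_const))

/-- The integrand representing the difference of the two inverse square roots, stripped of the outer
factors `h`. -/
def sqrtDiffIntegrand (h W C' : H →L[ℂ] H) (t : ℝ) : H →L[ℂ] H :=
  (t ^ (-1 / 2 : ℝ) : ℝ) • (smoother h t * bulk W C' t * smoother h t)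

theorem integrableOn_sqrtDiffIntegrand {h W C' : H →L[ℂ] H} (hh : 0 ≤ h) (hC' : 0 ≤ C') :
    IntegrableOn (sqrtDiffIntegrand h W C') (Set.Ioi 0) := by
  obtain ⟨c, hc, hB⟩ := norm_smoother_sq_le hh
  set M := ‖W‖ + ‖W‖ * ‖C'‖ * ‖W‖ with hMdef
  have hM : 0 ≤ M := by positivity
  have hcont : ContinuousOn (sqrtDiffIntegrand h W C') (Set.Ioi 0) := by
    have hr : ContinuousOn (fun t : ℝ => t ^ (-1 / 2 : ℝ)) (Set.Ioi 0) :=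
      ContinuousOn.rpow_const continuousOn_id fun t ht => Or.inl (ne_of_gt ht)
    exact hr.smul (((continuousOn_smoother hh).mul (continuousOn_bulk hC')).mul
      (continuousOn_smoother hh))
  have hbd : ∀ t : ℝ, 0 < t →
      ‖sqrtDiffIntegrand h W C' t‖ ≤ t ^ (-1 / 2 : ℝ) * (t * M) * ‖smoother h t‖ ^ 2 := by
    intro t ht
    have ht' : 0 ≤ t ^ (-1 / 2 : ℝ) := Real.rpow_nonneg ht.le _
    rw [sqrtDiffIntegrand, norm_smul, Real.norm_of_nonneg ht']
    calc _ ≤ t ^ (-1 / 2 : ℝ) * (‖smoother h t‖ * (t * M) * ‖smoother h t‖) := by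
          gcongr
          refine (norm_mul_le _ _).trans ?_
          gcongr
          refine (norm_mul_le _ _).trans ?_
          gcongr
          exact norm_bulk_le hC' ht
      _ = _ := by ring
  have hmeas := fun s (hs : s ⊆ Set.Ioi (0 : ℝ)) (hs' : MeasurableSet s) =>
    (hcont.mono hs).aestronglyMeasurable (μ := volume) hs'
  -- The factor t^{-1/2} · t meets t⁻¹ on (0, 1] and t⁻² on (1, ∞), leaving the integrable powers
  -- t^{-1/2} and t^{-3/2}.
  rw [← Set.Ioc_union_Ioi_eq_Ioi zero_le_one]
  refine IntegrableOn.union ?_ ?_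
  · have hi : IntegrableOn (fun t : ℝ => (M * c) * t ^ (-1 / 2 : ℝ)) (Set.Ioc 0 1) := by
      have := intervalIntegral.intervalIntegrable_rpow' (a := 0) (b := 1)
        (r := (-1 / 2 : ℝ)) (by norm_num)
      rw [intervalIntegrable_iff_integrableOn_Ioc_of_le zero_le_one] at this
      exact this.const_mul _
    refine Integrable.mono' hi (hmeas _ Set.Ioc_subset_Ioi_self measurableSet_Ioc) ?_
    refine ae_restrict_of_forall_mem measurableSet_Ioc fun t ht => ?_
    have ht0 : 0 < t := ht.1
    refine (hbd t ht0).trans ?_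
    calc _ ≤ t ^ (-1 / 2 : ℝ) * (t * M) * (c * t⁻¹) := by
          gcongr
          exact (hB t ht0).1
      _ = _ := by field_simp
  · have hi : IntegrableOn (fun t : ℝ => (M * c) * t ^ (-3 / 2 : ℝ)) (Set.Ioi 1) :=
      (integrableOn_Ioi_rpow_of_lt (by norm_num) one_pos).const_mul _
    refine Integrable.mono' hi (hmeas _ (Set.Ioi_subset_Ioi zero_le_one) measurableSet_Ioi) ?_
    refine ae_restrict_of_forall_mem measurableSet_Ioi fun t ht => ?_
    have ht0 : 0 < t := zero_lt_one.trans ht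
    refine (hbd t ht0).trans ?_
    have e : t ^ (-3 / 2 : ℝ) = t ^ (-1 / 2 : ℝ) * t⁻¹ := by
      rw [← Real.rpow_neg_one t, ← Real.rpow_add ht0]; norm_num
    calc _ ≤ t ^ (-1 / 2 : ℝ) * (t * M) * (c * (t⁻¹ * t⁻¹)) := by
          gcongr
          exact (hB t ht0).2
      _ = _ := by rw [e]; field_simp

/-- The operator `T` with `h T h = C'^{1/2} - (h⁴)^{1/2}`. -/
def sqrtDiff (h W C' : H →L[ℂ] H) : H →L[ℂ] H :=
  sqrtConst • ∫ t in Set.Ioi (0 : ℝ), sqrtDiffIntegrand h W C' t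

theorem bpow_half_sub_bpow_half {h W C' : H →L[ℂ] H} (hh : 0 ≤ h) (hC' : 0 ≤ C')
    (hW : IsSelfAdjoint W) (hd : C' - h ^ 4 = h ^ 4 * W * C') :
    bpow C' (1 / 2) - bpow (h ^ 4) (1 / 2) = h * sqrtDiff h W C' * h := by
  have h4 : 0 ≤ h ^ 4 := CStarAlgebra.pow_nonneg hh 4
  obtain ⟨i1, e1⟩ := rpow_half_eq_integral hC'
  obtain ⟨i2, e2⟩ := rpow_half_eq_integral h4
  have hi := integrableOn_sqrtDiffIntegrand (W := W) hh hC'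
  rw [e1, e2, ← smul_sub, ← integral_sub i1 i2, sqrtDiff, mul_smul_comm, smul_mul_assoc,
    ← integral_const_mul_of_integrable hi, ← integral_mul_const_of_integrable (hi.const_mul h)]
  congr 1
  refine setIntegral_congr_fun measurableSet_Ioi fun t ht => ?_
  have ht' : 0 < t := ht
  rw [← smul_sub, mul_resolv_sub_mul_resolv h4 hC' hW hd ht', ← mul_smoother, sqrtDiffIntegrand,
    mul_smul_comm, smul_mul_assoc]
  congr 1
  -- The right-hand copy of h · `smoother` is flipped so that an h stands outermost on the right as
  -- well.
  conv_lhs =>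
    rhs
    rw [(commute_smoother hh ht').eq]
  simp only [bulk, mul_assoc]

theorem isSelfAdjoint_sqrtDiff {h W C' : H →L[ℂ] H} (hh : 0 ≤ h) (hC' : 0 ≤ C')
    (hW : IsSelfAdjoint W) : IsSelfAdjoint (sqrtDiff h W C') := by
  rw [IsSelfAdjoint, sqrtDiff, star_smul, star_trivial]
  congr 1
  have := (starL' ℝ : (H →L[ℂ] H) ≃L[ℝ] (H →L[ℂ] H)).integral_comp_comm
    (μ := volume.restrict (Set.Ioi 0)) (sqrtDiffIntegrand h W C')
  simp only [starL'_apply] at this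
  rw [← this]
  refine setIntegral_congr_fun measurableSet_Ioi fun t ht => ?_
  have ht' : 0 < t := ht
  simp only [sqrtDiffIntegrand, star_smul, star_trivial, star_mul,
    (isSelfAdjoint_smoother hh ht').star_eq, (isSelfAdjoint_bulk hW hC' ht').star_eq, mul_assoc]

/-- Diagonal entries are continuous linear in the operator, so they pass under the integral, and the
finite sum is bounded at each t before integrating. The weight t^{1/2} is t^{-1/2} from the square
root formula times the factor t from `norm_inner_bulk_le`. -/
theorem diagonalBounded_sqrtDiff {h W C' : H →L[ℂ] H} (hh : 0 ≤ h) (hC' : 0 ≤ C')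
    (hW : IsSelfAdjoint W) {p : H → ℝ} {κ : ℝ} (hκ : 0 ≤ κ)
    (h1 : ∀ x, ‖inner ℂ x (W x)‖ ≤ κ * p x) (h2 : ∀ x, ‖W x‖ ^ 2 ≤ κ * p x)
    {φ : ℝ → ℝ} (hφ : IntegrableOn (fun t => t ^ (1 / 2 : ℝ) * φ t) (Set.Ioi 0))
    (hp : ∀ t, 0 < t → ∀ (ι : Type v) (e : HilbertBasis ι ℂ H) (s : Finset ι),
      ∑ i ∈ s, p (smoother h t (e i)) ≤ φ t) :
    DiagonalBounded (sqrtDiff h W C') := by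
  have hi := integrableOn_sqrtDiffIntegrand (W := W) hh hC'
  set κ' := κ * (1 + ‖C'‖) with hκ'
  have hκ0 : 0 ≤ κ' := by positivity
  refine ⟨|sqrtConst| * ∫ t in Set.Ioi (0 : ℝ), κ' * (t ^ (1 / 2 : ℝ) * φ t), fun ι e s => ?_⟩
  have hL : ∀ u : H, IntegrableOn (fun t => inner ℂ u (sqrtDiffIntegrand h W C' t u)) (Set.Ioi 0) ∧
      inner ℂ u (sqrtDiff h W C' u)
        = sqrtConst • ∫ t in Set.Ioi (0 : ℝ), inner ℂ u (sqrtDiffIntegrand h W C' t u) := by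
    intro u
    let L : (H →L[ℂ] H) →L[ℂ] ℂ := (innerSL ℂ u).comp (ContinuousLinearMap.apply ℂ H u)
    refine ⟨L.integrable_comp hi, ?_⟩
    have := L.integral_comp_comm hi
    change _ = sqrtConst • ∫ t in Set.Ioi (0 : ℝ), L (sqrtDiffIntegrand h W C' t)
    rw [this]
    simp [sqrtDiff, L]
  calc ∑ i ∈ s, ‖inner ℂ (e i) (sqrtDiff h W C' (e i))‖
      ≤ ∑ i ∈ s, |sqrtConst| *
          ∫ t in Set.Ioi (0 : ℝ), ‖inner ℂ (e i) (sqrtDiffIntegrand h W C' t (e i))‖ := by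
        refine Finset.sum_le_sum fun i _ => ?_
        rw [(hL (e i)).2, norm_smul, Real.norm_eq_abs]
        gcongr
        exact norm_integral_le_integral_norm _
    _ = |sqrtConst| * ∫ t in Set.Ioi (0 : ℝ),
          ∑ i ∈ s, ‖inner ℂ (e i) (sqrtDiffIntegrand h W C' t (e i))‖ := by
        rw [← Finset.mul_sum, integral_finsetSum]
        exact fun i _ => (hL (e i)).1.norm
    _ ≤ _ := by
        gcongr 1
        refine setIntegral_mono_on
          (integrable_finsetSum _ fun i _ => (hL (e i)).1.norm) (hφ.const_mul κ')
          measurableSet_Ioi fun t ht => ?_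
        have ht' : 0 < t := ht
        have hB := isSelfAdjoint_smoother hh ht'
        calc ∑ i ∈ s, ‖inner ℂ (e i) (sqrtDiffIntegrand h W C' t (e i))‖
            ≤ ∑ i ∈ s, t ^ (-1 / 2 : ℝ) * (t * (κ' * p (smoother h t (e i)))) := by
              refine Finset.sum_le_sum fun i _ => ?_
              have e1 : inner ℂ (e i) (sqrtDiffIntegrand h W C' t (e i))
                  = ((t ^ (-1 / 2 : ℝ) : ℝ) : ℂ)
                    * inner ℂ (smoother h t (e i)) (bulk W C' t (smoother h t (e i))) := by
                rw [inner_map_comm hB, ← inner_smul_right, Complex.coe_smul]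
                rfl
              rw [e1, norm_mul, Complex.norm_real,
                Real.norm_of_nonneg (Real.rpow_nonneg ht'.le _)]
              exact mul_le_mul_of_nonneg_left (norm_inner_bulk_le hW hC' h1 h2 ht' _)
                (Real.rpow_nonneg ht'.le _)
          _ = κ' * (t ^ (1 / 2 : ℝ) * ∑ i ∈ s, p (smoother h t (e i))) := by
              have e2 : t ^ (1 / 2 : ℝ) = t ^ (-1 / 2 : ℝ) * t := by
                rw [← Real.rpow_add_one ht'.ne']; norm_num
              rw [e2, Finset.mul_sum, Finset.mul_sum]
              exact Finset.sum_congr rfl fun i _ => by ring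
          _ ≤ κ' * (t ^ (1 / 2 : ℝ) * φ t) := by
              have := Real.rpow_nonneg ht'.le (1 / 2)
              gcongr
              exact hp t ht' ι e s

end Perturbation

/-! ### Abstract comparison of the three inverses -/

section Perturbation

universe v

variable {H : Type v} [NormedAddCommGroup H] [InnerProductSpace ℂ H] [CompleteSpace H]

/-- Trace class comparison of `(h⁻² + √θ P)⁻¹` with `h²`. -/
theorem exists_inverse_comparison {h P : H →L[ℂ] H} (hh : 0 ≤ h) (hinj : ∀ x, h x = 0 → x = 0)
    (hP : IsSelfAdjoint P) (hPP : P * P = P) (ψ : H) (k : ℝ)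
    (hψ : ∀ u, ‖P u‖ ≤ k * ‖inner ℂ u ψ‖) (r : ℝ) (hr : 0 ≤ r) :
    ∃ S : H →L[ℂ] H,
      IsBoundedInverse ((((r : ℂ) • P : H →L[ℂ] H) : H →ₗ[ℂ] H) +ᵥ
        (powOfInverse (h ^ 4) (1 / 2) : H →ₗ.[ℂ] H)) (h * S * h) ∧
      IsSelfAdjoint (S - 1) ∧ DiagonalBounded (S - 1) := by
  have hsh := hh.isSelfAdjoint
  set X : H →L[ℂ] H := h * ((r : ℂ) • P) * h with hX
  have hXQ : X = (r : ℂ) • (h * P * (P * h)) := by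
    rw [hX, mul_smul_comm, smul_mul_assoc, mul_assoc h P (P * h), ← mul_assoc P P h, hPP, mul_assoc]
  have hXsa : IsSelfAdjoint X := by
    rw [IsSelfAdjoint, hX]
    simp [hsh.star_eq, hP.star_eq, mul_assoc]
  have hXu : ∀ u, inner ℂ u (X u) = ((r * ‖(P * h) u‖ ^ 2 : ℝ) : ℂ) := by
    intro u
    have : X u = (r : ℂ) • h (P (P (h u))) := by rw [hXQ]; rfl
    rw [this, inner_smul_right, ← inner_map_comm hsh, ← inner_map_comm hP,
      inner_self_eq_norm_sq_to_K]
    push_cast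
    rfl
  have hcoer : ∀ u, 1 * ‖u‖ ^ 2 ≤ (inner ℂ u ((1 + X) u)).re := by
    intro u
    rw [add_apply, inner_add_right, hXu, Complex.add_re, Complex.ofReal_re]
    have h1 : (inner ℂ u ((1 : H →L[ℂ] H) u)).re = ‖u‖ ^ 2 := by
      have := inner_self_eq_norm_sq (𝕜 := ℂ) u
      exact this
    rw [h1, one_mul]
    exact le_add_of_nonneg_right (by positivity)
  have hu := isUnit_of_coercive one_pos hcoer
  set S := Ring.inverse (1 + X) with hS
  have hS1 : S * (1 + X) = 1 := Ring.inverse_mul_cancel _ hu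
  have hS2 : (1 + X) * S = 1 := Ring.mul_inverse_cancel _ hu
  have hSsa : IsSelfAdjoint S := by
    rw [IsSelfAdjoint, hS, ← Ring.inverse_star, star_add, star_one, hXsa.star_eq]
  have hinv : IsBoundedInverse (powOfInverse (h ^ 4) (1 / 2) : H →ₗ.[ℂ] H) (h * h) := by
    unfold powOfInverse
    rw [bpow_four_half hh, pow_two]
    exact isBoundedInverse_inverse fun x hx => hinj _ (hinj _ hx)
  refine ⟨S, hinv.vadd hS1 hS2, hSsa.sub (IsSelfAdjoint.one _), ?_⟩
  -- Expanding the inverse from the left and from the right leaves X at both ends of the remainder,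
  -- so each term of the form is controlled by ‖P h u‖².
  have hexp : S - 1 = X * S * X - X := by
    have e1 : S = 1 - X * S := by
      rw [eq_sub_iff_add_eq, ← hS2]; noncomm_ring
    have e2 : S = 1 - S * X := by
      rw [eq_sub_iff_add_eq, ← hS1]; noncomm_ring
    have e3 : S = 1 - X * (1 - S * X) := by rw [← e2]; exact e1
    rw [sub_eq_iff_eq_add]
    conv_lhs => rw [e3]
    noncomm_ring
  have hQn : ∀ u, ‖X u‖ ≤ r * ‖h * P‖ * ‖(P * h) u‖ := by
    intro u
    have : X u = (r : ℂ) • (h * P) ((P * h) u) := by rw [hXQ]; rfl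
    rw [this, norm_smul, Complex.norm_real, Real.norm_of_nonneg hr, mul_assoc]
    gcongr
    exact ContinuousLinearMap.le_opNorm _ _
  refine diagonalBounded_of_rankOne_bound (Q := P * h)
    (‖S‖ * (r * ‖h * P‖) ^ 2 + r) (h ψ) k (by positivity) ?_ ?_
  · intro u
    have e : inner ℂ u ((S - 1) u) = inner ℂ (X u) (S (X u)) - inner ℂ u (X u) := by
      rw [hexp, inner_map_comm hXsa, ← inner_sub_right]
      rfl
    rw [e, hXu]
    refine (norm_sub_le _ _).trans ?_
    rw [add_mul]
    refine add_le_add ?_ ?_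
    · calc ‖inner ℂ (X u) (S (X u))‖ ≤ ‖X u‖ * (‖S‖ * ‖X u‖) :=
          (norm_inner_le_norm _ _).trans (by gcongr; exact S.le_opNorm _)
        _ = ‖S‖ * ‖X u‖ ^ 2 := by ring
        _ ≤ ‖S‖ * (r * ‖h * P‖ * ‖(P * h) u‖) ^ 2 := by gcongr; exact hQn u
        _ = _ := by ring
    · rw [Complex.norm_real, Real.norm_of_nonneg (by positivity)]
  · intro u
    have := hψ (h u)
    rwa [inner_map_comm hsh] at this

/-- Abstract form of the comparison of inverse square roots: `A` plays the role of `h⁻⁴`, and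
`A - W` is a perturbation of it that stays coercive. -/
theorem exists_inverses_traceClass {A : H →ₗ.[ℂ] H} {h W P : H →L[ℂ] H} (hh : 0 ≤ h)
    (hinj : ∀ x, h x = 0 → x = 0) (hA : IsBoundedInverse A (h ^ 4)) (hW : IsSelfAdjoint W)
    {lam : ℝ} (hlam : 0 < lam)
    (hcoer : ∀ u, lam * ‖u‖ ^ 2 ≤ (inner ℂ u ((1 + h ^ 2 * (-W) * h ^ 2 : H →L[ℂ] H) u)).re)
    (hP : IsSelfAdjoint P) (hPP : P * P = P) (ψ : H) (k : ℝ)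
    (hψ : ∀ u, ‖P u‖ ≤ k * ‖inner ℂ u ψ‖) (r : ℝ) (hr : 0 ≤ r)
    {p : H → ℝ} {κ : ℝ} (hκ : 0 ≤ κ)
    (h1 : ∀ x, ‖inner ℂ x (W x)‖ ≤ κ * p x) (h2 : ∀ x, ‖W x‖ ^ 2 ≤ κ * p x)
    {φ : ℝ → ℝ} (hφ : IntegrableOn (fun t => t ^ (1 / 2 : ℝ) * φ t) (Set.Ioi 0))
    (hp : ∀ t, 0 < t → ∀ (ι : Type v) (e : HilbertBasis ι ℂ H) (s : Finset ι),
      ∑ i ∈ s, p (smoother h t (e i)) ≤ φ t) :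
    ∃ C D : H →L[ℂ] H,
      (IsBoundedInverse (((-W : H →L[ℂ] H) : H →ₗ[ℂ] H) +ᵥ A) C ∧ 0 ≤ C) ∧
      IsBoundedInverse ((((r : ℂ) • P : H →L[ℂ] H) : H →ₗ[ℂ] H) +ᵥ
        (powOfInverse (h ^ 4) (1 / 2) : H →ₗ.[ℂ] H)) D ∧
      IsTraceClassOp (sandwich (h ^ 4) (bpow C (1 / 2) - bpow (h ^ 4) (1 / 2))) ∧
      IsTraceClassOp (sandwich (h ^ 4) (D - bpow (h ^ 4) (1 / 2))) ∧
      IsTraceClassOp (sandwich (h ^ 4) (bpow C (1 / 2) - D)) := by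
  have hsh := hh.isSelfAdjoint
  have hsh2 : IsSelfAdjoint (h ^ 2) := hsh.pow 2
  have hXsa : IsSelfAdjoint (1 + h ^ 2 * (-W) * h ^ 2) := by
    rw [IsSelfAdjoint]
    simp [hsh.star_eq, hW.star_eq, mul_assoc]
  set S := Ring.inverse (1 + h ^ 2 * (-W) * h ^ 2) with hS
  have hu := isUnit_of_coercive hlam hcoer
  have hS0 : 0 ≤ S := inverse_nonneg_of_coercive hXsa hlam hcoer
  have hS1 : S * (1 + h ^ 2 * (-W) * h ^ 2) = 1 := Ring.inverse_mul_cancel _ hu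
  have hS2 : (1 + h ^ 2 * (-W) * h ^ 2) * S = 1 := Ring.mul_inverse_cancel _ hu
  have hA' : IsBoundedInverse A (h ^ 2 * h ^ 2) := by rw [← pow_add]; exact hA
  set C := h ^ 2 * S * h ^ 2 with hC
  have hC0 : 0 ≤ C := mul_mul_nonneg hsh2 hS0
  have hCeq : C - h ^ 4 = h ^ 4 * W * C := by
    have h4 : h ^ 4 = h ^ 2 * h ^ 2 := by rw [← pow_add]
    have e : S - h ^ 2 * W * h ^ 2 * S = 1 := by rw [← hS2]; noncomm_ring
    have e' : h ^ 2 * (S - h ^ 2 * W * h ^ 2 * S) * h ^ 2 = h ^ 4 := by rw [e, mul_one, h4]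
    conv_lhs => rw [← e']
    rw [hC, h4]
    noncomm_ring
  obtain ⟨Z, hD, hZsa, hZ⟩ := exists_inverse_comparison hh hinj hP hPP ψ k hψ r hr
  have hT1sa := isSelfAdjoint_sqrtDiff hh hC0 hW
  have hT1 := diagonalBounded_sqrtDiff hh hC0 hW hκ h1 h2 hφ hp
  have e1 := bpow_half_sub_bpow_half hh hC0 hW hCeq
  have e2 : h * Z * h - bpow (h ^ 4) (1 / 2) = h * (Z - 1) * h := by
    rw [bpow_four_half hh, pow_two]; noncomm_ring
  have e3 : bpow C (1 / 2) - h * Z * h = h * (sqrtDiff h W C - (Z - 1)) * h := by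
    rw [mul_sub, sub_mul, ← e1, ← e2]; abel
  have hq := bpow_four_quarter hh
  exact ⟨C, h * Z * h, ⟨hA'.vadd hS1 hS2, hC0⟩, hD,
    isTraceClassOp_sandwich hq hsh hinj e1 (hT1.isTraceClass hT1sa),
    isTraceClassOp_sandwich hq hsh hinj e2 (hZ.isTraceClass hZsa),
    isTraceClassOp_sandwich hq hsh hinj e3 ((hT1.sub hZ).isTraceClass (hT1sa.sub hZsa))⟩

end Perturbation

/-! ### Multiplication operators and Fourier multipliers on L² -/

section Multipliers

open FourierTransform

theorem memLp_top_of_continuous_bdd {g : ℝ → ℂ} (hg : Continuous g) {c : ℝ} (hc : ∀ x, ‖g x‖ ≤ c) :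
    MemLp g ⊤ (volume : Measure ℝ) :=
  memLp_top_of_bound hg.aestronglyMeasurable c (Filter.Eventually.of_forall hc)

/-- Multiplication by a bounded function on `L²(ℝ)`. -/
def mulOp (g : ℝ → ℂ) (hg : MemLp g ⊤ (volume : Measure ℝ)) : L2R →L[ℂ] L2R :=
  (ContinuousLinearMap.mul ℂ ℂ).holderL volume ⊤ 2 2 hg.toLp

theorem coeFn_mulOp {g : ℝ → ℂ} (hg : MemLp g ⊤ (volume : Measure ℝ)) (f : L2R) :
    mulOp g hg f =ᵐ[volume] fun x => g x * f x := by
  have h1 := (ContinuousLinearMap.mul ℂ ℂ).coeFn_holder (r := 2) hg.toLp f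
  have h2 : mulOp g hg f = (ContinuousLinearMap.mul ℂ ℂ).holder 2 hg.toLp f := rfl
  rw [h2]
  filter_upwards [h1, hg.coeFn_toLp] with x hx hx'
  rw [hx, hx']
  rfl

theorem mulOp_mul {g₁ g₂ g : ℝ → ℂ} (h₁ : MemLp g₁ ⊤ (volume : Measure ℝ))
    (h₂ : MemLp g₂ ⊤ (volume : Measure ℝ)) (h : MemLp g ⊤ (volume : Measure ℝ))
    (e : ∀ x, g x = g₁ x * g₂ x) : mulOp g₁ h₁ * mulOp g₂ h₂ = mulOp g h := by
  ext1 f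
  apply Lp.ext
  rw [mul_apply_eq_comp]
  filter_upwards [coeFn_mulOp h₁ (mulOp g₂ h₂ f), coeFn_mulOp h₂ f, coeFn_mulOp h f]
    with x hx1 hx2 hx3
  rw [hx1, hx2, hx3, e]
  ring

theorem inner_mulOp {g : ℝ → ℂ} (hg : MemLp g ⊤ (volume : Measure ℝ)) (f f' : L2R) :
    inner ℂ f (mulOp g hg f') = ∫ x, g x * (f' x * starRingEnd ℂ (f x)) := by
  rw [L2.inner_def]
  refine integral_congr_ae ?_
  filter_upwards [coeFn_mulOp hg f'] with x hx
  rw [RCLike.inner_apply, hx]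
  ring

theorem isSelfAdjoint_mulOp {g : ℝ → ℂ} (hg : MemLp g ⊤ (volume : Measure ℝ))
    (hr : ∀ x, starRingEnd ℂ (g x) = g x) : IsSelfAdjoint (mulOp g hg) := by
  rw [ContinuousLinearMap.isSelfAdjoint_iff_isSymmetric]
  intro f f'
  change inner ℂ (mulOp g hg f) f' = inner ℂ f (mulOp g hg f')
  rw [← inner_conj_symm, inner_mulOp, inner_mulOp, ← integral_conj]
  congr 1
  ext x
  simp only [map_mul, hr, Complex.conj_conj]
  ring

/-- The Fourier transform as a unitary operator on `L²(ℝ)`. -/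
abbrev fourierL : L2R ≃ₗᵢ[ℂ] L2R := Lp.fourierTransformₗᵢ ℝ ℂ

/-- The bounded Fourier multiplier on `L²(ℝ)`. -/
def fmul (g : ℝ → ℂ) (hg : MemLp g ⊤ (volume : Measure ℝ)) : L2R →L[ℂ] L2R :=
  (fourierL.symm.toContinuousLinearEquiv : L2R →L[ℂ] L2R) ∘L mulOp g hg ∘L
    (fourierL.toContinuousLinearEquiv : L2R →L[ℂ] L2R)

theorem fmul_apply {g : ℝ → ℂ} (hg : MemLp g ⊤ (volume : Measure ℝ)) (f : L2R) :
    fmul g hg f = fourierL.symm (mulOp g hg (fourierL f)) := rfl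

theorem fmul_mul {g₁ g₂ g : ℝ → ℂ} (h₁ : MemLp g₁ ⊤ (volume : Measure ℝ))
    (h₂ : MemLp g₂ ⊤ (volume : Measure ℝ)) (h : MemLp g ⊤ (volume : Measure ℝ))
    (e : ∀ x, g x = g₁ x * g₂ x) : fmul g₁ h₁ * fmul g₂ h₂ = fmul g h := by
  ext1 f
  rw [mul_apply_eq_comp, fmul_apply, fmul_apply, fmul_apply,
    LinearIsometryEquiv.apply_symm_apply, ← mulOp_mul h₁ h₂ h e]
  rfl

theorem inner_fmul {g : ℝ → ℂ} (hg : MemLp g ⊤ (volume : Measure ℝ)) (f f' : L2R) :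
    inner ℂ f (fmul g hg f') = inner ℂ (fourierL f) (mulOp g hg (fourierL f')) := by
  rw [fmul_apply, ← fourierL.inner_map_map, LinearIsometryEquiv.apply_symm_apply]

theorem isSelfAdjoint_fmul {g : ℝ → ℂ} (hg : MemLp g ⊤ (volume : Measure ℝ))
    (hr : ∀ x, starRingEnd ℂ (g x) = g x) : IsSelfAdjoint (fmul g hg) := by
  rw [ContinuousLinearMap.isSelfAdjoint_iff_isSymmetric]
  intro f f'
  change inner ℂ (fmul g hg f) f' = inner ℂ f (fmul g hg f')
  rw [inner_fmul, ← inner_conj_symm, inner_fmul, inner_conj_symm,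
    inner_map_comm (isSelfAdjoint_mulOp hg hr)]

theorem fmul_nonneg {g r : ℝ → ℂ} (hg : MemLp g ⊤ (volume : Measure ℝ))
    (h : MemLp r ⊤ (volume : Measure ℝ)) (hr : ∀ x, starRingEnd ℂ (r x) = r x)
    (e : ∀ x, g x = r x * r x) : 0 ≤ fmul g hg := by
  rw [← fmul_mul h h hg e]
  have := star_mul_self_nonneg (fmul r h)
  rwa [(isSelfAdjoint_fmul h hr).star_eq] at this

theorem fmul_injective {g : ℝ → ℂ} (hg : MemLp g ⊤ (volume : Measure ℝ))
    (h0 : ∀ x, g x ≠ 0) (f : L2R) (hf : fmul g hg f = 0) : f = 0 := by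
  rw [fmul_apply, LinearIsometryEquiv.map_eq_zero_iff] at hf
  have : fourierL f = 0 := by
    apply Lp.ext
    have h1 := coeFn_mulOp hg (fourierL f)
    rw [hf] at h1
    filter_upwards [h1, Lp.coeFn_zero ℂ 2 (volume : Measure ℝ)] with x hx hx'
    rw [hx'] at hx ⊢
    simp only [Pi.zero_apply] at hx ⊢
    exact (mul_eq_zero.1 hx.symm).resolve_left (h0 x)
  rwa [LinearIsometryEquiv.map_eq_zero_iff] at this

/-- The space H² and the Laplacian are defined through tempered distributions; this identity lets
symbol computations made there be read off in L². -/
theorem toTempered_fmul {g : ℝ → ℂ} (hg : MemLp g ⊤ (volume : Measure ℝ))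
    (hg' : g.HasTemperateGrowth) (f : L2R) :
    (Lp.toTemperedDistribution (fmul g hg f) : 𝓢'(ℝ, ℂ))
      = TemperedDistribution.fourierMultiplierCLM ℂ g (Lp.toTemperedDistribution f) := by
  have h1 : mulOp g hg (fourierL f) = (hg.toLp • (fourierL f) : L2R) := by
    apply Lp.ext
    filter_upwards [coeFn_mulOp hg (fourierL f),
      Lp.coeFn_lpSMul (r := 2) hg.toLp (fourierL f), hg.coeFn_toLp] with x h1 h2 h3
    rw [h1, h2]
    simp [h3]
  rw [TemperedDistribution.fourierMultiplierCLM_apply, Lp.fourier_toTemperedDistribution_eq]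
  change _ = 𝓕⁻ ((TemperedDistribution.smulLeftCLM ℂ g) (Lp.toTemperedDistribution (fourierL f)))
  rw [← Lp.toTemperedDistribution_smul_eq (r := 2) hg' hg,
    Lp.fourierInv_toTemperedDistribution_eq, ← h1]
  rfl

/-- On integrable square integrable functions the inverse `L²` Fourier transform is given by the
Fourier integral. -/
theorem coeFn_fourierL_symm {w : L2R} (hw : Integrable w) :
    fourierL.symm w =ᵐ[volume] 𝓕⁻ (w : ℝ → ℂ) := by
  have hcont : Continuous (𝓕⁻ (w : ℝ → ℂ)) := by
    have h := VectorFourier.fourierIntegral_continuous Real.continuous_fourierChar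
      (L := -(innerₗ ℝ)) ((continuous_inner (𝕜 := ℝ) (E := ℝ)).neg) hw
    have e : 𝓕⁻ (w : ℝ → ℂ) = VectorFourier.fourierIntegral 𝐞 volume (-(innerₗ ℝ)) w := by
      ext x
      rw [Real.fourierInv_eq]
      simp [VectorFourier.fourierIntegral]
    rw [e]; exact h
  -- Both sides are tested against smooth compactly supported g. Each pairing moves the transform
  -- onto g, by duality of distributions on the left and by Fubini on the right, and on Schwartz
  -- functions the two transforms agree.
  refine ae_eq_of_integral_contDiff_smul_eq ((Lp.memLp _).locallyIntegrable (by norm_num))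
    hcont.locallyIntegrable fun g g_smooth g_cpt => ?_
  have hg₁ : HasCompactSupport (Complex.ofRealCLM ∘ g) := g_cpt.comp_left rfl
  have hg₂ : ContDiff ℝ (⊤ : ℕ∞) (Complex.ofRealCLM ∘ g) := by fun_prop
  set φ : 𝓢(ℝ, ℂ) := hg₁.toSchwartzMap hg₂ with hφ
  have hφx : ∀ x, φ x = (g x : ℂ) := fun x => rfl
  have h1 : Lp.toTemperedDistribution (fourierL.symm w) φ
      = Lp.toTemperedDistribution w (𝓕⁻ φ) := by
    have := Lp.fourierInv_toTemperedDistribution_eq w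
    change 𝓕⁻ (Lp.toTemperedDistribution w) = Lp.toTemperedDistribution (fourierL.symm w) at this
    rw [← this]
    rfl
  rw [Lp.toTemperedDistribution_apply, Lp.toTemperedDistribution_apply] at h1
  have h2 : ∫ x, g x • (fourierL.symm w) x = ∫ x, φ x • (fourierL.symm w) x := by
    congr 1
  have h3 : ∫ x, g x • (𝓕⁻ (w : ℝ → ℂ)) x = ∫ x, φ x • (𝓕⁻ (w : ℝ → ℂ)) x := by
    congr 1
  rw [h2, h3, h1]
  have h4 := VectorFourier.integral_fourierIntegral_smul_eq_flip (μ := volume) (ν := volume)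
    (L := -(innerₗ ℝ)) Real.continuous_fourierChar ((continuous_inner (𝕜 := ℝ) (E := ℝ)).neg)
    φ.integrable hw
  have e1 : ∀ (f : ℝ → ℂ), 𝓕⁻ f = VectorFourier.fourierIntegral 𝐞 volume (-(innerₗ ℝ)) f := by
    intro f
    ext x
    rw [Real.fourierInv_eq]
    simp [VectorFourier.fourierIntegral]
  have e2 : (-(innerₗ ℝ)).flip = (-(innerₗ ℝ) : ℝ →ₗ[ℝ] ℝ →ₗ[ℝ] ℝ) := by
    ext
    simp
  rw [e2, ← e1, ← e1] at h4
  rw [← h4, ← SchwartzMap.fourierInv_coe]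

end Multipliers

/-! ### The Hilbert–Schmidt estimate -/

section TraceEstimate

open FourierTransform

theorem norm_sq_L2R (f : L2R) : ‖f‖ ^ 2 = ∫ x, ‖f x‖ ^ 2 := by
  have h1 := inner_self_eq_norm_sq (𝕜 := ℂ) f
  rw [← h1, L2.inner_def, ← integral_re (L2.integrable_inner f f)]
  congr 1
  ext x
  exact inner_self_eq_norm_sq (𝕜 := ℂ) (f x)

theorem norm_sq_toLp {f : ℝ → ℂ} (hf : MemLp f 2 (volume : Measure ℝ)) :
    ‖(hf.toLp : L2R)‖ ^ 2 = ∫ x, ‖f x‖ ^ 2 := by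
  rw [norm_sq_L2R]
  refine integral_congr_ae ?_
  filter_upwards [hf.coeFn_toLp] with x hx
  rw [hx]

theorem re_inner_mulOp_ofReal {V : ℝ → ℝ}
    (hV : MemLp (fun x => (V x : ℂ)) ⊤ (volume : Measure ℝ)) (f : L2R) :
    Integrable (fun x => V x * ‖f x‖ ^ 2) ∧
    inner ℂ f (mulOp _ hV f) = ((∫ x, V x * ‖f x‖ ^ 2 : ℝ) : ℂ) := by
  have h0 : ∀ x, (V x : ℂ) * (f x * starRingEnd ℂ (f x)) = ((V x * ‖f x‖ ^ 2 : ℝ) : ℂ) := by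
    intro x
    rw [Complex.mul_conj, Complex.normSq_eq_norm_sq]
    push_cast
    rfl
  have h1 : inner ℂ f (mulOp _ hV f) = ((∫ x, V x * ‖f x‖ ^ 2 : ℝ) : ℂ) := by
    rw [inner_mulOp, ← integral_complex_ofReal]
    congr 1
    ext x
    exact h0 x
  refine ⟨?_, h1⟩
  have h2 := L2.integrable_inner (𝕜 := ℂ) f (mulOp _ hV f)
  have h3 : (fun x => inner ℂ (f x) (mulOp _ hV f x)) =ᵐ[volume]
      fun x => ((V x * ‖f x‖ ^ 2 : ℝ) : ℂ) := by
    filter_upwards [coeFn_mulOp hV f] with x hx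
    rw [RCLike.inner_apply, hx, ← h0 x]
    ring
  exact (h2.congr h3).re

/-- Hilbert–Schmidt bound: the trace of `b(D)* V b(D)` is at most `∫ V · ∫ |b|²`. -/
theorem sum_inner_mulOp_fmul_le {b : ℝ → ℂ} (hb : MemLp b ⊤ (volume : Measure ℝ))
    (hb2 : MemLp b 2 (volume : Measure ℝ)) {V : ℝ → ℝ} (hV0 : ∀ x, 0 ≤ V x) (hVi : Integrable V)
    (hV : MemLp (fun x => (V x : ℂ)) ⊤ (volume : Measure ℝ))
    {ι : Type*} {e : ι → L2R} (he : Orthonormal ℂ e) (s : Finset ι) :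
    ∑ i ∈ s, (inner ℂ (fmul b hb (e i)) (mulOp _ hV (fmul b hb (e i)))).re
      ≤ (∫ x, V x) * ∫ ξ, ‖b ξ‖ ^ 2 := by
  set w : ι → L2R := fun i => mulOp b hb (fourierL (e i)) with hw
  have hwi : ∀ i, Integrable (w i) := by
    intro i
    refine (hb2.integrable_mul (Lp.memLp (fourierL (e i)))).congr ?_
    exact (coeFn_mulOp hb (fourierL (e i))).symm
  -- For fixed x, the value of b(D)e_i at x is the inner product of the Fourier transform of e_i
  -- with this vector, whose norm is ‖b‖₂ for every x. Bessel's inequality then bounds the sum over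
  -- i pointwise in x.
  have hβ : ∀ x : ℝ, MemLp (fun ξ : ℝ => starRingEnd ℂ (Complex.exp (((2 * Real.pi * (ξ * x) : ℝ) : ℂ) * Complex.I) * b ξ)) 2
      (volume : Measure ℝ) := by
    intro x
    refine MemLp.of_le hb2 ?_ (Filter.Eventually.of_forall fun ξ => ?_)
    · refine Complex.continuous_conj.comp_aestronglyMeasurable ?_
      refine AEStronglyMeasurable.mul ?_ hb2.1
      have : Continuous fun ξ : ℝ => Complex.exp (((2 * Real.pi * (ξ * x) : ℝ) : ℂ) * Complex.I) := by fun_prop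
      exact this.aestronglyMeasurable
    · rw [RCLike.norm_conj, norm_mul, Complex.norm_exp_ofReal_mul_I, one_mul]
  have hY : ∀ i x, 𝓕⁻ (w i : ℝ → ℂ) x
      = inner ℂ ((hβ x).toLp : L2R) (fourierL (e i)) := by
    intro i x
    rw [Real.fourierInv_eq', L2.inner_def]
    refine integral_congr_ae ?_
    filter_upwards [coeFn_mulOp hb (fourierL (e i)), (hβ x).coeFn_toLp] with ξ h1 h2
    have h3 : inner ℝ ξ x = ξ * x := by simp [mul_comm]
    have h4 : (w i) ξ = b ξ * (fourierL (e i)) ξ := h1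
    simp only [h3, h4, h2, RCLike.inner_apply, Complex.conj_conj, smul_eq_mul]
    ring
  have hβn : ∀ x, ‖((hβ x).toLp : L2R)‖ ^ 2 = ∫ ξ, ‖b ξ‖ ^ 2 := by
    intro x
    rw [norm_sq_toLp]
    congr 1
    ext ξ
    rw [RCLike.norm_conj, norm_mul, Complex.norm_exp_ofReal_mul_I, one_mul]
  have hbessel : ∀ x, ∑ i ∈ s, ‖𝓕⁻ (w i : ℝ → ℂ) x‖ ^ 2 ≤ ∫ ξ, ‖b ξ‖ ^ 2 := by
    intro x
    rw [← hβn x]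
    have ho : Orthonormal ℂ (fun i => fourierL (e i)) := he.comp_linearIsometry fourierL.toLinearIsometry
    refine le_trans (le_of_eq ?_) (ho.sum_inner_products_le ((hβ x).toLp : L2R) (s := s))
    refine Finset.sum_congr rfl fun i _ => ?_
    rw [hY, norm_inner_symm]
  have hy : ∀ i, fmul b hb (e i) =ᵐ[volume] 𝓕⁻ (w i : ℝ → ℂ) := fun i =>
    coeFn_fourierL_symm (hwi i)
  have hVy : ∀ i, Integrable (fun x => V x * ‖𝓕⁻ (w i : ℝ → ℂ) x‖ ^ 2) ∧
      (inner ℂ (fmul b hb (e i)) (mulOp _ hV (fmul b hb (e i)))).re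
        = ∫ x, V x * ‖𝓕⁻ (w i : ℝ → ℂ) x‖ ^ 2 := by
    intro i
    obtain ⟨h1, h2⟩ := re_inner_mulOp_ofReal hV (fmul b hb (e i))
    have h3 : (fun x => V x * ‖fmul b hb (e i) x‖ ^ 2) =ᵐ[volume]
        fun x => V x * ‖𝓕⁻ (w i : ℝ → ℂ) x‖ ^ 2 := by
      filter_upwards [hy i] with x hx
      rw [hx]
    exact ⟨h1.congr h3, by rw [h2, Complex.ofReal_re, integral_congr_ae h3]⟩
  calc ∑ i ∈ s, (inner ℂ (fmul b hb (e i)) (mulOp _ hV (fmul b hb (e i)))).re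
      = ∑ i ∈ s, ∫ x, V x * ‖𝓕⁻ (w i : ℝ → ℂ) x‖ ^ 2 :=
        Finset.sum_congr rfl fun i _ => (hVy i).2
    _ = ∫ x, ∑ i ∈ s, V x * ‖𝓕⁻ (w i : ℝ → ℂ) x‖ ^ 2 := by
        rw [integral_finsetSum]
        exact fun i _ => (hVy i).1
    _ ≤ ∫ x, V x * ∫ ξ, ‖b ξ‖ ^ 2 := by
        refine integral_mono (integrable_finsetSum _ fun i _ => (hVy i).1) (hVi.mul_const _)
          fun x => ?_
        simp only
        rw [← Finset.mul_sum]
        exact mul_le_mul_of_nonneg_left (hbessel x) (hV0 x)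
    _ = _ := by rw [integral_mul_const]

end TraceEstimate

/-! ### Powers of the free operator -∂² + 4m² -/

section FreeOperator

/-- The symbol `4m² + (2πξ)²` of `-∂² + 4m²`. -/
def disp (m ξ : ℝ) : ℝ := 4 * m ^ 2 + (2 * Real.pi * ξ) ^ 2

variable {m : ℝ}

theorem le_disp (m ξ : ℝ) : 4 * m ^ 2 ≤ disp m ξ := le_add_of_nonneg_right (by positivity)

theorem disp_pos (hm : 0 < m) (ξ : ℝ) : 0 < disp m ξ :=
  lt_of_lt_of_le (by positivity) (le_disp m ξ)

theorem hasTemperateGrowth_disp_rpow (hm : 0 < m) (s : ℝ) :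
    (fun ξ : ℝ => disp m ξ ^ s).HasTemperateGrowth := by
  have h1 : (fun ξ : ℝ => disp m ξ ^ s)
      = fun ξ : ℝ => (4 * m ^ 2) ^ s * (1 + ‖(Real.pi / m) * ξ‖ ^ 2) ^ s := by
    ext ξ
    rw [← Real.mul_rpow (by positivity) (by positivity), disp, Real.norm_eq_abs, sq_abs]
    congr 1
    field_simp
    ring
  rw [h1]
  have h2 : (fun ξ : ℝ => (Real.pi / m) * ξ).HasTemperateGrowth := by fun_prop
  exact (Function.HasTemperateGrowth.const _).mul
    ((Function.hasTemperateGrowth_one_add_norm_sq_rpow ℝ s).comp h2)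

theorem hasTemperateGrowth_ofReal_disp_rpow (hm : 0 < m) (s : ℝ) :
    (fun ξ : ℝ => ((disp m ξ ^ s : ℝ) : ℂ)).HasTemperateGrowth :=
  Function.HasTemperateGrowth.comp (g := Complex.ofReal) (by fun_prop)
    (hasTemperateGrowth_disp_rpow hm s)

theorem continuous_disp (m : ℝ) : Continuous (disp m) := by unfold disp; fun_prop

theorem continuous_disp_rpow (hm : 0 < m) (s : ℝ) : Continuous fun ξ : ℝ => disp m ξ ^ s :=
  (continuous_disp m).rpow_const fun ξ => Or.inl (disp_pos hm ξ).ne'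

theorem disp_rpow_le (hm : 0 < m) {s : ℝ} (hs : s ≤ 0) (ξ : ℝ) :
    disp m ξ ^ s ≤ (4 * m ^ 2) ^ s :=
  Real.rpow_le_rpow_of_nonpos (by positivity) (le_disp m ξ) hs

theorem memLp_disp_rpow (hm : 0 < m) {s : ℝ} (hs : s ≤ 0) :
    MemLp (fun ξ : ℝ => ((disp m ξ ^ s : ℝ) : ℂ)) ⊤ (volume : Measure ℝ) := by
  refine memLp_top_of_continuous_bdd
    (Complex.continuous_ofReal.comp (continuous_disp_rpow hm s)) (c := (4 * m ^ 2) ^ s) fun ξ => ?_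
  rw [Complex.norm_real, Real.norm_of_nonneg (Real.rpow_nonneg (disp_pos hm ξ).le _)]
  exact disp_rpow_le hm hs ξ

/-- The operator `(-∂² + 4m²)^s`, `s ≤ 0`. -/
def freePow (hm : 0 < m) (s : ℝ) (hs : s ≤ 0) : L2R →L[ℂ] L2R := fmul _ (memLp_disp_rpow hm hs)

theorem freePow_mul (hm : 0 < m) {s r : ℝ} (hs : s ≤ 0) (hr : r ≤ 0) :
    freePow hm s hs * freePow hm r hr = freePow hm (s + r) (by linarith) := by
  refine fmul_mul _ _ _ fun ξ => ?_
  rw [Real.rpow_add (disp_pos hm ξ)]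
  push_cast
  rfl

theorem freePow_nonneg (hm : 0 < m) {s : ℝ} (hs : s ≤ 0) : 0 ≤ freePow hm s hs := by
  refine fmul_nonneg _ (memLp_disp_rpow hm (s := s / 2) (by linarith)) (fun ξ => ?_) fun ξ => ?_
  · exact Complex.conj_ofReal _
  · rw [← Complex.ofReal_mul, ← Real.rpow_add (disp_pos hm ξ)]
    congr 3
    ring

theorem freePow_injective (hm : 0 < m) {s : ℝ} (hs : s ≤ 0) (f : L2R)
    (hf : freePow hm s hs f = 0) : f = 0 := by
  refine fmul_injective _ (fun ξ => ?_) f hf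
  exact_mod_cast (Real.rpow_pos_of_pos (disp_pos hm ξ) s).ne'

theorem freePow_pow (hm : 0 < m) {s : ℝ} (hs : s ≤ 0) (n : ℕ) :
    freePow hm s hs ^ (n + 1) = freePow hm ((n + 1 : ℕ) * s)
      (mul_nonpos_of_nonneg_of_nonpos (by positivity) hs) := by
  induction n with
  | zero => simp
  | succ k ih =>
    rw [pow_succ, ih, freePow_mul]
    congr 1
    push_cast
    ring

/-- The operator `(-∂² + 4m²)^{-1/4}`. -/
def freeRoot (hm : 0 < m) : L2R →L[ℂ] L2R := freePow hm (-1 / 4) (by norm_num)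

theorem freeRoot_pow_four (hm : 0 < m) : freeRoot hm ^ 4 = freePow hm (-1) (by norm_num) := by
  rw [freeRoot, freePow_pow hm _ 3]
  congr 1
  norm_num

theorem freeRoot_pow_two (hm : 0 < m) : freeRoot hm ^ 2 = freePow hm (-1 / 2) (by norm_num) := by
  rw [freeRoot, freePow_pow hm _ 1]
  congr 1
  norm_num

theorem freeRoot_pow_three (hm : 0 < m) : freeRoot hm ^ 3 = freePow hm (-3 / 4) (by norm_num) := by
  rw [freeRoot, freePow_pow hm _ 2]
  congr 1
  norm_num

open TemperedDistribution in
-- The real exponent 1 keeps the symbol inside the family of powers of `disp`, so that it cancels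
-- against the exponent -1 by adding exponents.
theorem fourierMultiplier_disp (m : ℝ) (f : 𝓢'(ℝ, ℂ)) :
    fourierMultiplierCLM ℂ (fun ξ : ℝ => ((disp m ξ ^ (1 : ℝ) : ℝ) : ℂ)) f
      = -(Δ f) + ((4 * m ^ 2 : ℝ) : ℂ) • f := by
  have ht : (fun ξ : ℝ => ((‖ξ‖ ^ 2 : ℝ) : ℂ)).HasTemperateGrowth := by fun_prop
  have ht' : (((2 * Real.pi) ^ 2 : ℝ) • fun ξ : ℝ => ((‖ξ‖ ^ 2 : ℝ) : ℂ)).HasTemperateGrowth := by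
    fun_prop
  have e : (fun ξ : ℝ => ((disp m ξ ^ (1 : ℝ) : ℝ) : ℂ))
      = (((2 * Real.pi) ^ 2 : ℝ) : ℂ) • (fun ξ : ℝ => ((‖ξ‖ ^ 2 : ℝ) : ℂ))
        + fun _ => ((4 * m ^ 2 : ℝ) : ℂ) := by
    ext ξ
    simp [disp]
    ring
  rw [laplacian_eq_fourierMultiplierCLM, e]
  have h1 : fourierMultiplierCLM ℂ ((((2 * Real.pi) ^ 2 : ℝ) : ℂ) •
      (fun ξ : ℝ => ((‖ξ‖ ^ 2 : ℝ) : ℂ)) + fun _ => ((4 * m ^ 2 : ℝ) : ℂ))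
      = fourierMultiplierCLM ℂ ((((2 * Real.pi) ^ 2 : ℝ) : ℂ) •
          (fun ξ : ℝ => ((‖ξ‖ ^ 2 : ℝ) : ℂ)))
        + fourierMultiplierCLM ℂ (fun _ : ℝ => ((4 * m ^ 2 : ℝ) : ℂ)) := by
    ext1 g
    rw [add_apply]
    simp only [fourierMultiplierCLM_apply]
    rw [smulLeftCLM_add (by fun_prop) (by fun_prop), add_apply, FourierTransform.fourierInv_add]
  rw [h1, fourierMultiplierCLM_smul ht, add_apply, fourierMultiplierCLM_const]
  simp only [smul_apply, neg_smul, neg_neg, ContinuousLinearMap.id_apply]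
  congr 1

theorem toTempered_K₀ (m : ℝ) (f : H2) :
    (Lp.toTemperedDistribution (K₀ m f) : 𝓢'(ℝ, ℂ)) = TemperedDistribution.fourierMultiplierCLM ℂ
      (fun ξ : ℝ => ((disp m ξ ^ (1 : ℝ) : ℝ) : ℂ)) (Lp.toTemperedDistribution (f : L2R)) := by
  have h1 : K₀ m f = -(secondDeriv f) + ((4 * m ^ 2 : ℝ) : ℂ) • (f : L2R) := rfl
  rw [fourierMultiplier_disp m, h1, ← Lp.toTemperedDistributionCLM_apply, map_add, map_neg,
    map_smul]
  have h2 : Lp.toTemperedDistributionCLM ℂ (volume : Measure ℝ) 2 (secondDeriv f)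
      = Δ (((f : L2R) : 𝓢'(ℝ, ℂ))) := (exists_second_deriv f).choose_spec
  rw [h2]
  rfl

theorem disp_rpow_mul_rpow_neg (hm : 0 < m) :
    ((fun ξ : ℝ => ((disp m ξ ^ (1 : ℝ) : ℝ) : ℂ)) * fun ξ : ℝ => ((disp m ξ ^ (-1 : ℝ) : ℝ) : ℂ))
      = fun _ => (1 : ℂ) := by
  ext ξ
  rw [Pi.mul_apply, ← Complex.ofReal_mul, ← Real.rpow_add (disp_pos hm ξ)]
  simp

theorem isBoundedInverse_K₀ (hm : 0 < m) :
    IsBoundedInverse (K₀ m) (freePow hm (-1) (by norm_num)) := by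
  have hg1 := hasTemperateGrowth_ofReal_disp_rpow hm 1
  have hg2 := hasTemperateGrowth_ofReal_disp_rpow hm (-1)
  have hT : ∀ g : L2R, (Lp.toTemperedDistribution (freePow hm (-1) (by norm_num) g) : 𝓢'(ℝ, ℂ))
      = TemperedDistribution.fourierMultiplierCLM ℂ
        (fun ξ : ℝ => ((disp m ξ ^ (-1 : ℝ) : ℝ) : ℂ)) (Lp.toTemperedDistribution g) :=
    fun g => toTempered_fmul _ hg2 g
  constructor
  · intro f
    apply toTempered_injective
    rw [Lp.toTemperedDistributionCLM_apply, Lp.toTemperedDistributionCLM_apply, hT,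
      toTempered_K₀ m f,
      TemperedDistribution.fourierMultiplierCLM_fourierMultiplierCLM_apply hg1 hg2,
      disp_rpow_mul_rpow_neg hm, TemperedDistribution.fourierMultiplierCLM_const]
    simp
  · intro g
    have hdom : freePow hm (-1) (by norm_num) g ∈ (K₀ m).domain := by
      change TemperedDistribution.MemSobolev 2 2 _
      have hb : (fun ξ : ℝ => (((1 + ‖ξ‖ ^ 2) ^ ((2 : ℝ) / 2) : ℝ) : ℂ)).HasTemperateGrowth := by
        fun_prop
      -- Membership in H² amounts to boundedness of (1 + ξ²)/`disp`. The bound is (4m²)⁻¹ + 1, from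
      -- 4m² ≤ `disp` and ξ² ≤ `disp`.
      have hbd : MemLp ((fun ξ : ℝ => ((disp m ξ ^ (-1 : ℝ) : ℝ) : ℂ)) *
          fun ξ : ℝ => (((1 + ‖ξ‖ ^ 2) ^ ((2 : ℝ) / 2) : ℝ) : ℂ)) ⊤ (volume : Measure ℝ) := by
        refine memLp_top_of_continuous_bdd (c := (4 * m ^ 2)⁻¹ + 1)
          (hg2.mul hb).1.continuous fun ξ => ?_
        have h1 : 0 < disp m ξ := disp_pos hm ξ
        rw [Pi.mul_apply, ← Complex.ofReal_mul, Complex.norm_real,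
          Real.norm_of_nonneg (by positivity), div_self two_ne_zero, Real.rpow_one,
          Real.rpow_neg_one, inv_mul_le_iff₀ h1, Real.norm_eq_abs, sq_abs, mul_add, mul_one]
        have h2 : 1 ≤ disp m ξ * (4 * m ^ 2)⁻¹ := by
          rw [← div_eq_mul_inv, le_div_iff₀ (by positivity), one_mul]
          exact le_disp m ξ
        have h3 : ξ ^ 2 ≤ disp m ξ := by
          have hpi := Real.pi_gt_three
          have : 1 ≤ (2 * Real.pi) ^ 2 := by nlinarith
          rw [disp, mul_pow]
          nlinarith [sq_nonneg m, sq_nonneg ξ]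
        linarith
      refine ⟨fmul _ hbd g, ?_⟩
      rw [toTempered_fmul hbd (hg2.mul hb), hT, TemperedDistribution.besselPotential,
        TemperedDistribution.fourierMultiplierCLM_fourierMultiplierCLM_apply hg2 hb]
    refine ⟨hdom, ?_⟩
    apply toTempered_injective
    rw [Lp.toTemperedDistributionCLM_apply, Lp.toTemperedDistributionCLM_apply]
    refine (toTempered_K₀ m ⟨_, hdom⟩).trans ?_
    rw [hT,
      TemperedDistribution.fourierMultiplierCLM_fourierMultiplierCLM_apply hg2 hg1, mul_comm,
      disp_rpow_mul_rpow_neg hm, TemperedDistribution.fourierMultiplierCLM_const]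
    simp

end FreeOperator

/-! ### The symbol of h³(t + h⁴)⁻¹ and its integrability in t -/

section Smoother

variable {m : ℝ}

theorem fmul_const_one_mul {g : ℝ → ℂ} {r : ℝ → ℂ} (hg : MemLp g ⊤ (volume : Measure ℝ))
    (hr : MemLp r ⊤ (volume : Measure ℝ)) {t : ℂ} (e : ∀ ξ, t * r ξ + g ξ * r ξ = 1) :
    (t • 1 + fmul g hg) * fmul r hr = 1 := by
  have h1 : t • mulOp r hr + mulOp g hg * mulOp r hr = 1 := by
    ext1 f
    apply Lp.ext
    have e1 : (t • mulOp r hr + mulOp g hg * mulOp r hr) f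
        = t • mulOp r hr f + mulOp g hg (mulOp r hr f) := rfl
    rw [e1]
    filter_upwards [Lp.coeFn_add (t • mulOp r hr f) (mulOp g hg (mulOp r hr f)),
      Lp.coeFn_smul t (mulOp r hr f), coeFn_mulOp hr f, coeFn_mulOp hg (mulOp r hr f)]
      with x h1 h2 h3 h4
    rw [h1, Pi.add_apply, h2, Pi.smul_apply, h4, h3, smul_eq_mul]
    have := congrArg (fun z => z * f x) (e x)
    simp only [one_mul, add_mul] at this
    rw [← mul_assoc, ← mul_assoc, this]
    rfl
  ext1 f
  have h2 := congrArg (fun T : L2R →L[ℂ] L2R => fourierL.symm (T (fourierL f))) h1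
  simp only [add_apply, smul_apply, mul_apply_eq_comp, map_add, map_smul, one_apply_eq_self,
    LinearIsometryEquiv.symm_apply_apply] at h2
  simp only [add_mul, add_apply, smul_apply, mul_apply_eq_comp, one_apply_eq_self, smul_mul_assoc,
    one_mul, fmul_apply, LinearIsometryEquiv.apply_symm_apply]
  exact h2

/-- The symbol of the smoothing operator `h³ (t + h⁴)⁻¹`. -/
def smootherSymbol (m t ξ : ℝ) : ℝ := disp m ξ ^ (-3 / 4 : ℝ) * (t + disp m ξ ^ (-1 : ℝ))⁻¹

theorem continuous_resolvSymbol (hm : 0 < m) {t : ℝ} (ht : 0 < t) :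
    Continuous fun ξ : ℝ => (t + disp m ξ ^ (-1 : ℝ))⁻¹ := by
  refine (continuous_const.add (continuous_disp_rpow hm _)).inv₀ fun ξ => ?_
  have := Real.rpow_pos_of_pos (disp_pos hm ξ) (-1)
  exact (add_pos ht this).ne'

theorem continuous_smootherSymbol (hm : 0 < m) {t : ℝ} (ht : 0 < t) :
    Continuous (smootherSymbol m t) :=
  (continuous_disp_rpow hm _).mul (continuous_resolvSymbol hm ht)

theorem resolvSymbol_le (hm : 0 < m) {t : ℝ} (ht : 0 < t) (ξ : ℝ) :
    (t + disp m ξ ^ (-1 : ℝ))⁻¹ ≤ t⁻¹ := by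
  have := Real.rpow_pos_of_pos (disp_pos hm ξ) (-1)
  exact inv_anti₀ ht (by linarith)

theorem smootherSymbol_nonneg (hm : 0 < m) {t : ℝ} (ht : 0 < t) (ξ : ℝ) :
    0 ≤ smootherSymbol m t ξ := by
  have := disp_pos hm ξ
  unfold smootherSymbol
  positivity

theorem memLp_resolvSymbol (hm : 0 < m) {t : ℝ} (ht : 0 < t) :
    MemLp (fun ξ => (((t + disp m ξ ^ (-1 : ℝ))⁻¹ : ℝ) : ℂ)) ⊤ (volume : Measure ℝ) := by
  refine memLp_top_of_continuous_bdd (c := t⁻¹)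
    (Complex.continuous_ofReal.comp (continuous_resolvSymbol hm ht)) fun ξ => ?_
  have := disp_pos hm ξ
  rw [Complex.norm_real, Real.norm_of_nonneg (by positivity)]
  exact resolvSymbol_le hm ht ξ

theorem memLp_smootherSymbol (hm : 0 < m) {t : ℝ} (ht : 0 < t) :
    MemLp (fun ξ => ((smootherSymbol m t ξ : ℝ) : ℂ)) ⊤ (volume : Measure ℝ) := by
  refine memLp_top_of_continuous_bdd (c := (4 * m ^ 2) ^ (-3 / 4 : ℝ) * t⁻¹)
    (Complex.continuous_ofReal.comp (continuous_smootherSymbol hm ht)) fun ξ => ?_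
  rw [Complex.norm_real, Real.norm_of_nonneg (smootherSymbol_nonneg hm ht ξ)]
  have := disp_pos hm ξ
  exact mul_le_mul (disp_rpow_le hm (by norm_num) ξ) (resolvSymbol_le hm ht ξ) (by positivity)
    (by positivity)

theorem smoother_freeRoot (hm : 0 < m) {t : ℝ} (ht : 0 < t) :
    smoother (freeRoot hm) t = fmul _ (memLp_smootherSymbol hm ht) := by
  have h4 : 0 ≤ freeRoot hm ^ 4 := CStarAlgebra.pow_nonneg (freePow_nonneg hm _) 4
  have h1 : ((t : ℂ) • 1 + freeRoot hm ^ 4) * fmul _ (memLp_resolvSymbol hm ht) = 1 := by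
    rw [freeRoot_pow_four, freePow]
    refine fmul_const_one_mul _ _ fun ξ => ?_
    have := Real.rpow_pos_of_pos (disp_pos hm ξ) (-1)
    have h0 : t + disp m ξ ^ (-1 : ℝ) ≠ 0 := by positivity
    rw [← add_mul, ← Complex.ofReal_add, ← Complex.ofReal_mul, mul_inv_cancel₀ h0]
    simp
  have h2 : resolv (freeRoot hm ^ 4) t = fmul _ (memLp_resolvSymbol hm ht) := by
    calc resolv (freeRoot hm ^ 4) t
        = resolv (freeRoot hm ^ 4) t * (((t : ℂ) • 1 + freeRoot hm ^ 4) *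
            fmul _ (memLp_resolvSymbol hm ht)) := by rw [h1, mul_one]
      _ = _ := by rw [← mul_assoc, resolv_mul h4 ht, one_mul]
  rw [smoother, h2, freeRoot_pow_three, freePow]
  refine fmul_mul _ _ _ fun ξ => ?_
  rw [smootherSymbol]
  push_cast
  rfl

/-- With c = `disp`⁻¹ the squared symbol is c^{3/2}/(t + c)², and t^s c^{2-s} ≤ (t + c)² for 0 ≤ s ≤
2 gives the bound t^{1/2-s} c^{s-1/2}. The choice s = 5/4 is integrable at t = 0 and s = 7/4 at
infinity. Both keep the factor c^{3/4}, integrable in ξ; in the second case the surplus c^{1/2} is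
at most (4m²)^{-1/2}. -/
theorem sqrt_mul_smootherSymbol_sq_le (hm : 0 < m) {t : ℝ} (ht : 0 < t) (ξ : ℝ) :
    t ^ (1 / 2 : ℝ) * smootherSymbol m t ξ ^ 2 ≤ t ^ (-3 / 4 : ℝ) * disp m ξ ^ (-3 / 4 : ℝ) ∧
    t ^ (1 / 2 : ℝ) * smootherSymbol m t ξ ^ 2
      ≤ t ^ (-5 / 4 : ℝ) * ((4 * m ^ 2) ^ (-1 / 2 : ℝ) * disp m ξ ^ (-3 / 4 : ℝ)) := by
  have hq := disp_pos hm ξ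
  set q := disp m ξ with hqdef
  set c := q ^ (-1 : ℝ) with hc
  have hc0 : 0 < c := Real.rpow_pos_of_pos hq _
  have hpow : ∀ s : ℝ, q ^ (-s) = c ^ s := fun s => by
    rw [hc, ← Real.rpow_mul hq.le]; congr 1; ring
  have hb : smootherSymbol m t ξ = c ^ (3 / 4 : ℝ) * (t + c)⁻¹ := by
    rw [← hpow, smootherSymbol]; congr 2; norm_num
  have hsum : 0 < t + c := by positivity
  have key : ∀ s : ℝ, 0 ≤ s → s ≤ 2 → t ^ s * c ^ (2 - s) ≤ (t + c) ^ 2 := by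
    intro s h0 h2
    calc t ^ s * c ^ (2 - s) ≤ (t + c) ^ s * (t + c) ^ (2 - s) := by
          gcongr
          · linarith
          · linarith
      _ = (t + c) ^ 2 := by
          rw [← Real.rpow_add hsum, ← Real.rpow_natCast]; congr 1; push_cast; ring
  have hb2 : smootherSymbol m t ξ ^ 2 = c ^ (3 / 2 : ℝ) / (t + c) ^ 2 := by
    rw [hb, mul_pow, ← Real.rpow_natCast (c ^ (3 / 4 : ℝ)), ← Real.rpow_mul hc0.le, inv_pow,
      div_eq_mul_inv]
    norm_num [div_eq_mul_inv]
  have main : ∀ s : ℝ, 0 ≤ s → s ≤ 2 → t ^ (1 / 2 : ℝ) * smootherSymbol m t ξ ^ 2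
      ≤ t ^ (1 / 2 - s) * c ^ (s - 1 / 2) := by
    intro s h0 h2
    rw [hb2, ← mul_div_assoc, div_le_iff₀ (by positivity)]
    calc t ^ (1 / 2 : ℝ) * c ^ (3 / 2 : ℝ)
        = t ^ (1 / 2 - s) * c ^ (s - 1 / 2) * (t ^ s * c ^ (2 - s)) := by
          rw [mul_mul_mul_comm, ← Real.rpow_add ht, ← Real.rpow_add hc0]
          congr 2 <;> ring
      _ ≤ _ := by gcongr; exact key s h0 h2
  constructor
  · have := main (5 / 4) (by norm_num) (by norm_num)
    norm_num at this ⊢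
    rw [hpow] 
    exact this
  · have h1 := main (7 / 4) (by norm_num) (by norm_num)
    have h2 : c ^ (5 / 4 : ℝ) = q ^ (-1 / 2 : ℝ) * q ^ (-3 / 4 : ℝ) := by
      rw [← hpow, ← Real.rpow_add hq]; norm_num
    norm_num at h1 ⊢
    refine h1.trans ?_
    rw [h2]
    have h3 := disp_rpow_le hm (s := -1 / 2) (by norm_num) ξ
    norm_num at h3 ⊢
    gcongr

theorem integrable_disp_rpow (hm : 0 < m) {s : ℝ} (hs : s < -1 / 2) :
    Integrable fun ξ : ℝ => disp m ξ ^ s := by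
  set a := min (4 * m ^ 2) 1 with ha
  have ha0 : 0 < a := lt_min (by positivity) one_pos
  have hi : Integrable fun ξ : ℝ => a ^ s * (1 + ‖ξ‖ ^ 2) ^ (-(-2 * s) / 2) :=
    (integrable_rpow_neg_one_add_norm_sq (E := ℝ) (r := -2 * s) (by simp; linarith)).const_mul _
  refine hi.mono' (continuous_disp_rpow hm s).aestronglyMeasurable
    (Filter.Eventually.of_forall fun ξ => ?_)
  rw [Real.norm_of_nonneg (Real.rpow_nonneg (disp_pos hm ξ).le _)]
  have e : -(-2 * s) / 2 = s := by ring
  rw [e, ← Real.mul_rpow ha0.le (by positivity)]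
  refine Real.rpow_le_rpow_of_nonpos (by positivity) ?_ (by linarith)
  have hpi := Real.pi_gt_three
  have h1 : 1 ≤ (2 * Real.pi) ^ 2 := by nlinarith
  have h2 : a ≤ 4 * m ^ 2 := min_le_left _ _
  have h3 : a ≤ 1 := min_le_right _ _
  rw [disp, mul_pow, Real.norm_eq_abs, sq_abs]
  nlinarith [sq_nonneg ξ]

theorem memLp_two_smootherSymbol (hm : 0 < m) {t : ℝ} (ht : 0 < t) :
    MemLp (fun ξ => ((smootherSymbol m t ξ : ℝ) : ℂ)) 2 (volume : Measure ℝ) := by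
  have hc := continuous_smootherSymbol hm ht
  suffices h : MemLp (smootherSymbol m t) 2 volume from h.ofReal
  rw [memLp_two_iff_integrable_sq hc.aestronglyMeasurable]
  have hr : 0 < t ^ (1 / 2 : ℝ) := Real.rpow_pos_of_pos ht _
  refine ((integrable_disp_rpow hm (s := -3 / 4) (by norm_num)).const_mul
    ((t ^ (1 / 2 : ℝ))⁻¹ * t ^ (-3 / 4 : ℝ))).mono' (hc.pow 2).aestronglyMeasurable
    (Filter.Eventually.of_forall fun ξ => ?_)
  rw [Real.norm_of_nonneg (by positivity), mul_assoc, le_inv_mul_iff₀ hr]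
  exact (sqrt_mul_smootherSymbol_sq_le hm ht ξ).1

/-- An integrable majorant, after multiplication by `t^{1/2}`, of the Hilbert–Schmidt norms. -/
theorem exists_smoother_majorant (hm : 0 < m) {V : ℝ → ℝ} (hV0 : ∀ x, 0 ≤ V x)
    (hVi : Integrable V) (hV : MemLp (fun x => (V x : ℂ)) ⊤ (volume : Measure ℝ)) :
    ∃ φ : ℝ → ℝ, IntegrableOn (fun t => t ^ (1 / 2 : ℝ) * φ t) (Set.Ioi 0) ∧
      ∀ t, 0 < t → ∀ (ι : Type) (e : HilbertBasis ι ℂ L2R) (s : Finset ι),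
        ∑ i ∈ s, (inner ℂ (smoother (freeRoot hm) t (e i))
          (mulOp _ hV (smoother (freeRoot hm) t (e i)))).re ≤ φ t := by
  set A := ∫ ξ, disp m ξ ^ (-3 / 4 : ℝ) with hA
  have hA0 : 0 ≤ A := integral_nonneg fun ξ => Real.rpow_nonneg (disp_pos hm ξ).le _
  have hIV : 0 ≤ ∫ x, V x := integral_nonneg hV0
  set κ := (4 * m ^ 2) ^ (-1 / 2 : ℝ) with hκ
  have hAi := integrable_disp_rpow hm (s := -3 / 4) (by norm_num)
  -- The prefactor cancels the weight t^{1/2}. What remains is t^{-3/4} up to 1 and t^{-5/4} beyond,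
  -- one for each alternative of `sqrt_mul_smootherSymbol_sq_le`.
  refine ⟨fun t => (t ^ (1 / 2 : ℝ))⁻¹ * (Set.Ioc 0 1).piecewise
    (fun t => ((∫ x, V x) * A) * t ^ (-3 / 4 : ℝ))
    (fun t => ((∫ x, V x) * (κ * A)) * t ^ (-5 / 4 : ℝ)) t, ?_, ?_⟩
  · have h1 : Set.EqOn (fun t : ℝ => (Set.Ioc (0 : ℝ) 1).piecewise
        (fun t => ((∫ x, V x) * A) * t ^ (-3 / 4 : ℝ))
        (fun t => ((∫ x, V x) * (κ * A)) * t ^ (-5 / 4 : ℝ)) t)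
        (fun t : ℝ => t ^ (1 / 2 : ℝ) * ((t ^ (1 / 2 : ℝ))⁻¹ * (Set.Ioc 0 1).piecewise
          (fun t => ((∫ x, V x) * A) * t ^ (-3 / 4 : ℝ))
          (fun t => ((∫ x, V x) * (κ * A)) * t ^ (-5 / 4 : ℝ)) t)) (Set.Ioi 0) := by
      intro t ht
      have hr : 0 < t ^ (1 / 2 : ℝ) := Real.rpow_pos_of_pos ht _
      simp only
      rw [mul_inv_cancel_left₀ hr.ne']
    refine IntegrableOn.congr_fun ?_ h1 measurableSet_Ioi
    rw [← Set.Ioc_union_Ioi_eq_Ioi zero_le_one]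
    refine IntegrableOn.union ?_ ?_
    · have hi := intervalIntegral.intervalIntegrable_rpow' (a := 0) (b := 1)
        (r := (-3 / 4 : ℝ)) (by norm_num)
      rw [intervalIntegrable_iff_integrableOn_Ioc_of_le zero_le_one] at hi
      refine IntegrableOn.congr_fun (hi.const_mul ((∫ x, V x) * A)) ?_ measurableSet_Ioc
      intro t ht
      simp only
      rw [Set.piecewise_eq_of_mem _ _ _ ht]
    · have hi := integrableOn_Ioi_rpow_of_lt (a := (-5 / 4 : ℝ)) (by norm_num) one_pos
      refine IntegrableOn.congr_fun (hi.const_mul ((∫ x, V x) * (κ * A))) ?_ measurableSet_Ioi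
      intro t ht
      simp only
      rw [Set.piecewise_eq_of_notMem _ _ _ fun h => not_lt.2 h.2 ht]
  · intro t ht ι e s
    have hr : 0 < t ^ (1 / 2 : ℝ) := Real.rpow_pos_of_pos ht _
    rw [smoother_freeRoot hm ht]
    refine (sum_inner_mulOp_fmul_le _ (memLp_two_smootherSymbol hm ht) hV0 hVi hV
      e.orthonormal s).trans ?_
    rw [le_inv_mul_iff₀ hr, mul_left_comm, ← integral_const_mul]
    have hn : ∀ ξ, ‖((smootherSymbol m t ξ : ℝ) : ℂ)‖ ^ 2 = smootherSymbol m t ξ ^ 2 := fun ξ => by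
      rw [Complex.norm_real, Real.norm_eq_abs, sq_abs]
    have hint : Integrable fun ξ => t ^ (1 / 2 : ℝ) * ‖((smootherSymbol m t ξ : ℝ) : ℂ)‖ ^ 2 :=
      ((memLp_two_iff_integrable_sq_norm (memLp_two_smootherSymbol hm ht).1).1
        (memLp_two_smootherSymbol hm ht)).const_mul _
    by_cases h1 : t ∈ Set.Ioc (0 : ℝ) 1
    · rw [Set.piecewise_eq_of_mem _ _ _ h1, mul_assoc]
      gcongr
      rw [mul_comm A, hA, ← integral_const_mul]
      refine integral_mono hint (hAi.const_mul _) fun ξ => ?_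
      simp only [hn]
      exact (sqrt_mul_smootherSymbol_sq_le hm ht ξ).1
    · rw [Set.piecewise_eq_of_notMem _ _ _ h1, mul_assoc]
      gcongr
      rw [mul_comm, hA, ← integral_const_mul, ← integral_const_mul]
      refine integral_mono hint ((hAi.const_mul _).const_mul _) fun ξ => ?_
      simp only [hn]
      exact (sqrt_mul_smootherSymbol_sq_le hm ht ξ).2

end Smoother

/-! ### The factorization K = A*A and the spectral gap -/

section Gap

open Filter Topology

theorem hasDerivAt_tanh_mul (m x : ℝ) :
    HasDerivAt (fun x => Real.tanh (m * x)) (m * (1 / Real.cosh (m * x)) ^ 2) x := by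
  have hx : HasDerivAt (fun x => m * x) m x := by simpa using (hasDerivAt_id x).const_mul m
  have hc := (Real.cosh_pos (m * x)).ne'
  have h := hx.sinh.div hx.cosh hc
  have e : (fun x => Real.tanh (m * x)) = fun x => Real.sinh (m * x) / Real.cosh (m * x) :=
    funext fun x => Real.tanh_eq_sinh_div_cosh _
  rw [e]
  refine h.congr_deriv ?_
  have := Real.cosh_sq (m * x)
  field_simp
  linear_combination m * this

theorem sech_sq_eq (x : ℝ) : (1 / Real.cosh x) ^ 2 = 1 - Real.tanh x ^ 2 := by
  have hc := (Real.cosh_pos x).ne'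
  have := Real.cosh_sq x
  rw [Real.tanh_eq_sinh_div_cosh]
  field_simp
  linear_combination -this

theorem continuous_tanh_mul (m : ℝ) : Continuous fun x => Real.tanh (m * x) :=
  continuous_iff_continuousAt.2 fun x => (hasDerivAt_tanh_mul m x).continuousAt

theorem hasDerivAt_sech_sq (m x : ℝ) :
    HasDerivAt (fun x => (1 / Real.cosh (m * x)) ^ 2)
      (-(2 * m * Real.tanh (m * x)) * (1 / Real.cosh (m * x)) ^ 2) x := by
  have h := ((hasDerivAt_tanh_mul m x).pow 2).const_sub 1
  have e : (fun x => (1 / Real.cosh (m * x)) ^ 2) = fun x => 1 - Real.tanh (m * x) ^ 2 :=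
    funext fun x => sech_sq_eq _
  rw [e]
  refine h.congr_deriv ?_
  push_cast
  ring

/-- The first-order factor `A = ∂ + 2m tanh(m x)` of the operator `K = A* A`. -/
def factor (m : ℝ) (h h' : ℝ → ℂ) (x : ℝ) : ℂ := h' x + (2 * m * Real.tanh (m * x) : ℝ) • h x

variable {m : ℝ}

theorem continuous_factor {h h' : ℝ → ℂ} (hc : Continuous h) (hc' : Continuous h') :
    Continuous (factor m h h') := by
  have := continuous_tanh_mul m
  unfold factor
  fun_prop

/-- A Hardy-type argument with the weight 2 - T, T = tanh(mx), which decreases from 2 to 1.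
Substituting h' = Ah - 2mTh in the derivative of (2 - T)|h|² produces -m(1 + T(8 - 5T))|h|², at most
-m|h|², plus a cross term bounded by 4|h||Ah| ≤ (m/2)|h|² + (8/m)|Ah|². The boundary term vanishes
at 0 and is nonnegative at R, so integration gives the constant (8/m)/(m/2) = 16/m². -/
theorem integral_Ioi_norm_sq_le (hm : 0 < m) {h h' : ℝ → ℂ}
    (hd : ∀ x, HasDerivAt h (h' x) x) (hc : Continuous h') (h0 : h 0 = 0)
    (hi : Integrable fun x => ‖h x‖ ^ 2) (hr : Integrable fun x => ‖factor m h h' x‖ ^ 2) :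
    ∫ x in Set.Ioi 0, ‖h x‖ ^ 2 ≤ 16 / m ^ 2 * ∫ x in Set.Ioi 0, ‖factor m h h' x‖ ^ 2 := by
  have hch : Continuous h := continuous_iff_continuousAt.2 fun x => (hd x).continuousAt
  have hct := continuous_tanh_mul m
  have hcf := continuous_factor (m := m) hch hc
  set G' : ℝ → ℝ := fun x => -(m * (1 - Real.tanh (m * x) ^ 2)) * ‖h x‖ ^ 2
    + (2 - Real.tanh (m * x)) * (2 * inner ℝ (h x) (h' x)) with hG'
  have hG : ∀ x, HasDerivAt (fun x => (2 - Real.tanh (m * x)) * ‖h x‖ ^ 2) (G' x) x := by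
    intro x
    have h1 := ((hasDerivAt_tanh_mul m x).const_sub 2).mul (hd x).norm_sq
    rw [sech_sq_eq] at h1
    exact h1
  have hcG : Continuous G' := by
    have : Continuous fun x => inner ℝ (h x) (h' x) := hch.inner hc
    fun_prop
  have hT : ∀ x, 0 ≤ x → 0 ≤ Real.tanh (m * x) := by
    intro x hx
    rw [Real.tanh_eq_sinh_div_cosh]
    exact div_nonneg (Real.sinh_nonneg_iff.2 (by positivity)) (Real.cosh_pos _).le
  have hpt : ∀ x, 0 ≤ x → G' x ≤ 8 / m * ‖factor m h h' x‖ ^ 2 - m / 2 * ‖h x‖ ^ 2 := by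
    intro x hx
    have t0 := hT x hx
    have t1 := (Real.tanh_lt_one (m * x)).le
    have e1 : inner ℝ (h x) (h' x)
        = inner ℝ (h x) (factor m h h' x) - 2 * m * Real.tanh (m * x) * ‖h x‖ ^ 2 := by
      rw [factor, inner_add_right, inner_smul_right, real_inner_self_eq_norm_sq]
      ring
    have e2 := real_inner_le_norm (h x) (factor m h h' x)
    simp only [hG', e1]
    set T := Real.tanh (m * x)
    set a := ‖h x‖
    set b := ‖factor m h h' x‖
    have ha : 0 ≤ a := norm_nonneg _
    have hb : 0 ≤ b := norm_nonneg _
    have e3 : (2 - T) * (2 * inner ℝ (h x) (factor m h h' x)) ≤ 4 * (a * b) := by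
      have : 0 ≤ a * b := by positivity
      nlinarith
    have e4 : 4 * (a * b) ≤ m / 2 * a ^ 2 + 8 / m * b ^ 2 := by
      have : 0 ≤ (m * a - 4 * b) ^ 2 / (2 * m) := by positivity
      have e : (m * a - 4 * b) ^ 2 / (2 * m) = m / 2 * a ^ 2 + 8 / m * b ^ 2 - 4 * (a * b) := by
        field_simp
        ring
      linarith
    have e5 : 0 ≤ m * (T * (8 - 5 * T)) * a ^ 2 := by
      have : 0 ≤ T * (8 - 5 * T) := mul_nonneg t0 (by linarith)
      positivity
    nlinarith
  have hint : IntegrableOn (fun x => 8 / m * ‖factor m h h' x‖ ^ 2 - m / 2 * ‖h x‖ ^ 2)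
      (Set.Ioi 0) := ((hr.const_mul _).sub (hi.const_mul _)).integrableOn
  have hlim := intervalIntegral_tendsto_integral_Ioi 0 hint tendsto_id
  have hge : 0 ≤ ∫ x in Set.Ioi 0, (8 / m * ‖factor m h h' x‖ ^ 2 - m / 2 * ‖h x‖ ^ 2) := by
    refine ge_of_tendsto hlim ?_
    filter_upwards [eventually_ge_atTop 0] with R hR
    have h1 := intervalIntegral.integral_eq_sub_of_hasDerivAt (a := 0) (b := R)
      (fun x _ => hG x) (hcG.intervalIntegrable _ _)
    have h2 : 0 ≤ ∫ x in (0 : ℝ)..R, G' x := by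
      rw [h1, h0]
      have := Real.tanh_lt_one (m * R)
      have h3 : 0 ≤ (2 - Real.tanh (m * R)) * ‖h R‖ ^ 2 := mul_nonneg (by linarith) (by positivity)
      simpa using h3
    refine h2.trans (intervalIntegral.integral_mono_on hR (hcG.intervalIntegrable _ _)
      (Continuous.intervalIntegrable (by fun_prop) _ _) fun x hx => hpt x hx.1)
  rw [integral_sub (hr.const_mul _).integrableOn (hi.const_mul _).integrableOn,
    integral_const_mul, integral_const_mul] at hge
  set X := ∫ x in Set.Ioi 0, ‖h x‖ ^ 2
  set Y := ∫ x in Set.Ioi 0, ‖factor m h h' x‖ ^ 2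
  have : 2 / m * (m / 2 * X) ≤ 2 / m * (8 / m * Y) := by
    have : 0 < 2 / m := by positivity
    exact mul_le_mul_of_nonneg_left (by linarith) this.le
  have e1 : 2 / m * (m / 2 * X) = X := by field_simp
  have e2 : 2 / m * (8 / m * Y) = 16 / m ^ 2 * Y := by field_simp; ring
  rwa [e1, e2] at this

theorem integral_norm_sq_le_of_eq_zero (hm : 0 < m) {h h' : ℝ → ℂ}
    (hd : ∀ x, HasDerivAt h (h' x) x) (hc : Continuous h') (h0 : h 0 = 0)
    (hi : Integrable fun x => ‖h x‖ ^ 2) (hr : Integrable fun x => ‖factor m h h' x‖ ^ 2) :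
    ∫ x, ‖h x‖ ^ 2 ≤ 16 / m ^ 2 * ∫ x, ‖factor m h h' x‖ ^ 2 := by
  -- Reflection turns A into -A because tanh is odd, so the half-line estimate also covers the
  -- negative axis.
  have hf : ∀ x, ‖factor m (fun x => h (-x)) (fun x => -h' (-x)) x‖ ^ 2
      = ‖factor m h h' (-x)‖ ^ 2 := by
    intro x
    have : factor m (fun x => h (-x)) (fun x => -h' (-x)) x = -factor m h h' (-x) := by
      simp only [factor, mul_neg, Real.tanh_neg, neg_smul]
      abel
    rw [this, norm_neg]
  have h1 := integral_Ioi_norm_sq_le hm hd hc h0 hi hr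
  have h2 := integral_Ioi_norm_sq_le hm (h := fun x => h (-x)) (h' := fun x => -h' (-x))
    (fun x => ((hd (-x)).scomp x (hasDerivAt_neg x)).congr_deriv (by simp)) (by fun_prop) (by simpa using h0)
    hi.comp_neg (by simp only [hf]; exact hr.comp_neg)
  simp only [hf] at h2
  rw [integral_comp_neg_Ioi (f := fun x => ‖h x‖ ^ 2),
    integral_comp_neg_Ioi (f := fun x => ‖factor m h h' x‖ ^ 2), neg_zero] at h2
  rw [← intervalIntegral.integral_Iic_add_Ioi (b := 0) hi.integrableOn hi.integrableOn,
    ← intervalIntegral.integral_Iic_add_Ioi (b := 0) hr.integrableOn hr.integrableOn, mul_add]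
  exact add_le_add h2 h1

theorem integrable_norm_sq_schwartz (f : 𝓢(ℝ, ℂ)) : Integrable fun x => ‖f x‖ ^ 2 :=
  (memLp_two_iff_integrable_sq_norm f.continuous.aestronglyMeasurable).1 (f.memLp 2 volume)

theorem integrable_factor_schwartz (m : ℝ) (f : 𝓢(ℝ, ℂ)) :
    Integrable fun x => ‖factor m f (deriv f) x‖ ^ 2 := by
  have hcd : Continuous (deriv f) := (SchwartzMap.derivCLM ℂ ℂ f).continuous
  have hc : Continuous (factor m f (deriv f)) := continuous_factor f.continuous hcd
  refine (memLp_two_iff_integrable_sq_norm hc.aestronglyMeasurable).1 ?_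
  refine ((SchwartzMap.derivCLM ℂ ℂ f).memLp 2 volume).add ?_
  have hT := continuous_tanh_mul m
  refine ((f.memLp 2 volume).const_mul ((2 * m : ℝ) : ℂ)).mono
    (by fun_prop) (Eventually.of_forall fun x => ?_)
  rw [norm_smul, norm_mul (2 * m), norm_mul ((2 * m : ℝ) : ℂ), Complex.norm_real]
  have : ‖Real.tanh (m * x)‖ ≤ 1 := (Real.abs_tanh_lt_one _).le
  gcongr
  exact mul_le_of_le_one_right (norm_nonneg _) this

/-- The quadratic form of `K` on Schwartz functions is `‖A f‖²`. -/
theorem integral_norm_sq_factor (m : ℝ) (f : 𝓢(ℝ, ℂ)) :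
    ∫ x, ‖factor m f (deriv f) x‖ ^ 2 = (∫ x, ‖deriv f x‖ ^ 2) + 4 * m ^ 2 * (∫ x, ‖f x‖ ^ 2)
      - ∫ x, 6 * m ^ 2 * (1 / Real.cosh (m * x)) ^ 2 * ‖f x‖ ^ 2 := by
  have hi := integrable_norm_sq_schwartz f
  have hi' : Integrable fun x => ‖deriv f x‖ ^ 2 :=
    integrable_norm_sq_schwartz (SchwartzMap.derivCLM ℂ ℂ f)
  have hir := integrable_factor_schwartz m f
  have hs := continuous_sech_sq m
  have hT := continuous_tanh_mul m
  have hcf := f.continuous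
  have hiV : Integrable fun x => 6 * m ^ 2 * (1 / Real.cosh (m * x)) ^ 2 * ‖f x‖ ^ 2 := by
    refine (hi.const_mul (6 * m ^ 2)).mono' (by fun_prop) (Eventually.of_forall fun x => ?_)
    rw [Real.norm_of_nonneg (by positivity)]
    exact mul_le_mul_of_nonneg_right (mul_le_of_le_one_right (by positivity) (sech_sq_le_one _))
      (by positivity)
  -- The difference of the two densities is the derivative of 2m tanh(mx)|f|², which is integrable,
  -- so its integral vanishes.
  set q : ℝ → ℝ := fun x => ‖factor m f (deriv f) x‖ ^ 2 - (‖deriv f x‖ ^ 2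
    + 4 * m ^ 2 * ‖f x‖ ^ 2 - 6 * m ^ 2 * (1 / Real.cosh (m * x)) ^ 2 * ‖f x‖ ^ 2) with hq
  have hqi : Integrable q := hir.sub ((hi'.add (hi.const_mul _)).sub hiV)
  have hG : ∀ x, HasDerivAt (fun x => 2 * m * Real.tanh (m * x) * ‖f x‖ ^ 2) (q x) x := by
    intro x
    have h1 := ((hasDerivAt_tanh_mul m x).const_mul (2 * m)).mul (f.hasDerivAt x).norm_sq
    refine h1.congr_deriv ?_
    have h2 : ‖factor m f (deriv f) x‖ ^ 2 = ‖deriv f x‖ ^ 2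
        + 2 * (2 * m * Real.tanh (m * x) * inner ℝ (f x) (deriv f x))
        + (2 * m * Real.tanh (m * x)) ^ 2 * ‖f x‖ ^ 2 := by
      rw [factor, norm_add_sq_real, inner_smul_right, norm_smul, mul_pow, Real.norm_eq_abs, sq_abs,
        real_inner_comm]
    simp only [hq]
    rw [h2, sech_sq_eq]
    ring
  have hGi : Integrable fun x => 2 * m * Real.tanh (m * x) * ‖f x‖ ^ 2 := by
    refine (hi.const_mul |2 * m|).mono' (by fun_prop) (Eventually.of_forall fun x => ?_)
    rw [norm_mul, norm_mul, Real.norm_of_nonneg (by positivity : 0 ≤ ‖f x‖ ^ 2)]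
    gcongr
    exact mul_le_of_le_one_right (norm_nonneg _) (Real.abs_tanh_lt_one _).le
  have h0 := integral_eq_zero_of_hasDerivAt_of_integrable hG hqi hGi
  have h1 := integral_sub hir ((hi'.add (hi.const_mul (4 * m ^ 2))).sub hiV)
  have h2 := integral_sub (hi'.add (hi.const_mul (4 * m ^ 2))) hiV
  have h3 := integral_add hi' (hi.const_mul (4 * m ^ 2))
  rw [integral_const_mul (4 * m ^ 2)] at h3
  simp only [Pi.add_apply, Pi.sub_apply] at h1 h2 h3
  simp only [hq] at h0
  linarith

/-- Spectral gap: `‖(1 - P₀) f‖ ≤ (4/m) ‖A f‖`. -/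
theorem norm_sub_P₀_sq_le (hm : 0 < m) (f : 𝓢(ℝ, ℂ)) :
    ‖f.toLp 2 volume - P₀ m (f.toLp 2 volume)‖ ^ 2 ≤ 16 / m ^ 2 * ∫ x, ‖factor m f (deriv f) x‖ ^ 2 := by
  have hk : 0 < √(3 * m / 4) := Real.sqrt_pos.2 (by positivity)
  -- Here √(3m/4) = ψ₀(0), so f - cψ₀ vanishes at 0, and Af is unchanged because Aψ₀ = 0. The
  -- multiple need not be the orthogonal one: the projection minimizes the distance to the span.
  set c : ℂ := f 0 / (√(3 * m / 4) : ℂ) with hc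
  set h : ℝ → ℂ := fun x => f x - c * zeroModeFun m x with hh
  set h' : ℝ → ℂ := fun x => deriv f x
    - c * ((-(2 * m * Real.tanh (m * x)) : ℝ) * zeroModeFun m x) with hh'
  have hmem : MemLp h 2 volume := (f.memLp 2 volume).sub ((memLp_zeroModeFun m).const_mul c)
  have hz : Continuous (zeroModeFun m) := by
    unfold zeroModeFun
    have := continuous_sech_sq m
    fun_prop
  have hL : (hmem.toLp : L2R) = f.toLp 2 volume - c • zeroMode m := by
    exact MemLp.toLp_sub (f.memLp 2 volume) ((memLp_zeroModeFun m).const_mul c)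
  have hle : ‖f.toLp 2 volume - P₀ m (f.toLp 2 volume)‖ ≤ ‖(hmem.toLp : L2R)‖ := by
    rw [hL, P₀, Submodule.starProjection_minimal]
    exact ciInf_le ⟨0, by rintro _ ⟨x, rfl⟩; exact norm_nonneg _⟩
      (⟨c • zeroMode m, Submodule.smul_mem _ _ (Submodule.mem_span_singleton_self _)⟩ :
        Submodule.span ℂ {zeroMode m})
  have hfac : ∀ x, factor m h h' x = factor m f (deriv f) x := by
    intro x
    simp only [factor, hh, hh', Complex.real_smul]
    push_cast
    ring
  have hd : ∀ x, HasDerivAt h (h' x) x := by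
    intro x
    refine (f.hasDerivAt x).sub (HasDerivAt.const_mul c ?_)
    have h1 := ((hasDerivAt_sech_sq m x).const_mul √(3 * m / 4)).ofReal_comp
    refine h1.congr_deriv ?_
    rw [zeroModeFun]
    push_cast
    ring
  have hcd : Continuous (deriv f) := (SchwartzMap.derivCLM ℂ ℂ f).continuous
  have hT := continuous_tanh_mul m
  have h0 : h 0 = 0 := by
    have hk' : (√(3 * m / 4) : ℂ) ≠ 0 := by exact_mod_cast hk.ne'
    simp only [hh, zeroModeFun, mul_zero, Real.cosh_zero, hc]
    push_cast
    field_simp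
    simp
  have key := integral_norm_sq_le_of_eq_zero hm hd (by fun_prop) h0
    ((memLp_two_iff_integrable_sq_norm hmem.1).1 hmem)
    (by simp only [hfac]; exact integrable_factor_schwartz m f)
  simp only [hfac] at key
  calc ‖f.toLp 2 volume - P₀ m (f.toLp 2 volume)‖ ^ 2 ≤ ‖(hmem.toLp : L2R)‖ ^ 2 := by gcongr
    _ = ∫ x, ‖h x‖ ^ 2 := norm_sq_toLp hmem
    _ ≤ _ := key

end Gap

/-! ### Coercivity of K^θ and the operator statements -/

section FirstPart

open FourierTransform

variable {m : ℝ}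

theorem freePow_toLp (hm : 0 < m) {s : ℝ} (hs : s ≤ 0) (g : 𝓢(ℝ, ℂ)) :
    freePow hm s hs (g.toLp 2 volume) = (SchwartzMap.fourierMultiplierCLM ℂ
      (fun ξ : ℝ => ((disp m ξ ^ s : ℝ) : ℂ)) g).toLp 2 volume := by
  apply toTempered_injective
  have hg := hasTemperateGrowth_ofReal_disp_rpow hm s
  simp only [Lp.toTemperedDistributionCLM_apply]
  rw [freePow, toTempered_fmul _ hg, Lp.toTemperedDistribution_toLp_eq,
    Lp.toTemperedDistribution_toLp_eq,
    TemperedDistribution.fourierMultiplierCLM_toTemperedDistributionCLM_eq hg]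

theorem fourier_fourierMultiplier_apply {g : ℝ → ℂ} (hg : g.HasTemperateGrowth) (f : 𝓢(ℝ, ℂ))
    (ξ : ℝ) : 𝓕 (SchwartzMap.fourierMultiplierCLM ℂ g f) ξ = g ξ * 𝓕 f ξ := by
  rw [SchwartzMap.fourierMultiplierCLM_apply, FourierTransform.fourier_fourierInv_eq,
    SchwartzMap.smulLeftCLM_apply_apply hg, smul_eq_mul]

theorem norm_sq_toLp_schwartz (f : 𝓢(ℝ, ℂ)) : ‖f.toLp 2 volume‖ ^ 2 = ∫ x, ‖f x‖ ^ 2 :=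
  norm_sq_toLp (f.memLp 2 volume)

/-- `‖K₀^{1/2} f‖² = ‖f'‖² + 4m² ‖f‖²`. -/
theorem norm_sq_eq_of_freePow (hm : 0 < m) (g : 𝓢(ℝ, ℂ)) :
    ∀ f, f = SchwartzMap.fourierMultiplierCLM ℂ
      (fun ξ : ℝ => ((disp m ξ ^ (-1 / 2 : ℝ) : ℝ) : ℂ)) g →
    ∫ x, ‖g x‖ ^ 2 = (∫ x, ‖deriv f x‖ ^ 2) + 4 * m ^ 2 * ∫ x, ‖f x‖ ^ 2 := by
  intro f hf
  have h1 : ∀ ξ, 𝓕 f ξ = ((disp m ξ ^ (-1 / 2 : ℝ) : ℝ) : ℂ) * 𝓕 g ξ := fun ξ => by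
    rw [hf, fourier_fourierMultiplier_apply (hasTemperateGrowth_ofReal_disp_rpow hm _)]
  have h2 : ∀ ξ, 𝓕 (SchwartzMap.derivCLM ℂ ℂ f) ξ = (2 * Real.pi * Complex.I * ξ) * 𝓕 f ξ := by
    intro ξ
    have h := Real.fourier_deriv f.integrable f.differentiable
      (SchwartzMap.derivCLM ℂ ℂ f).integrable
    have h' := congrFun h ξ
    rw [smul_eq_mul] at h'
    exact h'
  have h3 : ∀ ξ, ‖𝓕 g ξ‖ ^ 2 = ‖𝓕 (SchwartzMap.derivCLM ℂ ℂ f) ξ‖ ^ 2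
      + 4 * m ^ 2 * ‖𝓕 f ξ‖ ^ 2 := by
    intro ξ
    have hp := disp_pos hm ξ
    have e : ‖𝓕 g ξ‖ ^ 2 = disp m ξ * ‖𝓕 f ξ‖ ^ 2 := by
      rw [h1, norm_mul, mul_pow, Complex.norm_real, Real.norm_of_nonneg (by positivity),
        ← Real.rpow_natCast (disp m ξ ^ (-1 / 2 : ℝ)), ← Real.rpow_mul hp.le,
        show (-1 / 2 : ℝ) * (2 : ℕ) = -1 by norm_num, Real.rpow_neg_one,
        mul_inv_cancel_left₀ hp.ne']
    rw [e, h2, norm_mul, mul_pow, disp]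
    have : ‖(2 * Real.pi * Complex.I * ξ : ℂ)‖ ^ 2 = (2 * Real.pi * ξ) ^ 2 := by
      simp [mul_pow]
    rw [this]
    ring
  have h4 := SchwartzMap.integral_norm_sq_fourier (SchwartzMap.derivCLM ℂ ℂ f)
  rw [← SchwartzMap.integral_norm_sq_fourier g, ← SchwartzMap.integral_norm_sq_fourier f]
  simp only [SchwartzMap.derivCLM_apply] at h4
  rw [← h4]
  simp only [h3]
  rw [integral_add (integrable_norm_sq_schwartz _) ((integrable_norm_sq_schwartz _).const_mul _),
    integral_const_mul]

theorem isSelfAdjoint_freeRoot (hm : 0 < m) : IsSelfAdjoint (freeRoot hm) :=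
  (freePow_nonneg hm _).isSelfAdjoint

theorem isSelfAdjoint_P₀ (m : ℝ) : IsSelfAdjoint (P₀ m) := isSelfAdjoint_starProjection _

theorem P₀_mul_P₀ (m : ℝ) : P₀ m * P₀ m = P₀ m := Submodule.isIdempotentElem_starProjection _

theorem inner_P₀ (m : ℝ) (x : L2R) : inner ℂ x (P₀ m x) = ((‖P₀ m x‖ ^ 2 : ℝ) : ℂ) := by
  have h : P₀ m x = P₀ m (P₀ m x) := by
    conv_lhs => rw [← P₀_mul_P₀]
    rfl
  rw [h, ← inner_map_comm (isSelfAdjoint_P₀ m), ← h, inner_self_eq_norm_sq_to_K]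
  push_cast
  rfl

/-- The square root `√6 m sech(m x)` of the potential. -/
def rootPotential (m x : ℝ) : ℝ := √6 * m * (1 / Real.cosh (m * x))

theorem rootPotential_sq (m x : ℝ) :
    rootPotential m x ^ 2 = 6 * m ^ 2 * (1 / Real.cosh (m * x)) ^ 2 := by
  rw [rootPotential, mul_pow, mul_pow, Real.sq_sqrt (by norm_num)]

theorem continuous_rootPotential (m : ℝ) : Continuous (rootPotential m) := by
  have h : ∀ x : ℝ, Real.cosh (m * x) ≠ 0 := fun x => (Real.cosh_pos _).ne'
  unfold rootPotential
  fun_prop (disch := exact h _)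

theorem memLp_rootPotential (m : ℝ) :
    MemLp (fun x => (rootPotential m x : ℂ)) ⊤ (volume : Measure ℝ) := by
  refine memLp_top_of_continuous_bdd (c := √(6 * m ^ 2))
    (Complex.continuous_ofReal.comp (continuous_rootPotential m)) fun x => ?_
  rw [Complex.norm_real]
  apply Real.le_sqrt_of_sq_le
  rw [Real.norm_eq_abs, sq_abs, rootPotential_sq]
  exact mul_le_of_le_one_right (by positivity) (sech_sq_le_one _)

def rootPotentialOp (m : ℝ) : L2R →L[ℂ] L2R := mulOp _ (memLp_rootPotential m)

theorem isSelfAdjoint_rootPotentialOp (m : ℝ) : IsSelfAdjoint (rootPotentialOp m) :=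
  isSelfAdjoint_mulOp _ fun _ => Complex.conj_ofReal _

theorem potential_eq (m : ℝ) : potential m = rootPotentialOp m * rootPotentialOp m := by
  refine (mulOp_mul _ _ (memLp_potential m) fun x => ?_).symm
  rw [← rootPotential_sq]
  push_cast
  ring

theorem isSelfAdjoint_potential (m : ℝ) : IsSelfAdjoint (potential m) :=
  isSelfAdjoint_mulOp _ fun _ => Complex.conj_ofReal _

theorem inner_potential (m : ℝ) (x : L2R) :
    inner ℂ x (potential m x) = ((‖rootPotentialOp m x‖ ^ 2 : ℝ) : ℂ) := by
  rw [potential_eq, mul_apply_eq_comp, ← inner_map_comm (isSelfAdjoint_rootPotentialOp m),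
    inner_self_eq_norm_sq_to_K]
  push_cast
  rfl

theorem integrable_sech_sq (hm : 0 < m) :
    Integrable fun x => (1 / Real.cosh (m * x)) ^ 2 := by
  refine (integrable_inv_one_add_sq.comp_mul_left' hm.ne').mono'
    (continuous_sech_sq m).aestronglyMeasurable (Filter.Eventually.of_forall fun x => ?_)
  rw [Real.norm_of_nonneg (by positivity)]
  exact sech_sq_le _

theorem norm_P₀_le (m : ℝ) (x : L2R) :
    ‖P₀ m x‖ ≤ ‖zeroMode m‖ / ‖zeroMode m‖ ^ 2 * ‖inner ℂ x (zeroMode m)‖ := by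
  rw [P₀, Submodule.starProjection_singleton, norm_smul, norm_div, norm_inner_symm]
  rw [RCLike.norm_ofReal, abs_of_nonneg (by positivity)]
  apply le_of_eq
  ring

/-- Since ψ₀ is √V times a multiple of sech, which lies in L², ⟨x, ψ₀⟩ is controlled by ‖√V x‖. The
projection is thus dominated by the same form as the potential. -/
theorem exists_norm_P₀_le (hm : 0 < m) :
    ∃ b, 0 ≤ b ∧ ∀ x, ‖P₀ m x‖ ≤ b * ‖rootPotentialOp m x‖ := by
  have hmem : MemLp (fun x => ((√(3 * m / 4) / (√6 * m) * (1 / Real.cosh (m * x)) : ℝ) : ℂ)) 2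
      (volume : Measure ℝ) := by
    suffices h : MemLp (fun x => √(3 * m / 4) / (√6 * m) * (1 / Real.cosh (m * x))) 2
      (volume : Measure ℝ) from h.ofReal
    refine MemLp.const_mul ?_ _
    have hc : Continuous fun x => 1 / Real.cosh (m * x) := by
      have h : ∀ x : ℝ, Real.cosh (m * x) ≠ 0 := fun x => (Real.cosh_pos _).ne'
      fun_prop (disch := exact h _)
    rw [memLp_two_iff_integrable_sq hc.aestronglyMeasurable]
    exact integrable_sech_sq hm
  have hz : zeroMode m = rootPotentialOp m hmem.toLp := by
    apply Lp.ext
    filter_upwards [(memLp_zeroModeFun m).coeFn_toLp,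
      coeFn_mulOp (memLp_rootPotential m) hmem.toLp, hmem.coeFn_toLp] with x h1 h2 h3
    rw [zeroMode, h1, rootPotentialOp, h2, h3, ← Complex.ofReal_mul, zeroModeFun, rootPotential]
    congr 1
    field_simp
  refine ⟨‖zeroMode m‖ / ‖zeroMode m‖ ^ 2 * ‖(hmem.toLp : L2R)‖, by positivity, fun x => ?_⟩
  refine (norm_P₀_le m x).trans ?_
  rw [mul_assoc]
  gcongr
  conv_lhs => rw [hz]
  rw [← inner_map_comm (isSelfAdjoint_rootPotentialOp m)]
  exact (norm_inner_le_norm _ _).trans (mul_comm _ _).le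

/-- For f = K₀^{-1/2}u the form is Q = ⟨f, K^θ f⟩ = ‖Af‖² + θ‖P₀f‖², and the gap gives Q ≥ c‖f‖²
with c = min(m²/16, θ). To recover ‖u‖, note that ‖u‖² ≤ Q + ⟨f, Vf⟩ ≤ Q + 6m²‖f‖² ≤ (1 + 6m²/c)Q,
whence the constant c/(c + 6m²). Schwartz functions suffice by density. -/
theorem exists_coercive (hm : 0 < m) {θ : ℝ} (hθ : 0 < θ) :
    ∃ lam > 0, ∀ u : L2R, lam * ‖u‖ ^ 2 ≤ (inner ℂ u ((1 + freeRoot hm ^ 2 *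
      (-(potential m - (θ : ℂ) • P₀ m)) * freeRoot hm ^ 2 : L2R →L[ℂ] L2R) u)).re := by
  set c := min (m ^ 2 / 16) θ with hc
  have hc0 : 0 < c := lt_min (by positivity) hθ
  refine ⟨c / (c + 6 * m ^ 2), by positivity, ?_⟩
  have hcl : IsClosed {u : L2R | c / (c + 6 * m ^ 2) * ‖u‖ ^ 2 ≤ (inner ℂ u ((1 + freeRoot hm ^ 2 *
      (-(potential m - (θ : ℂ) • P₀ m)) * freeRoot hm ^ 2 : L2R →L[ℂ] L2R) u)).re} := by
    refine isClosed_le (by fun_prop) ?_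
    exact Complex.continuous_re.comp (continuous_id.inner (ContinuousLinearMap.continuous _))
  intro u
  have hd : DenseRange (SchwartzMap.toLpCLM ℂ ℂ 2 (volume : Measure ℝ)) :=
    SchwartzMap.denseRange_toLpCLM (by norm_num)
  refine hd.induction_on (p := fun u => c / (c + 6 * m ^ 2) * ‖u‖ ^ 2 ≤ (inner ℂ u
    ((1 + freeRoot hm ^ 2 * (-(potential m - (θ : ℂ) • P₀ m)) * freeRoot hm ^ 2 :
      L2R →L[ℂ] L2R) u)).re) u hcl fun g => ?_
  simp only [SchwartzMap.toLpCLM_apply]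
  set U : L2R := g.toLp 2 volume with hU
  set f := SchwartzMap.fourierMultiplierCLM ℂ
      (fun ξ : ℝ => ((disp m ξ ^ (-1 / 2 : ℝ) : ℝ) : ℂ)) g with hf
  set F : L2R := f.toLp 2 volume with hF
  have hUF : (freeRoot hm ^ 2) U = F := by
    rw [freeRoot_pow_two, hU, freePow_toLp]
  have e1 : (inner ℂ U ((1 + freeRoot hm ^ 2 * (-(potential m - (θ : ℂ) • P₀ m)) *
      freeRoot hm ^ 2 : L2R →L[ℂ] L2R) U)).re
      = ‖U‖ ^ 2 - ‖rootPotentialOp m F‖ ^ 2 + θ * ‖P₀ m F‖ ^ 2 := by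
    rw [add_apply, one_apply_eq_self, mul_apply_eq_comp, mul_apply_eq_comp, hUF, inner_add_right,
      ← inner_map_comm ((isSelfAdjoint_freeRoot hm).pow 2), hUF, neg_apply,
      sub_apply, smul_apply, inner_neg_right, inner_sub_right, inner_smul_right, inner_potential,
      inner_P₀, inner_self_eq_norm_sq_to_K, ← Complex.ofReal_mul]
    simp only [Complex.add_re, Complex.neg_re, Complex.sub_re, Complex.ofReal_re]
    have : (((‖U‖ : ℂ)) ^ 2).re = ‖U‖ ^ 2 := by norm_cast
    rw [← this]
    simp only [RCLike.ofReal_eq_complex_ofReal]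
    ring
  have e2 : ‖rootPotentialOp m F‖ ^ 2
      = ∫ x, 6 * m ^ 2 * (1 / Real.cosh (m * x)) ^ 2 * ‖f x‖ ^ 2 := by
    have h1 := (re_inner_mulOp_ofReal (memLp_potential m) F).2
    have h2 : inner ℂ F (mulOp _ (memLp_potential m) F)
      = ((‖rootPotentialOp m F‖ ^ 2 : ℝ) : ℂ) := inner_potential m F
    rw [h2] at h1
    rw [Complex.ofReal_injective h1]
    refine integral_congr_ae ?_
    filter_upwards [(f.memLp 2 volume).coeFn_toLp] with x hx
    rw [← hx]
    rfl
  have e3 : ‖U‖ ^ 2 = (∫ x, ‖deriv f x‖ ^ 2) + 4 * m ^ 2 * ∫ x, ‖f x‖ ^ 2 := by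
    rw [hU, norm_sq_toLp_schwartz, norm_sq_eq_of_freePow hm g f hf]
  have e4 := integral_norm_sq_factor m f
  have e5 := norm_sub_P₀_sq_le hm f
  have e6 : ‖F‖ ^ 2 = ‖F - P₀ m F‖ ^ 2 + ‖P₀ m F‖ ^ 2 := by
    have h := Submodule.norm_sq_eq_add_norm_sq_starProjection F (Submodule.span ℂ {zeroMode m})
    rw [Submodule.starProjection_orthogonal', sub_apply, add_comm] at h
    exact h
  have e7 : ‖rootPotentialOp m F‖ ^ 2 ≤ 6 * m ^ 2 * ‖F‖ ^ 2 := by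
    rw [e2, hF, norm_sq_toLp_schwartz, ← integral_const_mul]
    refine integral_mono_of_nonneg (Filter.Eventually.of_forall fun x => by positivity)
      ((integrable_norm_sq_schwartz f).const_mul _) (Filter.Eventually.of_forall fun x => ?_)
    exact mul_le_mul_of_nonneg_right (mul_le_of_le_one_right (by positivity) (sech_sq_le_one _))
      (by positivity)
  rw [e1]
  set R := ∫ x, ‖factor m f (deriv f) x‖ ^ 2
  have hR : 0 ≤ R := integral_nonneg fun x => by positivity
  have q1 : ‖U‖ ^ 2 - ‖rootPotentialOp m F‖ ^ 2 + θ * ‖P₀ m F‖ ^ 2 = R + θ * ‖P₀ m F‖ ^ 2 := by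
    linarith
  have q2 : c * ‖F‖ ^ 2 ≤ R + θ * ‖P₀ m F‖ ^ 2 := by
    have c1 : c ≤ m ^ 2 / 16 := min_le_left _ _
    have c2 : c ≤ θ := min_le_right _ _
    have h1 : c * ‖F - P₀ m F‖ ^ 2 ≤ R := by
      calc c * ‖F - P₀ m F‖ ^ 2 ≤ m ^ 2 / 16 * (16 / m ^ 2 * R) := by gcongr
        _ = R := by field_simp
    have h2 : c * ‖P₀ m F‖ ^ 2 ≤ θ * ‖P₀ m F‖ ^ 2 := by gcongr
    rw [e6]
    linarith
  have q3 : 0 ≤ θ * ‖P₀ m F‖ ^ 2 := by positivity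
  rw [q1, div_mul_eq_mul_div, div_le_iff₀ (by positivity)]
  nlinarith [sq_nonneg m]

theorem isSelfAdjoint_perturbation (m θ : ℝ) :
    IsSelfAdjoint (potential m - (θ : ℂ) • P₀ m : L2R →L[ℂ] L2R) := by
  have h : star (θ : ℂ) = θ := Complex.conj_ofReal _
  rw [IsSelfAdjoint, star_sub, star_smul, (isSelfAdjoint_potential m).star_eq,
    (isSelfAdjoint_P₀ m).star_eq, h]

theorem exists_operators (hm : 0 < m) {θ : ℝ} (hθ : 0 < θ) : ∃ C₀ Cθ D : L2R →L[ℂ] L2R,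
    (IsBoundedInverse (K₀ m) C₀ ∧ 0 ≤ C₀) ∧ (IsBoundedInverse (Kθ m θ) Cθ ∧ 0 ≤ Cθ) ∧
    IsBoundedInverse (comparison m θ C₀) D ∧
    IsTraceClassOp (sandwich C₀ (bpow Cθ (1 / 2) - bpow C₀ (1 / 2))) ∧
    IsTraceClassOp (sandwich C₀ (D - bpow C₀ (1 / 2))) ∧
    IsTraceClassOp (sandwich C₀ (bpow Cθ (1 / 2) - D)) := by
  have hh : 0 ≤ freeRoot hm := freePow_nonneg hm _
  have hA : IsBoundedInverse (K₀ m) (freeRoot hm ^ 4) := by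
    rw [freeRoot_pow_four]; exact isBoundedInverse_K₀ hm
  have hW := isSelfAdjoint_perturbation m θ
  obtain ⟨lam, hlam, hcoer⟩ := exists_coercive hm hθ
  obtain ⟨b, hb, hPb⟩ := exists_norm_P₀_le hm
  have hVi : Integrable fun x => 6 * m ^ 2 * (1 / Real.cosh (m * x)) ^ 2 :=
    (integrable_sech_sq hm).const_mul _
  obtain ⟨φ, hφ, hp⟩ := exists_smoother_majorant hm
    (V := fun x => 6 * m ^ 2 * (1 / Real.cosh (m * x)) ^ 2) (fun x => by positivity) hVi
    (memLp_potential m)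
  set w := rootPotentialOp m with hw
  have hpx : ∀ x, (inner ℂ x (mulOp _ (memLp_potential m) x)).re = ‖w x‖ ^ 2 := by
    intro x
    have h2 : inner ℂ x (mulOp _ (memLp_potential m) x) = ((‖w x‖ ^ 2 : ℝ) : ℂ) :=
      inner_potential m x
    rw [h2, Complex.ofReal_re]
  simp only [hpx] at hp
  have hPsq : ∀ x, ‖P₀ m x‖ ^ 2 ≤ b ^ 2 * ‖w x‖ ^ 2 := fun x => by
    rw [← mul_pow]
    exact pow_le_pow_left₀ (norm_nonneg _) (hPb x) 2
  -- The abstract comparison takes one constant for both bounds: 1 + θb² serves the form and 2‖w‖² +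
  -- 2θ²b² the squared norm, and their sum serves both.
  have h1 : ∀ x, ‖inner ℂ x ((potential m - (θ : ℂ) • P₀ m) x)‖
      ≤ (1 + θ * b ^ 2 + 2 * ‖w‖ ^ 2 + 2 * θ ^ 2 * b ^ 2) * ‖w x‖ ^ 2 := by
    intro x
    rw [sub_apply, smul_apply, inner_sub_right, inner_smul_right, inner_potential, inner_P₀]
    refine (norm_sub_le _ _).trans ?_
    rw [norm_mul, Complex.norm_real, Complex.norm_real, Complex.norm_real,
      Real.norm_of_nonneg (by positivity), Real.norm_of_nonneg hθ.le,
      Real.norm_of_nonneg (by positivity)]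
    have e1 : θ * ‖P₀ m x‖ ^ 2 ≤ θ * (b ^ 2 * ‖w x‖ ^ 2) := by gcongr; exact hPsq x
    have e2 : 0 ≤ (2 * ‖w‖ ^ 2 + 2 * θ ^ 2 * b ^ 2) * ‖w x‖ ^ 2 := by positivity
    linarith
  have h2 : ∀ x, ‖(potential m - (θ : ℂ) • P₀ m) x‖ ^ 2
      ≤ (1 + θ * b ^ 2 + 2 * ‖w‖ ^ 2 + 2 * θ ^ 2 * b ^ 2) * ‖w x‖ ^ 2 := by
    intro x
    have e0 : ‖(potential m - (θ : ℂ) • P₀ m) x‖ ≤ ‖w‖ * ‖w x‖ + θ * ‖P₀ m x‖ := by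
      rw [sub_apply, smul_apply, potential_eq, mul_apply_eq_comp]
      refine (norm_sub_le _ _).trans (add_le_add (ContinuousLinearMap.le_opNorm _ _) ?_)
      rw [norm_smul, Complex.norm_real, Real.norm_of_nonneg hθ.le]
    have e1 := pow_le_pow_left₀ (norm_nonneg _) e0 2
    have e2 : (‖w‖ * ‖w x‖ + θ * ‖P₀ m x‖) ^ 2
        ≤ 2 * (‖w‖ ^ 2 * ‖w x‖ ^ 2) + 2 * θ ^ 2 * ‖P₀ m x‖ ^ 2 := by
      nlinarith [sq_nonneg (‖w‖ * ‖w x‖ - θ * ‖P₀ m x‖)]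
    have e3 : 2 * θ ^ 2 * ‖P₀ m x‖ ^ 2 ≤ 2 * θ ^ 2 * (b ^ 2 * ‖w x‖ ^ 2) := by
      gcongr; exact hPsq x
    have e4 : 0 ≤ (1 + θ * b ^ 2) * ‖w x‖ ^ 2 := by positivity
    linarith
  obtain ⟨C, D, hC, hD, t1, t2, t3⟩ := exists_inverses_traceClass hh
    (freePow_injective hm _) hA hW hlam hcoer (isSelfAdjoint_P₀ m) (P₀_mul_P₀ m) (zeroMode m) _
    (norm_P₀_le m) √θ (Real.sqrt_nonneg θ) (by positivity) h1 h2 hφ hp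
  refine ⟨freeRoot hm ^ 4, C, D, ⟨hA, CStarAlgebra.pow_nonneg hh 4⟩, ?_, hD, t1, t2, t3⟩
  have e : Kθ m θ = ((-(potential m - (θ : ℂ) • P₀ m) : L2R →L[ℂ] L2R) : L2R →ₗ[ℂ] L2R) +ᵥ K₀ m := by
    rw [Kθ, K, ← add_vadd]
    congr 1
    rw [neg_sub, sub_eq_add_neg]
    rfl
  rw [e]
  exact hC

end FirstPart

/-! ### Symbol classes on the line -/

section Symbols

/-- The squared Japanese bracket `1 + x²`. -/
def bracket (x : ℝ) : ℝ := 1 + x ^ 2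

theorem one_le_bracket (x : ℝ) : 1 ≤ bracket x := le_add_of_nonneg_right (sq_nonneg x)

theorem bracket_pos (x : ℝ) : 0 < bracket x := one_pos.trans_le (one_le_bracket x)

theorem bracket_rpow_pos (x s : ℝ) : 0 < bracket x ^ s := Real.rpow_pos_of_pos (bracket_pos x) s

theorem bracket_neg (x : ℝ) : bracket (-x) = bracket x := by simp [bracket]

theorem bracket_rpow_mono (x : ℝ) {s r : ℝ} (h : s ≤ r) : bracket x ^ s ≤ bracket x ^ r :=
  Real.rpow_le_rpow_of_exponent_le (one_le_bracket x) h

theorem integrable_bracket_rpow {s : ℝ} (hs : s < -1 / 2) : Integrable fun x => bracket x ^ s := by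
  have h := integrable_rpow_neg_one_add_norm_sq (E := ℝ) (μ := volume) (r := -2 * s)
    (by simp; linarith)
  refine h.congr (Filter.Eventually.of_forall fun x => ?_)
  simp only [bracket, Real.norm_eq_abs, sq_abs]
  congr 1
  ring

theorem abs_le_bracket_rpow_half (x : ℝ) : |x| ≤ bracket x ^ (1 / 2 : ℝ) := by
  rw [← Real.sqrt_eq_rpow]
  apply Real.abs_le_sqrt
  rw [bracket]
  linarith

theorem bracket_add_le (x y : ℝ) : bracket (x + y) ≤ 2 * (bracket x * bracket y) := by
  unfold bracket
  nlinarith [sq_nonneg (x - y), sq_nonneg (x * y), sq_nonneg x, sq_nonneg y]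

/-- Peetre's inequality. -/
theorem bracket_add_rpow_le (x y s : ℝ) :
    bracket (x + y) ^ s ≤ 2 ^ |s| * (bracket x ^ s * bracket y ^ |s|) := by
  have hx := bracket_pos x
  have hy := bracket_pos y
  have hxy := bracket_pos (x + y)
  rcases le_total 0 s with hs | hs
  · rw [abs_of_nonneg hs, ← Real.mul_rpow hx.le hy.le, ← Real.mul_rpow (by norm_num) (by positivity)]
    exact Real.rpow_le_rpow hxy.le (bracket_add_le x y) hs
  -- For negative exponents the elementary inequality is applied to x = (x + y) + (-y).
  · have h1 : bracket x ≤ 2 * (bracket (x + y) * bracket y) := by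
      have := bracket_add_le (x + y) (-y)
      rwa [bracket_neg, add_neg_cancel_right] at this
    have h2 := Real.rpow_le_rpow_of_nonpos hx h1 hs
    rw [Real.mul_rpow (by norm_num) (by positivity), Real.mul_rpow hxy.le hy.le] at h2
    rw [abs_of_nonpos hs]
    calc bracket (x + y) ^ s
        = 2 ^ (-s) * (2 ^ s * (bracket (x + y) ^ s * bracket y ^ s) * bracket y ^ (-s)) := by
          rw [Real.rpow_neg (by norm_num), Real.rpow_neg hy.le]
          have := (bracket_rpow_pos y s).ne'
          have h2 : (2 : ℝ) ^ s ≠ 0 := by positivity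
          field_simp
      _ ≤ 2 ^ (-s) * (bracket x ^ s * bracket y ^ (-s)) := by gcongr

/-- Symbols of order `2s`, with control of `n` derivatives. -/
def IsSymbol : ℕ → ℝ → (ℝ → ℝ) → Prop
  | 0, s, g => Continuous g ∧ ∃ C, 0 ≤ C ∧ ∀ x, |g x| ≤ C * bracket x ^ s
  | n + 1, s, g => (∃ C, 0 ≤ C ∧ ∀ x, |g x| ≤ C * bracket x ^ s) ∧
      ∃ g' : ℝ → ℝ, (∀ x, HasDerivAt g (g' x) x) ∧ IsSymbol n (s - 1 / 2) g'

namespace IsSymbol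

theorem bound : ∀ {n : ℕ} {s : ℝ} {g : ℝ → ℝ}, IsSymbol n s g →
    ∃ C, 0 ≤ C ∧ ∀ x, |g x| ≤ C * bracket x ^ s
  | 0, _, _, h => h.2
  | _ + 1, _, _, h => h.1

theorem continuous : ∀ {n : ℕ} {s : ℝ} {g : ℝ → ℝ}, IsSymbol n s g → Continuous g
  | 0, _, _, h => h.1
  | _ + 1, _, _, h => by
    obtain ⟨g', hg, -⟩ := h.2
    exact continuous_iff_continuousAt.2 fun x => (hg x).continuousAt

theorem lower : ∀ {n : ℕ} {s : ℝ} {g : ℝ → ℝ}, IsSymbol (n + 1) s g → IsSymbol n s g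
  | 0, _, _, h => ⟨h.continuous, h.1⟩
  | _ + 1, _, _, h => by
    obtain ⟨hb, g', hg, h'⟩ := h
    exact ⟨hb, g', hg, h'.lower⟩

theorem mono : ∀ {n : ℕ} {s r : ℝ} {g : ℝ → ℝ}, s ≤ r → IsSymbol n s g → IsSymbol n r g
  | 0, _, _, _, hsr, h => by
    obtain ⟨hc, C, hC, hb⟩ := h
    exact ⟨hc, C, hC, fun x => (hb x).trans
      (mul_le_mul_of_nonneg_left (bracket_rpow_mono x hsr) hC)⟩
  | _ + 1, _, _, _, hsr, h => by
    obtain ⟨⟨C, hC, hb⟩, g', hg, h'⟩ := h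
    exact ⟨⟨C, hC, fun x => (hb x).trans
      (mul_le_mul_of_nonneg_left (bracket_rpow_mono x hsr) hC)⟩, g', hg, h'.mono (by linarith)⟩

theorem bound_add {s : ℝ} {g₁ g₂ : ℝ → ℝ} (h₁ : ∃ C, 0 ≤ C ∧ ∀ x, |g₁ x| ≤ C * bracket x ^ s)
    (h₂ : ∃ C, 0 ≤ C ∧ ∀ x, |g₂ x| ≤ C * bracket x ^ s) :
    ∃ C, 0 ≤ C ∧ ∀ x, |g₁ x + g₂ x| ≤ C * bracket x ^ s := by
  obtain ⟨C₁, hC₁, h₁⟩ := h₁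
  obtain ⟨C₂, hC₂, h₂⟩ := h₂
  refine ⟨C₁ + C₂, by positivity, fun x => ?_⟩
  rw [add_mul]
  exact (abs_add_le _ _).trans (add_le_add (h₁ x) (h₂ x))

theorem add : ∀ {n : ℕ} {s : ℝ} {g₁ g₂ : ℝ → ℝ}, IsSymbol n s g₁ → IsSymbol n s g₂ →
    IsSymbol n s fun x => g₁ x + g₂ x
  | 0, _, _, _, h₁, h₂ => ⟨h₁.1.add h₂.1, bound_add h₁.2 h₂.2⟩
  | _ + 1, _, _, _, h₁, h₂ => by
    obtain ⟨hb₁, g₁', hg₁, h₁'⟩ := h₁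
    obtain ⟨hb₂, g₂', hg₂, h₂'⟩ := h₂
    exact ⟨bound_add hb₁ hb₂, _, fun x => (hg₁ x).add (hg₂ x), h₁'.add h₂'⟩

theorem bound_mul {s r : ℝ} {g₁ g₂ : ℝ → ℝ} (h₁ : ∃ C, 0 ≤ C ∧ ∀ x, |g₁ x| ≤ C * bracket x ^ s)
    (h₂ : ∃ C, 0 ≤ C ∧ ∀ x, |g₂ x| ≤ C * bracket x ^ r) :
    ∃ C, 0 ≤ C ∧ ∀ x, |g₁ x * g₂ x| ≤ C * bracket x ^ (s + r) := by
  obtain ⟨C₁, hC₁, h₁⟩ := h₁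
  obtain ⟨C₂, hC₂, h₂⟩ := h₂
  refine ⟨C₁ * C₂, by positivity, fun x => ?_⟩
  have := bracket_rpow_pos x s
  rw [abs_mul, Real.rpow_add (bracket_pos x), mul_mul_mul_comm]
  exact mul_le_mul (h₁ x) (h₂ x) (abs_nonneg _) (by positivity)

theorem mul : ∀ {n : ℕ} {s r : ℝ} {g₁ g₂ : ℝ → ℝ}, IsSymbol n s g₁ → IsSymbol n r g₂ →
    IsSymbol n (s + r) fun x => g₁ x * g₂ x
  | 0, _, _, _, _, h₁, h₂ => ⟨h₁.1.mul h₂.1, bound_mul h₁.2 h₂.2⟩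
  | _ + 1, s, r, _, _, h₁, h₂ => by
    have l₁ := h₁.lower
    have l₂ := h₂.lower
    obtain ⟨hb₁, g₁', hg₁, h₁'⟩ := h₁
    obtain ⟨hb₂, g₂', hg₂, h₂'⟩ := h₂
    refine ⟨bound_mul hb₁ hb₂, _, fun x => (hg₁ x).mul (hg₂ x), ?_⟩
    have e₁ := h₁'.mul l₂
    have e₂ := l₁.mul h₂'
    rw [show s - 1 / 2 + r = s + r - 1 / 2 by ring] at e₁
    rw [show s + (r - 1 / 2) = s + r - 1 / 2 by ring] at e₂
    exact e₁.add e₂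

theorem zero : ∀ (n : ℕ) (s : ℝ), IsSymbol n s fun _ => 0
  | 0, s => ⟨continuous_const, 0, le_rfl, fun x => by simp⟩
  | n + 1, s => ⟨⟨0, le_rfl, fun x => by simp⟩, _, fun x => hasDerivAt_const x 0, zero n _⟩

theorem const (n : ℕ) (c : ℝ) : IsSymbol n 0 fun _ => c := by
  have hb : ∃ C, 0 ≤ C ∧ ∀ x : ℝ, |c| ≤ C * bracket x ^ (0 : ℝ) :=
    ⟨|c|, abs_nonneg c, fun x => by simp⟩
  cases n with
  | zero => exact ⟨continuous_const, hb⟩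
  | succ n => exact ⟨hb, _, fun x => hasDerivAt_const x c, zero n _⟩

theorem linear (n : ℕ) (c : ℝ) : IsSymbol n (1 / 2) fun x => c * x := by
  have hb : ∃ C, 0 ≤ C ∧ ∀ x : ℝ, |c * x| ≤ C * bracket x ^ (1 / 2 : ℝ) := by
    refine ⟨|c|, abs_nonneg c, fun x => ?_⟩
    rw [abs_mul]
    exact mul_le_mul_of_nonneg_left (abs_le_bracket_rpow_half x) (abs_nonneg c)
  cases n with
  | zero => exact ⟨by fun_prop, hb⟩
  | succ n =>
    refine ⟨hb, fun _ => c, fun x => by simpa using (hasDerivAt_id x).const_mul c, ?_⟩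
    rw [sub_self]
    exact const n c

theorem pow {n : ℕ} {s : ℝ} {g : ℝ → ℝ} (h : IsSymbol n s g) :
    ∀ j : ℕ, IsSymbol n (j * s) fun x => g x ^ j
  | 0 => by simpa using const n 1
  | j + 1 => by
    have := (pow h j).mul h
    rw [show (j : ℝ) * s + s = (j + 1 : ℕ) * s by push_cast; ring] at this
    simpa only [pow_succ] using this

end IsSymbol

theorem exists_disp_rpow_le {m : ℝ} (hm : 0 < m) (s : ℝ) :
    ∃ C, 0 ≤ C ∧ ∀ x, |disp m x ^ s| ≤ C * bracket x ^ s := by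
  set a := min (4 * m ^ 2) ((2 * Real.pi) ^ 2) with ha
  set b := max (4 * m ^ 2) ((2 * Real.pi) ^ 2) with hb
  have ha0 : 0 < a := lt_min (by positivity) (by positivity)
  have hb0 : 0 < b := lt_max_of_lt_left (by positivity)
  have h1 : ∀ x, a * bracket x ≤ disp m x := fun x => by
    have i1 : a ≤ 4 * m ^ 2 := min_le_left _ _
    have i2 : a ≤ (2 * Real.pi) ^ 2 := min_le_right _ _
    rw [disp, bracket, mul_pow _ x]
    nlinarith [sq_nonneg x]
  have h2 : ∀ x, disp m x ≤ b * bracket x := fun x => by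
    have i1 : 4 * m ^ 2 ≤ b := le_max_left _ _
    have i2 : (2 * Real.pi) ^ 2 ≤ b := le_max_right _ _
    rw [disp, bracket, mul_pow _ x]
    nlinarith [sq_nonneg x]
  refine ⟨max (a ^ s) (b ^ s), by positivity, fun x => ?_⟩
  have hx := bracket_pos x
  rw [abs_of_nonneg (Real.rpow_nonneg (disp_pos hm x).le _)]
  rcases le_total 0 s with hs | hs
  · calc disp m x ^ s ≤ (b * bracket x) ^ s := Real.rpow_le_rpow (disp_pos hm x).le (h2 x) hs
      _ = b ^ s * bracket x ^ s := Real.mul_rpow hb0.le hx.le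
      _ ≤ _ := mul_le_mul_of_nonneg_right (le_max_right _ _) (bracket_rpow_pos x s).le
  · calc disp m x ^ s ≤ (a * bracket x) ^ s :=
          Real.rpow_le_rpow_of_nonpos (by positivity) (h1 x) hs
      _ = a ^ s * bracket x ^ s := Real.mul_rpow ha0.le hx.le
      _ ≤ _ := mul_le_mul_of_nonneg_right (le_max_left _ _) (bracket_rpow_pos x s).le

/-- The derivative of `disp`^s is a multiple of x · `disp`^{s-1}, of exponent 1/2 + (s - 1) = s -
1/2, so the induction closes when s ranges over all reals. -/
theorem isSymbol_disp_rpow {m : ℝ} (hm : 0 < m) :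
    ∀ (n : ℕ) (s : ℝ), IsSymbol n s fun x => disp m x ^ s
  | 0, s => ⟨continuous_disp_rpow hm s, exists_disp_rpow_le hm s⟩
  | n + 1, s => by
    refine ⟨exists_disp_rpow_le hm s,
      fun x => (2 * (2 * Real.pi) ^ 2 * s) * x * disp m x ^ (s - 1), fun x => ?_, ?_⟩
    · have h1 : HasDerivAt (disp m) (2 * (2 * Real.pi) ^ 2 * x) x := by
        have := ((((hasDerivAt_id x).const_mul (2 * Real.pi)).pow 2).const_add (4 * m ^ 2))
        refine this.congr_deriv ?_
        simp only [id]
        push_cast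
        ring
      refine (h1.rpow_const (p := s) (Or.inl (disp_pos hm x).ne')).congr_deriv ?_
      ring
    · have h := (IsSymbol.linear n (2 * (2 * Real.pi) ^ 2 * s)).mul (isSymbol_disp_rpow hm n (s - 1))
      rwa [show 1 / 2 + (s - 1) = s - 1 / 2 by ring] at h

end Symbols

/-! ### Families depending on a frequency, and decay by integration by parts -/

section Families

/-- A family `G κ` of functions, with `n` derivatives bounded by a multiple of
`⟨κ⟩^{2b} ⟨ζ⟩^{2M}`. -/
def IsFamily (b M : ℝ) : ℕ → (ℝ → ℝ → ℂ) → Prop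
  | 0, G => (∀ κ, Continuous (G κ)) ∧
      ∃ C, 0 ≤ C ∧ ∀ κ ζ, ‖G κ ζ‖ ≤ C * (bracket κ ^ b * bracket ζ ^ M)
  | n + 1, G => (∃ C, 0 ≤ C ∧ ∀ κ ζ, ‖G κ ζ‖ ≤ C * (bracket κ ^ b * bracket ζ ^ M)) ∧
      ∃ G' : ℝ → ℝ → ℂ, (∀ κ ζ, HasDerivAt (G κ) (G' κ ζ) ζ) ∧ IsFamily b M n G'

namespace IsFamily

theorem bound {b M : ℝ} : ∀ {n : ℕ} {G : ℝ → ℝ → ℂ}, IsFamily b M n G →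
    ∃ C, 0 ≤ C ∧ ∀ κ ζ, ‖G κ ζ‖ ≤ C * (bracket κ ^ b * bracket ζ ^ M)
  | 0, _, h => h.2
  | _ + 1, _, h => h.1

theorem continuous {b M : ℝ} : ∀ {n : ℕ} {G : ℝ → ℝ → ℂ}, IsFamily b M n G → ∀ κ, Continuous (G κ)
  | 0, _, h => h.1
  | _ + 1, _, h => by
    obtain ⟨G', hG, -⟩ := h.2
    exact fun κ => continuous_iff_continuousAt.2 fun x => (hG κ x).continuousAt

theorem lower {b M : ℝ} : ∀ {n : ℕ} {G : ℝ → ℝ → ℂ}, IsFamily b M (n + 1) G → IsFamily b M n G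
  | 0, _, h => ⟨h.continuous, h.1⟩
  | _ + 1, _, h => by
    obtain ⟨hb, G', hG, h'⟩ := h
    exact ⟨hb, G', hG, h'.lower⟩

theorem bound_mono {b M N : ℝ} (hMN : M ≤ N) {G : ℝ → ℝ → ℂ}
    (h : ∃ C, 0 ≤ C ∧ ∀ κ ζ, ‖G κ ζ‖ ≤ C * (bracket κ ^ b * bracket ζ ^ M)) :
    ∃ C, 0 ≤ C ∧ ∀ κ ζ, ‖G κ ζ‖ ≤ C * (bracket κ ^ b * bracket ζ ^ N) := by
  obtain ⟨C, hC, h⟩ := h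
  refine ⟨C, hC, fun κ ζ => (h κ ζ).trans (mul_le_mul_of_nonneg_left ?_ hC)⟩
  exact mul_le_mul_of_nonneg_left (bracket_rpow_mono ζ hMN) (bracket_rpow_pos κ b).le

theorem mono {b M N : ℝ} (hMN : M ≤ N) :
    ∀ {n : ℕ} {G : ℝ → ℝ → ℂ}, IsFamily b M n G → IsFamily b N n G
  | 0, _, h => ⟨h.1, bound_mono hMN h.2⟩
  | _ + 1, _, h => by
    obtain ⟨hb, G', hG, h'⟩ := h
    exact ⟨bound_mono hMN hb, G', hG, h'.mono hMN⟩

theorem bound_add {b M : ℝ} {G₁ G₂ : ℝ → ℝ → ℂ}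
    (h₁ : ∃ C, 0 ≤ C ∧ ∀ κ ζ, ‖G₁ κ ζ‖ ≤ C * (bracket κ ^ b * bracket ζ ^ M))
    (h₂ : ∃ C, 0 ≤ C ∧ ∀ κ ζ, ‖G₂ κ ζ‖ ≤ C * (bracket κ ^ b * bracket ζ ^ M)) :
    ∃ C, 0 ≤ C ∧ ∀ κ ζ, ‖G₁ κ ζ + G₂ κ ζ‖ ≤ C * (bracket κ ^ b * bracket ζ ^ M) := by
  obtain ⟨C₁, hC₁, h₁⟩ := h₁
  obtain ⟨C₂, hC₂, h₂⟩ := h₂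
  refine ⟨C₁ + C₂, by positivity, fun κ ζ => ?_⟩
  rw [add_mul]
  exact (norm_add_le _ _).trans (add_le_add (h₁ κ ζ) (h₂ κ ζ))

theorem add {b M : ℝ} : ∀ {n : ℕ} {G₁ G₂ : ℝ → ℝ → ℂ}, IsFamily b M n G₁ → IsFamily b M n G₂ →
    IsFamily b M n fun κ ζ => G₁ κ ζ + G₂ κ ζ
  | 0, _, _, h₁, h₂ => ⟨fun κ => (h₁.1 κ).add (h₂.1 κ), bound_add h₁.2 h₂.2⟩
  | _ + 1, _, _, h₁, h₂ => by
    obtain ⟨hb₁, G₁', hG₁, h₁'⟩ := h₁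
    obtain ⟨hb₂, G₂', hG₂, h₂'⟩ := h₂
    exact ⟨bound_add hb₁ hb₂, _, fun κ ζ => (hG₁ κ ζ).add (hG₂ κ ζ), h₁'.add h₂'⟩

theorem bound_mul {b c M N : ℝ} {G₁ G₂ : ℝ → ℝ → ℂ}
    (h₁ : ∃ C, 0 ≤ C ∧ ∀ κ ζ, ‖G₁ κ ζ‖ ≤ C * (bracket κ ^ b * bracket ζ ^ M))
    (h₂ : ∃ C, 0 ≤ C ∧ ∀ κ ζ, ‖G₂ κ ζ‖ ≤ C * (bracket κ ^ c * bracket ζ ^ N)) :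
    ∃ C, 0 ≤ C ∧
      ∀ κ ζ, ‖G₁ κ ζ * G₂ κ ζ‖ ≤ C * (bracket κ ^ (b + c) * bracket ζ ^ (M + N)) := by
  obtain ⟨C₁, hC₁, h₁⟩ := h₁
  obtain ⟨C₂, hC₂, h₂⟩ := h₂
  refine ⟨C₁ * C₂, by positivity, fun κ ζ => ?_⟩
  have := bracket_rpow_pos κ b
  have := bracket_rpow_pos ζ M
  rw [norm_mul, Real.rpow_add (bracket_pos κ), Real.rpow_add (bracket_pos ζ)]
  calc ‖G₁ κ ζ‖ * ‖G₂ κ ζ‖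
      ≤ (C₁ * (bracket κ ^ b * bracket ζ ^ M)) * (C₂ * (bracket κ ^ c * bracket ζ ^ N)) :=
        mul_le_mul (h₁ κ ζ) (h₂ κ ζ) (norm_nonneg _) (by positivity)
    _ = _ := by ring

theorem mul {b c M N : ℝ} : ∀ {n : ℕ} {G₁ G₂ : ℝ → ℝ → ℂ}, IsFamily b M n G₁ →
    IsFamily c N n G₂ → IsFamily (b + c) (M + N) n fun κ ζ => G₁ κ ζ * G₂ κ ζ
  | 0, _, _, h₁, h₂ => ⟨fun κ => (h₁.1 κ).mul (h₂.1 κ), bound_mul h₁.2 h₂.2⟩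
  | _ + 1, _, _, h₁, h₂ => by
    have l₁ := h₁.lower
    have l₂ := h₂.lower
    obtain ⟨hb₁, G₁', hG₁, h₁'⟩ := h₁
    obtain ⟨hb₂, G₂', hG₂, h₂'⟩ := h₂
    exact ⟨bound_mul hb₁ hb₂, _, fun κ ζ => (hG₁ κ ζ).mul (hG₂ κ ζ),
      (h₁'.mul l₂).add (l₁.mul h₂')⟩

theorem neg {b M : ℝ} : ∀ {n : ℕ} {G : ℝ → ℝ → ℂ}, IsFamily b M n G →
    IsFamily b M n fun κ ζ => -G κ ζ
  | 0, _, h => ⟨fun κ => (h.1 κ).neg, by simpa only [norm_neg] using h.2⟩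
  | _ + 1, _, h => by
    obtain ⟨hb, G', hG, h'⟩ := h
    exact ⟨by simpa only [norm_neg] using hb, _, fun κ ζ => (hG κ ζ).neg, h'.neg⟩

end IsFamily

/-- Peetre's inequality separates κ from ζ at the cost of a power |s| of the bracket of ζ. The gain
of order under differentiation is discarded, since only a fixed power of the bracket of κ is wanted.
-/
theorem IsSymbol.isFamily_add : ∀ {n : ℕ} {s : ℝ} {g : ℝ → ℝ}, IsSymbol n s g →
    IsFamily s |s| n fun κ ζ => (g (κ + ζ) : ℂ) := by
  have hb : ∀ {s : ℝ} {g : ℝ → ℝ}, (∃ C, 0 ≤ C ∧ ∀ x, |g x| ≤ C * bracket x ^ s) →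
      ∃ C, 0 ≤ C ∧ ∀ κ ζ, ‖(g (κ + ζ) : ℂ)‖ ≤ C * (bracket κ ^ s * bracket ζ ^ |s|) := by
    rintro s g ⟨C, hC, h⟩
    refine ⟨C * 2 ^ |s|, by positivity, fun κ ζ => ?_⟩
    rw [Complex.norm_real, mul_assoc]
    exact (h _).trans (mul_le_mul_of_nonneg_left (bracket_add_rpow_le κ ζ s) hC)
  intro n
  induction n with
  | zero =>
    intro s g h
    have hc := h.1
    exact ⟨fun κ => by fun_prop, hb h.2⟩
  | succ n ih =>
    intro s g h
    obtain ⟨hg, g', hd, h'⟩ := h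
    refine ⟨hb hg, fun κ ζ => (g' (κ + ζ) : ℂ), fun κ ζ => ?_, ih (h'.mono (by linarith))⟩
    exact ((hd (κ + ζ)).comp_const_add κ ζ).ofReal_comp

/-- The mean value inequality between κ and κ + ζ trades a factor |ζ| for one order of decay in κ.
Powers of ζ will be absorbed by a Schwartz function; the gain in κ is what makes the case j = 3
converge. -/
theorem IsSymbol.exists_abs_sub_le {n : ℕ} {s : ℝ} {g : ℝ → ℝ} (h : IsSymbol (n + 1) s g) :
    ∃ C, 0 ≤ C ∧ ∀ κ ζ, ‖((g κ : ℂ) - g (κ + ζ))‖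
      ≤ C * (bracket κ ^ (s - 1 / 2) * bracket ζ ^ (|s - 1 / 2| + 1 / 2)) := by
  obtain ⟨-, g', hd, h'⟩ := h
  obtain ⟨C, hC, hb⟩ := h'.bound
  refine ⟨C * 2 ^ |s - 1 / 2|, by positivity, fun κ ζ => ?_⟩
  have hz := bracket_rpow_pos ζ |s - 1 / 2|
  have hk := bracket_rpow_pos κ (s - 1 / 2)
  have hv : ∀ x ∈ segment ℝ κ (κ + ζ),
      ‖g' x‖ ≤ C * 2 ^ |s - 1 / 2| * (bracket κ ^ (s - 1 / 2) * bracket ζ ^ |s - 1 / 2|) := by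
    intro x hx
    rw [segment_eq_image'] at hx
    obtain ⟨t, ⟨ht0, ht1⟩, rfl⟩ := hx
    simp only [add_sub_cancel_left, smul_eq_mul]
    rw [Real.norm_eq_abs, mul_assoc]
    refine (hb _).trans (mul_le_mul_of_nonneg_left ?_ hC)
    refine (bracket_add_rpow_le κ (t * ζ) _).trans ?_
    have htz : bracket (t * ζ) ≤ bracket ζ := by
      have : (t * ζ) ^ 2 ≤ ζ ^ 2 := by
        rw [mul_pow]
        exact mul_le_of_le_one_left (sq_nonneg ζ) (pow_le_one₀ ht0 ht1)
      unfold bracket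
      linarith
    have := (bracket_pos (t * ζ)).le
    gcongr
  have := (convex_segment κ (κ + ζ)).norm_image_sub_le_of_norm_hasDerivWithin_le
    (fun x _ => (hd x).hasDerivWithinAt) hv (right_mem_segment ℝ κ (κ + ζ))
    (left_mem_segment ℝ κ (κ + ζ))
  rw [← Complex.ofReal_sub, Complex.norm_real]
  refine this.trans ?_
  rw [sub_add_cancel_left, norm_neg, Real.rpow_add (bracket_pos ζ), mul_assoc, mul_assoc,
    mul_assoc, mul_assoc]
  gcongr
  exact abs_le_bracket_rpow_half ζ

theorem IsSymbol.isFamily_sub {n : ℕ} {s : ℝ} {g : ℝ → ℝ} (h : IsSymbol (n + 1) s g) :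
    IsFamily (s - 1 / 2) (|s - 1 / 2| + 1 / 2) n fun κ ζ => (g κ : ℂ) - g (κ + ζ) := by
  have hc := h.continuous
  cases n with
  | zero => exact ⟨fun κ => by fun_prop, h.exists_abs_sub_le⟩
  | succ n =>
    refine ⟨h.exists_abs_sub_le, ?_⟩
    obtain ⟨-, g', hd, h'⟩ := h
    -- Differentiating in ζ removes the term g κ, and g' already has exponent s - 1/2, so the gain
    -- persists for derivatives.
    refine ⟨fun κ ζ => -(g' (κ + ζ) : ℂ), fun κ ζ => ?_,
      (h'.lower.isFamily_add.mono (by linarith)).neg⟩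
    exact ((hd (κ + ζ)).comp_const_add κ ζ).ofReal_comp.const_sub _

theorem exists_norm_schwartz_le (f : 𝓢(ℝ, ℂ)) (M : ℝ) :
    ∃ C, 0 ≤ C ∧ ∀ x, ‖f x‖ ≤ C * bracket x ^ M := by
  obtain ⟨N, hN⟩ := exists_nat_ge (-M)
  obtain ⟨C, hC⟩ : ∃ C, ∀ x, (1 + ‖x‖) ^ (2 * N) * ‖f x‖ ≤ C := by
    have h := SchwartzMap.one_add_le_sup_seminorm_apply (𝕜 := ℝ) (m := (2 * N, 0)) (k := 2 * N)
      (n := 0) le_rfl le_rfl f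
    simp only [norm_iteratedFDeriv_zero] at h
    exact ⟨_, h⟩
  have hC0 : 0 ≤ C := le_trans (by positivity) (hC 0)
  refine ⟨C, hC0, fun x => ?_⟩
  have hx := bracket_pos x
  have h1 : bracket x ^ N ≤ (1 + ‖x‖) ^ (2 * N) := by
    rw [pow_mul]
    refine pow_le_pow_left₀ hx.le ?_ N
    rw [bracket, Real.norm_eq_abs, ← sq_abs]
    nlinarith [abs_nonneg x]
  have h2 : bracket x ^ N * ‖f x‖ ≤ C :=
    (mul_le_mul_of_nonneg_right h1 (norm_nonneg _)).trans (hC x)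
  calc ‖f x‖ = bracket x ^ N * ‖f x‖ * bracket x ^ (-(N : ℝ)) := by
        rw [Real.rpow_neg hx.le, Real.rpow_natCast]
        field_simp
    _ ≤ C * bracket x ^ M :=
        mul_le_mul h2 (bracket_rpow_mono x (by linarith)) (bracket_rpow_pos _ _).le hC0

theorem isFamily_schwartz (M : ℝ) : ∀ (n : ℕ) (f : 𝓢(ℝ, ℂ)), IsFamily 0 M n fun _ ζ => f ζ := by
  have hb : ∀ f : 𝓢(ℝ, ℂ), ∃ C, 0 ≤ C ∧
      ∀ κ ζ, ‖f ζ‖ ≤ C * (bracket κ ^ (0 : ℝ) * bracket ζ ^ M) := by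
    intro f
    obtain ⟨C, hC, h⟩ := exists_norm_schwartz_le f M
    exact ⟨C, hC, fun κ ζ => by simpa using h ζ⟩
  intro n
  induction n with
  | zero => exact fun f => ⟨fun _ => f.continuous, hb f⟩
  | succ n ih =>
    exact fun f => ⟨hb f, _, fun κ ζ => f.hasDerivAt ζ, ih (SchwartzMap.derivCLM ℂ ℂ f)⟩

theorem IsFamily.integrable {b M : ℝ} (hM : M < -1 / 2) {n : ℕ} {G : ℝ → ℝ → ℂ}
    (h : IsFamily b M n G) (κ : ℝ) : Integrable (G κ) := by
  obtain ⟨C, hC, hb⟩ := h.bound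
  refine ((integrable_bracket_rpow hM).const_mul (C * bracket κ ^ b)).mono'
    (h.continuous κ).aestronglyMeasurable (Filter.Eventually.of_forall fun ζ => ?_)
  rw [mul_assoc]
  exact hb κ ζ

open FourierTransform

/-- Repeated integration by parts. -/
theorem IsFamily.exists_fourier_le {b M : ℝ} (hM : M < -1 / 2) :
    ∀ {n : ℕ} {G : ℝ → ℝ → ℂ}, IsFamily b M n G →
      ∃ C, 0 ≤ C ∧ ∀ κ x, |x| ^ n * ‖𝓕 (G κ) x‖ ≤ C * bracket κ ^ b
  | 0, G, h => by
    obtain ⟨C, hC, hb⟩ := h.bound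
    have hi := integrable_bracket_rpow hM
    have hI : 0 ≤ ∫ ζ, bracket ζ ^ M := integral_nonneg fun ζ => (bracket_rpow_pos ζ M).le
    refine ⟨C * ∫ ζ, bracket ζ ^ M, by positivity, fun κ x => ?_⟩
    rw [pow_zero, one_mul]
    calc ‖𝓕 (G κ) x‖ ≤ ∫ ζ, ‖G κ ζ‖ := VectorFourier.norm_fourierIntegral_le_integral_norm _ _ _ _ _
      _ ≤ ∫ ζ, C * bracket κ ^ b * bracket ζ ^ M := by
        refine integral_mono (h.integrable hM κ).norm (hi.const_mul _) fun ζ => ?_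
        simp only
        rw [mul_assoc]
        exact hb κ ζ
      _ = _ := by rw [integral_const_mul]; ring
  | n + 1, G, h => by
    have hint := h.integrable hM
    obtain ⟨-, G', hd, h'⟩ := h
    obtain ⟨C, hC, hb⟩ := h'.exists_fourier_le hM
    refine ⟨C, hC, fun κ x => ?_⟩
    have hG' : deriv (G κ) = G' κ := funext fun ζ => (hd κ ζ).deriv
    have h1 := congrFun (Real.fourier_deriv (hint κ) (fun ζ => (hd κ ζ).differentiableAt)
      (by rw [hG']; exact h'.integrable hM κ)) x
    rw [hG'] at h1
    have h2 : |x| * ‖𝓕 (G κ) x‖ ≤ ‖𝓕 (G' κ) x‖ := by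
      rw [h1, norm_smul]
      have : ‖(2 * Real.pi * Complex.I * x : ℂ)‖ = 2 * Real.pi * |x| := by
        simp [abs_of_pos Real.pi_pos]
      rw [this, mul_assoc]
      have hp : 0 ≤ |x| * ‖𝓕 (G κ) x‖ := by positivity
      have := Real.pi_gt_three
      nlinarith
    calc |x| ^ (n + 1) * ‖𝓕 (G κ) x‖ = |x| ^ n * (|x| * ‖𝓕 (G κ) x‖) := by ring
      _ ≤ |x| ^ n * ‖𝓕 (G' κ) x‖ := by gcongr
      _ ≤ _ := hb κ x

theorem IsFamily.exists_fourierInv_le {b M : ℝ} (hM : M < -1 / 2) {n : ℕ} {G : ℝ → ℝ → ℂ}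
    (h : IsFamily b M n G) : ∃ C, 0 ≤ C ∧ ∀ κ x, |x| ^ n * ‖𝓕⁻ (G κ) x‖ ≤ C * bracket κ ^ b := by
  obtain ⟨C, hC, hb⟩ := h.exists_fourier_le hM
  refine ⟨C, hC, fun κ x => ?_⟩
  have := hb κ (-x)
  rwa [abs_neg, ← Real.fourierInv_eq_fourier_neg] at this

end Families

/-! ### Superpositions of plane waves -/

section Superposition

open FourierTransform

/-- The character `e^{2πi r}`. -/
def wave (r : ℝ) : ℂ := Complex.exp ((2 * Real.pi * r : ℝ) * Complex.I)

theorem norm_wave (r : ℝ) : ‖wave r‖ = 1 := Complex.norm_exp_ofReal_mul_I _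

theorem wave_add (r s : ℝ) : wave (r + s) = wave r * wave s := by
  rw [wave, wave, wave, ← Complex.exp_add]
  congr 1
  push_cast
  ring

@[fun_prop]
theorem continuous_wave : Continuous wave := by unfold wave; fun_prop

theorem fourierInv_eq_integral_wave (g : ℝ → ℂ) (x : ℝ) :
    𝓕⁻ g x = ∫ ζ, g ζ * wave (x * ζ) := by
  rw [Real.fourierInv_eq']
  congr 1
  ext ζ
  rw [smul_eq_mul, mul_comm, wave]
  simp [mul_assoc]

theorem inner_plane (p : Plane) (a b : ℝ) : inner ℝ p !₂[a, b] = p 0 * a + p 1 * b := by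
  rw [PiLp.inner_apply, Fin.sum_univ_two]
  simp [mul_comm]

theorem hasTemperateGrowth_symbol {m : ℝ} (hm : 0 < m) : (symbol m).HasTemperateGrowth := by
  have h : ∀ i : Fin 2,
      (fun ξ : Plane => ((disp m (ξ i) ^ (1 / 4 : ℝ) : ℝ) : ℂ)).HasTemperateGrowth := by
    intro i
    exact (hasTemperateGrowth_ofReal_disp_rpow hm (1 / 4)).comp
      (EuclideanSpace.proj (𝕜 := ℝ) i : Plane →L[ℝ] ℝ).hasTemperateGrowth
  have e : symbol m = fun ξ : Plane => ((disp m (ξ 0) ^ (1 / 4 : ℝ) : ℝ) : ℂ)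
      * ((disp m (ξ 1) ^ (1 / 4 : ℝ) : ℝ) : ℂ) := by
    ext ξ
    rw [symbol, disp, disp]
    push_cast
    rfl
  rw [e]
  exact (h 0).mul (h 1)

theorem fourierInv_pseudoDiff {m : ℝ} (hm : 0 < m) (φ : 𝓢(Plane, ℂ)) (q : Plane) :
    𝓕⁻ (pseudoDiff m φ : Plane → ℂ) q = symbol m q * 𝓕⁻ (φ : Plane → ℂ) q := by
  have hs : symbol m (-q) = symbol m q := by simp [symbol]
  rw [Real.fourierInv_eq_fourier_neg, Real.fourierInv_eq_fourier_neg, ← SchwartzMap.fourier_coe,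
    ← SchwartzMap.fourier_coe, pseudoDiff, SchwartzMap.fourierMultiplierCLM_apply,
    FourierTransform.fourier_fourierInv_eq,
    SchwartzMap.smulLeftCLM_apply_apply (hasTemperateGrowth_symbol hm), smul_eq_mul, hs]

variable {Ω : Type*} [MeasurableSpace Ω] {μ : Measure Ω}

/-- A superposition of plane waves. -/
def superpose (μ : Measure Ω) (ρ : Ω → ℂ) (a b : Ω → ℝ) (x y : ℝ) : ℂ :=
  ∫ w, ρ w * wave (x * a w + y * b w) ∂μ

theorem norm_superpose_le (ρ : Ω → ℂ) (a b : Ω → ℝ) (x y : ℝ) :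
    ‖superpose μ ρ a b x y‖ ≤ ∫ w, ‖ρ w‖ ∂μ := by
  refine (norm_integral_le_integral_norm _).trans_eq ?_
  simp only [norm_mul, norm_wave, mul_one]

theorem integrable_mul_wave {ρ : Ω → ℂ} (hρ : Integrable ρ μ) {a : Ω → ℝ} (ha : Measurable a) :
    Integrable (fun w => ρ w * wave (a w)) μ :=
  hρ.mul_bdd (c := 1) (continuous_wave.measurable.comp ha).aestronglyMeasurable
    (Filter.Eventually.of_forall fun _ => (norm_wave _).le)

theorem continuous_superpose {ρ : Ω → ℂ} (hρ : Integrable ρ μ) {a b : Ω → ℝ} (ha : Measurable a)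
    (hb : Measurable b) : Continuous fun p : ℝ × ℝ => superpose μ ρ a b p.1 p.2 := by
  refine continuous_of_dominated (bound := fun w => ‖ρ w‖) (fun p => ?_) (fun p => ?_) hρ.norm ?_
  · exact (integrable_mul_wave hρ (by fun_prop)).aestronglyMeasurable
  · exact Filter.Eventually.of_forall fun w => by rw [norm_mul, norm_wave, mul_one]
  · exact Filter.Eventually.of_forall fun w => by fun_prop

/-- By Fubini, pairing a plane wave with φ evaluates the inverse Fourier transform of φ at the
frequency of the wave. -/
theorem integral_superpose_mul [SFinite μ] {ρ : Ω → ℂ} (hρ : Integrable ρ μ) {a b : Ω → ℝ}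
    (ha : Measurable a) (hb : Measurable b) (φ : 𝓢(Plane, ℂ)) :
    Integrable (fun p : Plane => superpose μ ρ a b (p 0) (p 1) * φ p) ∧
    ∫ p : Plane, superpose μ ρ a b (p 0) (p 1) * φ p
      = ∫ w, ρ w * 𝓕⁻ (φ : Plane → ℂ) !₂[a w, b w] ∂μ := by
  have hc : Continuous fun p : Plane => superpose μ ρ a b (p 0) (p 1) :=
    (continuous_superpose hρ ha hb).comp (by fun_prop : Continuous fun p : Plane => (p 0, p 1))
  refine ⟨φ.integrable.bdd_mul (c := ∫ w, ‖ρ w‖ ∂μ) hc.aestronglyMeasurable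
    (Filter.Eventually.of_forall fun p => norm_superpose_le ρ a b _ _), ?_⟩
  have hprod : Integrable (fun z : Plane × Ω =>
      (φ z.1 * ρ z.2) * wave (z.1 0 * a z.2 + z.1 1 * b z.2)) (volume.prod μ) :=
    integrable_mul_wave (φ.integrable.mul_prod hρ) (by fun_prop)
  calc ∫ p : Plane, superpose μ ρ a b (p 0) (p 1) * φ p
      = ∫ p : Plane, ∫ w, (φ p * ρ w) * wave (p 0 * a w + p 1 * b w) ∂μ := by
        congr 1
        ext p
        rw [superpose, ← integral_mul_const]
        congr 1
        ext w
        ring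
    _ = ∫ w, (∫ p : Plane, (φ p * ρ w) * wave (p 0 * a w + p 1 * b w)) ∂μ :=
        integral_integral_swap hprod
    _ = _ := by
        congr 1
        ext w
        rw [Real.fourierInv_eq', ← integral_const_mul]
        congr 1
        ext p
        rw [inner_plane, smul_eq_mul, ← wave]
        ring

/-- On plane waves the operator multiplies by its symbol, so it multiplies the density.
Integrability is assumed only after multiplication: the symbol is bounded below by a positive
constant, hence ρ itself is integrable. -/
theorem isPseudoDiffOf_superpose [SFinite μ] {m : ℝ} (hm : 0 < m) {ρ : Ω → ℂ}
    (hρm : AEStronglyMeasurable ρ μ) {a b : Ω → ℝ} (ha : Measurable a) (hb : Measurable b)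
    (hρ : Integrable (fun w => ρ w
      * ((disp m (a w) ^ (1 / 4 : ℝ) * disp m (b w) ^ (1 / 4 : ℝ) : ℝ) : ℂ)) μ) :
    IsPseudoDiffOf m (superpose μ (fun w => ρ w
      * ((disp m (a w) ^ (1 / 4 : ℝ) * disp m (b w) ^ (1 / 4 : ℝ) : ℝ) : ℂ)) a b)
      (superpose μ ρ a b) := by
  have hρ0 : Integrable ρ μ := by
    set c := (4 * m ^ 2) ^ (1 / 4 : ℝ) * (4 * m ^ 2) ^ (1 / 4 : ℝ) with hc
    have hc0 : 0 < c := by positivity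
    refine (hρ.norm.const_mul c⁻¹).mono' hρm (Filter.Eventually.of_forall fun w => ?_)
    have h1 : c ≤ disp m (a w) ^ (1 / 4 : ℝ) * disp m (b w) ^ (1 / 4 : ℝ) := by
      have := le_disp m (a w)
      have := le_disp m (b w)
      have := disp_pos hm (a w)
      rw [hc]
      gcongr
    rw [le_inv_mul_iff₀ hc0, norm_mul, Complex.norm_real, Real.norm_of_nonneg (hc0.le.trans h1),
      mul_comm]
    gcongr
  intro φ
  obtain ⟨i1, e1⟩ := integral_superpose_mul hρ ha hb φ
  obtain ⟨i2, e2⟩ := integral_superpose_mul hρ0 ha hb (pseudoDiff m φ)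
  refine ⟨i1, i2, ?_⟩
  rw [e1, e2]
  congr 1
  ext w
  rw [fourierInv_pseudoDiff hm, mul_assoc]
  rfl

/-- A continuous function with `|x|² ‖F x‖` bounded is integrable. -/
theorem integrable_of_sq_mul_le {F : ℝ → ℂ} (hF : Continuous F) {c₀ c₂ : ℝ}
    (h0 : ∀ x, ‖F x‖ ≤ c₀) (h2 : ∀ x, |x| ^ 2 * ‖F x‖ ≤ c₂) : Integrable F := by
  refine (integrable_inv_one_add_sq.const_mul (c₀ + c₂)).mono' hF.aestronglyMeasurable
    (Filter.Eventually.of_forall fun x => ?_)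
  rw [← div_eq_mul_inv, le_div_iff₀ (by positivity)]
  have := h2 x
  rw [sq_abs] at this
  linarith [h0 x]

end Superposition

/-! ### The kernels built from I_j -/

section Kernels

open FourierTransform

variable {m : ℝ}

/-- The Fourier transform of `I_j`. -/
def oscSymbol (m : ℝ) (j : ℕ) (κ : ℝ) : ℝ :=
  2 * Real.pi * ((2 * Real.pi * κ) ^ j * (disp (m / 2) κ ^ (-1 : ℝ) * disp m κ ^ (-3 / 2 : ℝ)))

/-- The substitution k = 2πκ, whose Jacobian is the leading 2π of `oscSymbol`. The mass m/2 appears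
because 4(m/2)² = m². -/
theorem oscInt_eq (hm : 0 < m) (j : ℕ) (z : ℝ) :
    oscInt m j z = ∫ κ, (oscSymbol m j κ : ℂ) * wave (z * κ) := by
  set F : ℝ → ℂ := fun k =>
    ((k ^ j / ((k ^ 2 + m ^ 2) * (k ^ 2 + 4 * m ^ 2) ^ (3 / 2 : ℝ)) : ℝ) : ℂ)
      * Complex.exp (Complex.I * k * z) with hF
  have hpi : 0 < 2 * Real.pi := by positivity
  have h := Measure.integral_comp_mul_left F (2 * Real.pi)
  rw [abs_of_pos (inv_pos.2 hpi)] at h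
  have h1 : oscInt m j z = (2 * Real.pi) • ∫ κ, F (2 * Real.pi * κ) := by
    rw [h, smul_inv_smul₀ hpi.ne']
    rfl
  rw [h1, ← integral_smul]
  congr 1
  ext κ
  have hd : disp (m / 2) κ = (2 * Real.pi * κ) ^ 2 + m ^ 2 := by rw [disp]; ring
  have hd' : disp m κ = (2 * Real.pi * κ) ^ 2 + 4 * m ^ 2 := by rw [disp]; ring
  have hp := disp_pos hm κ
  have he : Complex.exp (Complex.I * ((2 * Real.pi * κ : ℝ) : ℂ) * z) = wave (z * κ) := by
    rw [wave]
    congr 1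
    push_cast
    ring
  simp only [hF]
  rw [he, oscSymbol, ← hd, ← hd', Real.rpow_neg_one, neg_div, Real.rpow_neg hp.le, ← mul_inv,
    ← div_eq_mul_inv, Complex.real_smul, ← mul_assoc, ← Complex.ofReal_mul]

theorem isSymbol_oscSymbol (hm : 0 < m) (j n : ℕ) :
    IsSymbol n ((j : ℝ) / 2 - 5 / 2) (oscSymbol m j) := by
  have h := (IsSymbol.const n (2 * Real.pi)).mul (((IsSymbol.linear n (2 * Real.pi)).pow j).mul
    ((isSymbol_disp_rpow (half_pos hm) n (-1)).mul (isSymbol_disp_rpow hm n (-3 / 2))))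
  rwa [show (0 : ℝ) + (j * (1 / 2) + (-1 + -3 / 2)) = (j : ℝ) / 2 - 5 / 2 by ring] at h

theorem integrable_oscSymbol (hm : 0 < m) {j : ℕ} (hj : j ≤ 3) :
    Integrable fun κ => (oscSymbol m j κ : ℂ) := by
  have hs := isSymbol_oscSymbol hm j 0
  obtain ⟨C, hC, hb⟩ := hs.bound
  have hj' : (j : ℝ) ≤ 3 := by exact_mod_cast hj
  have hc := hs.continuous
  refine ((integrable_bracket_rpow (s := (j : ℝ) / 2 - 5 / 2) (by linarith)).const_mul C).mono'
    (by fun_prop) (Filter.Eventually.of_forall fun κ => ?_)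
  rw [Complex.norm_real]
  exact hb κ

theorem schwartz_eq_integral_wave (f : 𝓢(ℝ, ℂ)) (x : ℝ) :
    f x = ∫ ζ, 𝓕 f ζ * wave (x * ζ) := by
  rw [← fourierInv_eq_integral_wave, ← SchwartzMap.fourierInv_coe,
    FourierTransform.fourierInv_fourier_eq]

theorem disp_neg (m κ : ℝ) : disp m (-κ) = disp m κ := by simp [disp]

/-- The family `f̂(ζ) λ(κ + ζ)`. -/
def shiftFamily (m : ℝ) (f : 𝓢(ℝ, ℂ)) (κ ζ : ℝ) : ℂ :=
  𝓕 f ζ * ((disp m (κ + ζ) ^ (1 / 4 : ℝ) : ℝ) : ℂ)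

theorem isFamily_shiftFamily (hm : 0 < m) (f : 𝓢(ℝ, ℂ)) (n : ℕ) :
    IsFamily (1 / 4) (-1) n (shiftFamily m f) := by
  -- The decay of the Schwartz factor is chosen to pay Peetre's loss |1/4| and leave the integrable
  -- exponent -1 in ζ.
  have h := (isFamily_schwartz (-1 - |1 / 4|) n (𝓕 f)).mul (isSymbol_disp_rpow hm n (1 / 4)).isFamily_add
  rwa [zero_add, sub_add_cancel] at h

theorem integrable_bracket_neg_one : Integrable fun κ => bracket κ ^ (-1 : ℝ) :=
  integrable_bracket_rpow (by norm_num)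

theorem pow_mul_norm_integral_le {H : ℝ → ℝ → ℂ} {n : ℕ} {C x : ℝ}
    (h : ∀ κ, |x| ^ n * ‖H κ x‖ ≤ C * bracket κ ^ (-1 : ℝ)) :
    |x| ^ n * ‖∫ κ, H κ x‖ ≤ C * ∫ κ, bracket κ ^ (-1 : ℝ) := by
  have e : |x| ^ n * ‖∫ κ, H κ x‖ = ‖∫ κ, ((|x| ^ n : ℝ) : ℂ) * H κ x‖ := by
    rw [integral_const_mul, norm_mul, Complex.norm_real, Real.norm_of_nonneg (by positivity)]
  rw [e, ← integral_const_mul]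
  refine norm_integral_le_of_norm_le (integrable_bracket_neg_one.const_mul C)
    (Filter.Eventually.of_forall fun κ => ?_)
  rw [norm_mul, Complex.norm_real, Real.norm_of_nonneg (by positivity)]
  exact h κ

/-! ### The kernel with two Schwartz factors, j ≤ 2 -/

section Product

/-- The density of `f(x) I_j(x - y) g(y)` with respect to plane waves. -/
def prodDensity (m : ℝ) (j : ℕ) (f g : 𝓢(ℝ, ℂ)) (w : ℝ × ℝ × ℝ) : ℂ :=
  (oscSymbol m j w.1 : ℂ) * (𝓕 f w.2.1 * 𝓕 g w.2.2)

theorem continuous_prodDensity (hm : 0 < m) (j : ℕ) (f g : 𝓢(ℝ, ℂ)) :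
    Continuous (prodDensity m j f g) := by
  have hc := (isSymbol_oscSymbol hm j 0).continuous
  have h1 := (𝓕 f : 𝓢(ℝ, ℂ)).continuous
  have h2 := (𝓕 g : 𝓢(ℝ, ℂ)).continuous
  unfold prodDensity
  fun_prop

theorem superpose_prodDensity (hm : 0 < m) (j : ℕ) (f g : 𝓢(ℝ, ℂ)) (x y : ℝ) :
    superpose volume (prodDensity m j f g) (fun w => w.1 + w.2.1) (fun w => -w.1 + w.2.2) x y
      = f x * oscInt m j (x - y) * g y := by
  rw [oscInt_eq hm, schwartz_eq_integral_wave f x, schwartz_eq_integral_wave g y, mul_right_comm,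
    ← integral_prod_mul, mul_comm, ← integral_prod_mul]
  refine integral_congr_ae (Filter.Eventually.of_forall fun w => ?_)
  simp only [prodDensity]
  rw [show x * (w.1 + w.2.1) + y * (-w.1 + w.2.2) = (x - y) * w.1 + (x * w.2.1 + y * w.2.2) by ring,
    wave_add, wave_add]
  ring

/-- The density of the image of `f(x) I_j(x - y) g(y)`. -/
def prodDensity' (m : ℝ) (j : ℕ) (f g : 𝓢(ℝ, ℂ)) (w : ℝ × ℝ × ℝ) : ℂ :=
  prodDensity m j f g w * ((disp m (w.1 + w.2.1) ^ (1 / 4 : ℝ)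
    * disp m (-w.1 + w.2.2) ^ (1 / 4 : ℝ) : ℝ) : ℂ)

theorem prodDensity'_eq (m : ℝ) (j : ℕ) (f g : 𝓢(ℝ, ℂ)) (w : ℝ × ℝ × ℝ) :
    prodDensity' m j f g w = (oscSymbol m j w.1 : ℂ)
      * (shiftFamily m f w.1 w.2.1 * shiftFamily m g (-w.1) w.2.2) := by
  simp only [prodDensity', prodDensity, shiftFamily]
  push_cast
  ring

/-- The condition j ≤ 2 enters here: the exponent is at most -3/2, and the two quarter powers raise
it to -1, still integrable. -/
theorem exists_oscSymbol_mul_le (hm : 0 < m) {j : ℕ} (hj : j ≤ 2) {C₁ C₂ : ℝ} (hC₁ : 0 ≤ C₁)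
    (hC₂ : 0 ≤ C₂) : ∃ C, 0 ≤ C ∧ ∀ κ, |oscSymbol m j κ|
      * ((C₁ * bracket κ ^ (1 / 4 : ℝ)) * (C₂ * bracket κ ^ (1 / 4 : ℝ)))
        ≤ C * bracket κ ^ (-1 : ℝ) := by
  have hj' : (j : ℝ) ≤ 2 := by exact_mod_cast hj
  obtain ⟨C, hC, hb⟩ := ((isSymbol_oscSymbol hm j 0).mono (r := -3 / 2) (by linarith)).bound
  refine ⟨C * (C₁ * C₂), by positivity, fun κ => ?_⟩
  have hk := bracket_rpow_pos κ (1 / 4)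
  calc _ ≤ (C * bracket κ ^ (-3 / 2 : ℝ))
        * ((C₁ * bracket κ ^ (1 / 4 : ℝ)) * (C₂ * bracket κ ^ (1 / 4 : ℝ))) := by
        gcongr; exact hb κ
    _ = C * (C₁ * C₂)
        * (bracket κ ^ (-3 / 2 : ℝ) * (bracket κ ^ (1 / 4 : ℝ) * bracket κ ^ (1 / 4 : ℝ))) := by
        ring
    _ = _ := by
        rw [← Real.rpow_add (bracket_pos κ), ← Real.rpow_add (bracket_pos κ)]
        norm_num

theorem integrable_prodDensity' (hm : 0 < m) {j : ℕ} (hj : j ≤ 2) (f g : 𝓢(ℝ, ℂ)) :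
    Integrable (prodDensity' m j f g) := by
  obtain ⟨C₁, hC₁, h₁⟩ := (isFamily_shiftFamily hm f 0).bound
  obtain ⟨C₂, hC₂, h₂⟩ := (isFamily_shiftFamily hm g 0).bound
  obtain ⟨C, hC, h⟩ := exists_oscSymbol_mul_le hm hj hC₁ hC₂
  have hi := integrable_bracket_neg_one
  have hcd := continuous_disp_rpow hm (1 / 4)
  have hcp := continuous_prodDensity hm j f g
  refine ((hi.const_mul C).mul_prod (hi.mul_prod hi)).mono' (Continuous.aestronglyMeasurable ?_)
    (Filter.Eventually.of_forall fun w => ?_)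
  · unfold prodDensity'
    have c1 : Continuous fun w : ℝ × ℝ × ℝ => disp m (w.1 + w.2.1) ^ (1 / 4 : ℝ) :=
      hcd.comp (by fun_prop)
    have c2 : Continuous fun w : ℝ × ℝ × ℝ => disp m (-w.1 + w.2.2) ^ (1 / 4 : ℝ) :=
      hcd.comp (by fun_prop)
    fun_prop
  · have hx := bracket_rpow_pos w.2.1 (-1)
    have hy := bracket_rpow_pos w.2.2 (-1)
    have hk := bracket_rpow_pos w.1 (1 / 4)
    have k₂ := h₂ (-w.1) w.2.2
    rw [bracket_neg] at k₂
    rw [prodDensity'_eq, norm_mul, norm_mul, Complex.norm_real, Real.norm_eq_abs]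
    calc _ ≤ |oscSymbol m j w.1| * ((C₁ * (bracket w.1 ^ (1 / 4 : ℝ) * bracket w.2.1 ^ (-1 : ℝ)))
          * (C₂ * (bracket w.1 ^ (1 / 4 : ℝ) * bracket w.2.2 ^ (-1 : ℝ)))) := by
          gcongr
          exact h₁ _ _
      _ = |oscSymbol m j w.1| * ((C₁ * bracket w.1 ^ (1 / 4 : ℝ)) * (C₂ * bracket w.1 ^ (1 / 4 : ℝ)))
          * (bracket w.2.1 ^ (-1 : ℝ) * bracket w.2.2 ^ (-1 : ℝ)) := by ring
      _ ≤ _ := mul_le_mul_of_nonneg_right (h _) (by positivity)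

/-- On the diagonal the frequencies κ and -κ cancel in the phase. All dependence on x then sits in
inverse Fourier transforms whose decay is controlled for each κ. -/
theorem superpose_prodDensity'_diag (hm : 0 < m) {j : ℕ} (hj : j ≤ 2) (f g : 𝓢(ℝ, ℂ)) (x : ℝ) :
    superpose volume (prodDensity' m j f g) (fun w => w.1 + w.2.1) (fun w => -w.1 + w.2.2) x x
      = ∫ κ, (oscSymbol m j κ : ℂ)
        * (𝓕⁻ (shiftFamily m f κ) x * 𝓕⁻ (shiftFamily m g (-κ)) x) := by
  have hi : Integrable (fun w : ℝ × ℝ × ℝ => prodDensity' m j f g w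
      * wave (x * (w.1 + w.2.1) + x * (-w.1 + w.2.2))) :=
    integrable_mul_wave (integrable_prodDensity' hm hj f g) (by fun_prop)
  rw [superpose, Measure.volume_eq_prod, integral_prod _ hi]
  congr 1
  ext κ
  rw [fourierInv_eq_integral_wave, fourierInv_eq_integral_wave, ← integral_prod_mul,
    ← integral_const_mul]
  refine integral_congr_ae (Filter.Eventually.of_forall fun w => ?_)
  simp only [prodDensity'_eq]
  rw [show x * (κ + w.1) + x * (-κ + w.2) = x * w.1 + x * w.2 by ring, wave_add]
  ring

theorem exists_kernel_prod (hm : 0 < m) (f g : 𝓢(ℝ, ℂ)) {j : ℕ} (hj : j ≤ 2) :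
    ∃ Γ : ℝ → ℝ → ℂ,
      IsPseudoDiffOf m Γ (fun x y => f x * oscInt m j (x - y) * g y) ∧
      Continuous (fun p : ℝ × ℝ => Γ p.1 p.2) ∧
      (∀ N : ℕ, ∃ c : ℝ, ∀ x : ℝ, |x| ^ N * ‖Γ x x‖ ≤ c) ∧
      Integrable (fun x : ℝ => Γ x x) := by
  have hint := integrable_prodDensity' hm hj f g
  have hpd := isPseudoDiffOf_superpose (μ := volume) hm
    (continuous_prodDensity hm j f g).aestronglyMeasurable
    (a := fun w => w.1 + w.2.1) (b := fun w => -w.1 + w.2.2) (by fun_prop) (by fun_prop) hint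
  have hcont := continuous_superpose hint (a := fun w => w.1 + w.2.1) (b := fun w => -w.1 + w.2.2)
    (by fun_prop) (by fun_prop)
  have hdec : ∀ N : ℕ, ∃ c : ℝ, ∀ x : ℝ, |x| ^ N * ‖superpose volume (prodDensity' m j f g)
      (fun w => w.1 + w.2.1) (fun w => -w.1 + w.2.2) x x‖ ≤ c := by
    intro N
    -- The whole power |x|^N is charged to the factor with f; the factor with g need only be
    -- bounded.
    obtain ⟨C₁, hC₁, h₁⟩ := (isFamily_shiftFamily hm f N).exists_fourierInv_le (by norm_num)
    obtain ⟨C₂, hC₂, h₂⟩ := (isFamily_shiftFamily hm g 0).exists_fourierInv_le (by norm_num)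
    obtain ⟨C, hC, h⟩ := exists_oscSymbol_mul_le hm hj hC₁ hC₂
    refine ⟨C * ∫ κ, bracket κ ^ (-1 : ℝ), fun x => ?_⟩
    rw [superpose_prodDensity'_diag hm hj]
    refine pow_mul_norm_integral_le (H := fun κ x => (oscSymbol m j κ : ℂ)
        * (𝓕⁻ (shiftFamily m f κ) x * 𝓕⁻ (shiftFamily m g (-κ)) x)) fun κ => ?_
    have k₂ := h₂ (-κ) x
    rw [bracket_neg, pow_zero, one_mul] at k₂
    have k₁ := h₁ κ x
    have hk := bracket_rpow_pos κ (1 / 4)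
    rw [norm_mul, norm_mul, Complex.norm_real, Real.norm_eq_abs]
    calc _ = |oscSymbol m j κ| * ((|x| ^ N * ‖𝓕⁻ (shiftFamily m f κ) x‖)
          * ‖𝓕⁻ (shiftFamily m g (-κ)) x‖) := by ring
      _ ≤ |oscSymbol m j κ|
          * ((C₁ * bracket κ ^ (1 / 4 : ℝ)) * (C₂ * bracket κ ^ (1 / 4 : ℝ))) := by gcongr
      _ ≤ _ := h κ
  refine ⟨_, ?_, hcont, hdec, ?_⟩
  · have e : superpose volume (prodDensity m j f g) (fun w => w.1 + w.2.1) (fun w => -w.1 + w.2.2)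
        = fun x y => f x * oscInt m j (x - y) * g y :=
      funext fun x => funext fun y => superpose_prodDensity hm j f g x y
    rw [← e]
    exact hpd
  · obtain ⟨c₀, h0⟩ := hdec 0
    obtain ⟨c₂, h2⟩ := hdec 2
    exact integrable_of_sq_mul_le (hcont.comp (by fun_prop : Continuous fun x : ℝ => (x, x)))
      (fun x => by simpa using h0 x) h2

end Product

/-! ### The kernel with f(x) - f(y), j = 3 -/

section Difference

/-- The density of `(f(x) - f(y)) I_3(x - y)` with respect to plane waves. -/
def diffDensity (m : ℝ) (f : 𝓢(ℝ, ℂ)) (w : ℝ × ℝ) : ℂ :=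
  𝓕 f w.2 * ((oscSymbol m 3 w.1 : ℂ) - oscSymbol m 3 (w.1 + w.2))

theorem continuous_diffDensity (hm : 0 < m) (f : 𝓢(ℝ, ℂ)) : Continuous (diffDensity m f) := by
  have hc := (isSymbol_oscSymbol hm 3 0).continuous
  have h1 := (𝓕 f : 𝓢(ℝ, ℂ)).continuous
  unfold diffDensity
  fun_prop

/-- The term with f(x) has frequencies (κ + ζ, -κ), the term with f(y) has (κ, -κ + ζ). The measure
preserving shear κ ↦ κ + ζ aligns the second with the first, and the densities can be subtracted. -/
theorem superpose_diffDensity (hm : 0 < m) (f : 𝓢(ℝ, ℂ)) (x y : ℝ) :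
    superpose volume (diffDensity m f) (fun w => w.1 + w.2) (fun w => -w.1) x y
      = (f x - f y) * oscInt m 3 (x - y) := by
  have hc := (isSymbol_oscSymbol hm 3 0).continuous
  have hcf := (𝓕 f : 𝓢(ℝ, ℂ)).continuous
  set h : ℝ → ℝ × ℝ → ℂ := fun r w =>
    ((oscSymbol m 3 w.1 : ℂ) * wave ((x - y) * w.1)) * (𝓕 f w.2 * wave (r * w.2)) with hh
  have hi : ∀ r, Integrable (h r) := fun r =>
    (integrable_mul_wave (integrable_oscSymbol hm le_rfl) (by fun_prop)).mul_prod
      (integrable_mul_wave (𝓕 f : 𝓢(ℝ, ℂ)).integrable (by fun_prop))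
  have hI : ∀ r, ∫ w, h r w = oscInt m 3 (x - y) * f r := fun r => by
    rw [oscInt_eq hm, schwartz_eq_integral_wave f r, ← integral_prod_mul]
    rfl
  have hmp : MeasurePreserving (fun z : ℝ × ℝ => (z.1 + z.2, z.2)) volume volume :=
    measurePreserving_add_prod volume volume
  have hshear : ∫ w : ℝ × ℝ, h y (w.1 + w.2, w.2) = ∫ w, h y w := by
    conv_rhs => rw [← hmp.map_eq]
    refine (integral_map hmp.measurable.aemeasurable ?_).symm
    rw [hmp.map_eq]
    exact (hi y).aestronglyMeasurable
  have his : Integrable fun w : ℝ × ℝ => h y (w.1 + w.2, w.2) :=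
    (hmp.integrable_comp (hi y).aestronglyMeasurable).2 (hi y)
  calc superpose volume (diffDensity m f) (fun w => w.1 + w.2) (fun w => -w.1) x y
      = ∫ w : ℝ × ℝ, (h x w - h y (w.1 + w.2, w.2)) := by
        refine integral_congr_ae (Filter.Eventually.of_forall fun w => ?_)
        simp only [hh, diffDensity]
        have e1 : wave (x * (w.1 + w.2) + y * -w.1) = wave ((x - y) * w.1) * wave (x * w.2) := by
          rw [← wave_add]; congr 1; ring
        have e2 : wave (x * (w.1 + w.2) + y * -w.1)
            = wave ((x - y) * (w.1 + w.2)) * wave (y * w.2) := by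
          rw [← wave_add]; congr 1; ring
        rw [mul_sub, sub_mul]
        nth_rewrite 1 [e1]
        rw [e2]
        ring
    _ = _ := by
        rw [integral_sub (hi x) his, hshear, hI, hI]
        ring

/-- The family `f̂(ζ) (σ(κ) - σ(κ + ζ)) λ(κ + ζ)`. -/
def diffFamily (m : ℝ) (f : 𝓢(ℝ, ℂ)) (κ ζ : ℝ) : ℂ :=
  𝓕 f ζ * ((oscSymbol m 3 κ : ℂ) - oscSymbol m 3 (κ + ζ))
    * ((disp m (κ + ζ) ^ (1 / 4 : ℝ) : ℝ) : ℂ)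

theorem isFamily_diffFamily (hm : 0 < m) (f : 𝓢(ℝ, ℂ)) (n : ℕ) :
    IsFamily (-5 / 4) (-1) n (diffFamily m f) := by
  -- One derivative more than n is spent on the mean value inequality. The exponent in κ is -1 - 1/2
  -- + 1/4 = -5/4, and the remaining quarter power of `disp` at κ brings it to -1; without the gain
  -- 1/2 it would end at -1/2, which is not integrable.
  have hs := isSymbol_oscSymbol hm 3 (n + 1)
  rw [show ((3 : ℕ) : ℝ) / 2 - 5 / 2 = -1 by norm_num] at hs
  have h := ((isFamily_schwartz (-1 - |1 / 4| - (|-1 - 1 / 2| + 1 / 2)) n (𝓕 f)).mul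
    hs.isFamily_sub).mul (isSymbol_disp_rpow hm n (1 / 4)).isFamily_add
  rwa [sub_add_cancel, sub_add_cancel, show (0 : ℝ) + (-1 - 1 / 2) + 1 / 4 = -5 / 4 by norm_num] at h

/-- The density of the image of `(f(x) - f(y)) I_3(x - y)`. -/
def diffDensity' (m : ℝ) (f : 𝓢(ℝ, ℂ)) (w : ℝ × ℝ) : ℂ :=
  diffDensity m f w * ((disp m (w.1 + w.2) ^ (1 / 4 : ℝ) * disp m (-w.1) ^ (1 / 4 : ℝ) : ℝ) : ℂ)

theorem diffDensity'_eq (m : ℝ) (f : 𝓢(ℝ, ℂ)) (w : ℝ × ℝ) :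
    diffDensity' m f w = ((disp m w.1 ^ (1 / 4 : ℝ) : ℝ) : ℂ) * diffFamily m f w.1 w.2 := by
  simp only [diffDensity', diffDensity, diffFamily, disp_neg]
  push_cast
  ring

theorem exists_disp_mul_le (hm : 0 < m) {C₁ : ℝ} (hC₁ : 0 ≤ C₁) :
    ∃ C, 0 ≤ C ∧ ∀ κ, disp m κ ^ (1 / 4 : ℝ) * (C₁ * bracket κ ^ (-5 / 4 : ℝ))
      ≤ C * bracket κ ^ (-1 : ℝ) := by
  obtain ⟨C, hC, hb⟩ := exists_disp_rpow_le hm (1 / 4)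
  refine ⟨C * C₁, by positivity, fun κ => ?_⟩
  have hk := bracket_rpow_pos κ (-5 / 4)
  calc _ ≤ (C * bracket κ ^ (1 / 4 : ℝ)) * (C₁ * bracket κ ^ (-5 / 4 : ℝ)) := by
        gcongr; exact (le_abs_self _).trans (hb κ)
    _ = C * C₁ * (bracket κ ^ (1 / 4 : ℝ) * bracket κ ^ (-5 / 4 : ℝ)) := by ring
    _ = _ := by rw [← Real.rpow_add (bracket_pos κ)]; norm_num

theorem integrable_diffDensity' (hm : 0 < m) (f : 𝓢(ℝ, ℂ)) : Integrable (diffDensity' m f) := by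
  obtain ⟨C₁, hC₁, h₁⟩ := (isFamily_diffFamily hm f 0).bound
  obtain ⟨C, hC, h⟩ := exists_disp_mul_le hm hC₁
  have hi := integrable_bracket_neg_one
  have hcd := continuous_disp_rpow hm (1 / 4)
  have hcp := continuous_diffDensity hm f
  refine ((hi.const_mul C).mul_prod hi).mono' (Continuous.aestronglyMeasurable ?_)
    (Filter.Eventually.of_forall fun w => ?_)
  · unfold diffDensity'
    have c1 : Continuous fun w : ℝ × ℝ => disp m (w.1 + w.2) ^ (1 / 4 : ℝ) :=
      hcd.comp (by fun_prop)
    have c2 : Continuous fun w : ℝ × ℝ => disp m (-w.1) ^ (1 / 4 : ℝ) := hcd.comp (by fun_prop)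
    fun_prop
  · have hx := bracket_rpow_pos w.2 (-1)
    have hd := Real.rpow_nonneg (disp_pos hm w.1).le (1 / 4)
    rw [diffDensity'_eq, norm_mul, Complex.norm_real, Real.norm_of_nonneg hd]
    calc _ ≤ disp m w.1 ^ (1 / 4 : ℝ)
          * (C₁ * (bracket w.1 ^ (-5 / 4 : ℝ) * bracket w.2 ^ (-1 : ℝ))) := by
          gcongr
          exact h₁ _ _
      _ = disp m w.1 ^ (1 / 4 : ℝ) * (C₁ * bracket w.1 ^ (-5 / 4 : ℝ)) * bracket w.2 ^ (-1 : ℝ) := by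
          ring
      _ ≤ _ := mul_le_mul_of_nonneg_right (h _) (by positivity)

theorem superpose_diffDensity'_diag (hm : 0 < m) (f : 𝓢(ℝ, ℂ)) (x : ℝ) :
    superpose volume (diffDensity' m f) (fun w => w.1 + w.2) (fun w => -w.1) x x
      = ∫ κ, ((disp m κ ^ (1 / 4 : ℝ) : ℝ) : ℂ) * 𝓕⁻ (diffFamily m f κ) x := by
  have hi : Integrable (fun w : ℝ × ℝ => diffDensity' m f w
      * wave (x * (w.1 + w.2) + x * -w.1)) :=
    integrable_mul_wave (integrable_diffDensity' hm f) (by fun_prop)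
  rw [superpose, Measure.volume_eq_prod, integral_prod _ hi]
  congr 1
  ext κ
  rw [fourierInv_eq_integral_wave, ← integral_const_mul]
  refine integral_congr_ae (Filter.Eventually.of_forall fun ζ => ?_)
  simp only [diffDensity'_eq]
  rw [show x * (κ + ζ) + x * -κ = x * ζ by ring, mul_assoc]

theorem exists_kernel_diff (hm : 0 < m) (f : 𝓢(ℝ, ℂ)) : ∃ Γ : ℝ → ℝ → ℂ,
    IsPseudoDiffOf m Γ (fun x y => (f x - f y) * oscInt m 3 (x - y)) ∧
    Continuous (fun p : ℝ × ℝ => Γ p.1 p.2) ∧ Integrable (fun x : ℝ => Γ x x) := by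
  have hint := integrable_diffDensity' hm f
  have hpd := isPseudoDiffOf_superpose (μ := volume) hm
    (continuous_diffDensity hm f).aestronglyMeasurable
    (a := fun w => w.1 + w.2) (b := fun w => -w.1) (by fun_prop) (by fun_prop) hint
  have hcont := continuous_superpose hint (a := fun w => w.1 + w.2) (b := fun w => -w.1)
    (by fun_prop) (by fun_prop)
  have hdec : ∀ N : ℕ, ∃ c : ℝ, ∀ x : ℝ, |x| ^ N * ‖superpose volume (diffDensity' m f)
      (fun w => w.1 + w.2) (fun w => -w.1) x x‖ ≤ c := by
    intro N
    obtain ⟨C₁, hC₁, h₁⟩ := (isFamily_diffFamily hm f N).exists_fourierInv_le (by norm_num)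
    obtain ⟨C, hC, h⟩ := exists_disp_mul_le hm hC₁
    refine ⟨C * ∫ κ, bracket κ ^ (-1 : ℝ), fun x => ?_⟩
    rw [superpose_diffDensity'_diag hm]
    refine pow_mul_norm_integral_le (H := fun κ x =>
      ((disp m κ ^ (1 / 4 : ℝ) : ℝ) : ℂ) * 𝓕⁻ (diffFamily m f κ) x) fun κ => ?_
    have hd := Real.rpow_nonneg (disp_pos hm κ).le (1 / 4)
    rw [norm_mul, Complex.norm_real, Real.norm_of_nonneg hd, mul_left_comm]
    exact (mul_le_mul_of_nonneg_left (h₁ κ x) hd).trans (h κ)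
  refine ⟨_, ?_, hcont, ?_⟩
  · have e : superpose volume (diffDensity m f) (fun w => w.1 + w.2) (fun w => -w.1)
        = fun x y => (f x - f y) * oscInt m 3 (x - y) :=
      funext fun x => funext fun y => superpose_diffDensity hm f x y
    rw [← e]
    exact hpd
  · obtain ⟨c₀, h0⟩ := hdec 0
    obtain ⟨c₂, h2⟩ := hdec 2
    exact integrable_of_sq_mul_le (hcont.comp (by fun_prop : Continuous fun x : ℝ => (x, x)))
      (fun x => by simpa using h0 x) h2

end Difference

end Kernels

end Kink

end

theorem theorem2p8 (m : ℝ) (hm : 0 < m) :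
    (∀ θ : ℝ, 0 < θ → ∃ C₀ Cθ D : Kink.L2R →L[ℂ] Kink.L2R,
      (Kink.IsBoundedInverse (Kink.K₀ m) C₀ ∧ 0 ≤ C₀) ∧
      (Kink.IsBoundedInverse (Kink.Kθ m θ) Cθ ∧ 0 ≤ Cθ) ∧
      Kink.IsBoundedInverse (Kink.comparison m θ C₀) D ∧
      Kink.IsTraceClassOp (Kink.sandwich C₀ (Kink.bpow Cθ (1 / 2) - Kink.bpow C₀ (1 / 2))) ∧
      Kink.IsTraceClassOp (Kink.sandwich C₀ (D - Kink.bpow C₀ (1 / 2))) ∧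
      Kink.IsTraceClassOp (Kink.sandwich C₀ (Kink.bpow Cθ (1 / 2) - D))) ∧
    (∀ f g : 𝓢(ℝ, ℂ), ∀ j : ℕ, j ≤ 2 → ∃ Γ : ℝ → ℝ → ℂ,
      Kink.IsPseudoDiffOf m Γ (fun x y => f x * Kink.oscInt m j (x - y) * g y) ∧
      Continuous (fun p : ℝ × ℝ => Γ p.1 p.2) ∧
      (∀ N : ℕ, ∃ c : ℝ, ∀ x : ℝ, |x| ^ N * ‖Γ x x‖ ≤ c) ∧
      Integrable (fun x : ℝ => Γ x x)) ∧
    (∀ f : 𝓢(ℝ, ℂ), ∃ Γ : ℝ → ℝ → ℂ,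
      Kink.IsPseudoDiffOf m Γ (fun x y => (f x - f y) * Kink.oscInt m 3 (x - y)) ∧
      Continuous (fun p : ℝ × ℝ => Γ p.1 p.2) ∧
      Integrable (fun x : ℝ => Γ x x)) := by
  exact ⟨fun θ hθ => Kink.exists_operators hm hθ,
    fun f g j hj => Kink.exists_kernel_prod hm f g hj, fun f => Kink.exists_kernel_diff hm f⟩
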